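/- Let $H$ be a finite simple graph. For a finite graph $G$ with vertex set $V$, the \emph{$H$-dynamics} started at $G_0=G$ is given by: $G_{t}$ is obtained from $G_{t-1}$ by adding every edge $e$ of the complete graph $K_V$ such that some copy of $H$ in $K_V$ contains $e$ and has all its other edges in $G_{t-1}$. Put $\langle G\rangle_H=\bigcup_{t\ge 0}G_t$, and say that $G$ is \emph{$H$-percolating} if $\langle G\rangle_H=K_V$. Let $$\rho(H)=\inf_{(e,A)}\ \max_{F}\ \frac{e(F)-1}{v(F)-2},$$ where the infimum is over all finite graphs $A$ and all edges $e\in\langle A\rangle_H\setminus A$, the maximum is over all subgraphs $F\subseteq A\cup e$ that properly contain the edge $e$, and $e(F)$, $v(F)$ are the numbers of edges and vertices of $F$. Let $G_{n,p}$ be the binomial random graph on $n$ vertices, let $p_c(n,H)=\inf\{p>0:\mathbb P(\langle G_{n,p}\rangle_H=K_n)\ge 1/2\}$, and let $(\mathcal G_m)_{0\le m\le\binom n2}$ be the random graph process on $n$ vertices, which starts at the empty graph and in each step adds a uniformly random missing edge. Suppose that $\rho(H)=1$ and that $H$ has minimum degree $\delta(H)=2$. Then, with probability tending to $1$ as $n\to\infty$,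 the first $m$ for which $\mathcal G_m$ is $H$-percolating equals the first $m$ for which $\mathcal G_m$ is connected. In particular, $p_c(n,H)\sim \log n/n$ as $n\to\infty$, and the threshold is sharp: for every $\varepsilon>0$ and every sequence $p_n\in[0,1]$, the probability that $G_{n,p_n}$ is $H$-percolating tends to $0$ if $p_n\le(1-\varepsilon)\,p_c(n,H)$ for all large $n$, and tends to $1$ if $p_n\ge(1+\varepsilon)\,p_c(n,H)$ for all large $n$. -/

import Mathlib

open Filter Topology Asymptotics
open scoped ENNReal

/-- The edge `e` completes a copy of `H` over `G`: there is a copy of `H` in the complete graph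
on the vertex set of `G` which contains `e` and all of whose other edges lie in `G`. -/
def CompletesCopy {W V : Type*} (H : SimpleGraph W) (G : SimpleGraph V) (e : Sym2 V) : Prop :=
  ∃ φ : SimpleGraph.Copy H (⊤ : SimpleGraph V),
    e ∈ φ.toSubgraph.edgeSet ∧ φ.toSubgraph.edgeSet \ {e} ⊆ G.edgeSet

/-- One step of the `H`-dynamics: all edges which complete a copy of `H` are activated. -/
def dynamicsStep {W V : Type*} (H : SimpleGraph W) (G : SimpleGraph V) : SimpleGraph V :=
  G ⊔ SimpleGraph.fromEdgeSet {e | CompletesCopy H G e}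

/-- The graph `⟨G⟩_H` of all eventually active edges of the `H`-dynamics started at `G`. -/
def dynamicsClosure {W V : Type*} (H : SimpleGraph W) (G : SimpleGraph V) : SimpleGraph V :=
  ⨆ t : ℕ, (dynamicsStep H)^[t] G

/-- `G` is weakly `H`-saturated (the `H`-dynamics started at `G` percolates): `⟨G⟩_H` is the
complete graph. -/
def Percolates {W V : Type*} (H : SimpleGraph W) (G : SimpleGraph V) : Prop :=
  dynamicsClosure H G = ⊤

/-- The critical `H`-activation density `ρ(H)`: the infimum, over all finite graphs `A` and all
edges `e` in `⟨A⟩_H` but not in `A`, of the maximum of `(e(F) - 1) / (v(F) - 2)` over the subgraphs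
`F` of `A ∪ e` which properly contain the edge `e` (so that `v(F) ≥ 3`).
The value is `∞` if there is no such pair `(e, A)`. -/
noncomputable def activationDensity {W : Type*} (H : SimpleGraph W) : ℝ≥0∞ :=
  ⨅ (k : ℕ) (A : SimpleGraph (Fin k)) (e : Sym2 (Fin k))
    (_ : e ∈ (dynamicsClosure H A).edgeSet \ A.edgeSet),
    ⨆ (F : (A ⊔ SimpleGraph.fromEdgeSet {e}).Subgraph)
      (_ : e ∈ F.edgeSet) (_ : 3 ≤ F.verts.ncard),
      ENNReal.ofReal (((F.edgeSet.ncard : ℝ) - 1) / ((F.verts.ncard : ℝ) - 2))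

/-- The critical `H`-percolation threshold `p_c(n, H) = inf {p > 0 : P(⟨G(n,p)⟩_H = K_n) ≥ 1/2}`,
where `G(n,p)` is the binomial random graph. -/
noncomputable def criticalThreshold {W : Type*} (H : SimpleGraph W) (n : ℕ) : ℝ :=
  sInf {x : ℝ | ∃ p : unitInterval, (p : ℝ) = x ∧ 0 < x ∧
    1 / 2 ≤ SimpleGraph.binomialRandom (Fin n) p {G | Percolates H G}}

/-- An ordering of the edges of the complete graph on `n` vertices. -/
abbrev EdgeOrdering (n : ℕ) : Type :=
  Fin (n.choose 2) ≃ (⊤ : SimpleGraph (Fin n)).edgeSet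

/-- The graph at time `m` of the graph process given by an edge ordering: its edges are the first
`m` edges of the ordering (and it is complete for all `m ≥ n.choose 2`). -/
def processGraph {n : ℕ} (π : EdgeOrdering n) (m : ℕ) : SimpleGraph (Fin n) :=
  SimpleGraph.fromEdgeSet {e | ∃ i : Fin (n.choose 2), (i : ℕ) < m ∧ (π i : Sym2 (Fin n)) = e}

/-- The probability of an event of the random graph process: all edge orderings are
equally likely, that is, in each step a uniformly random missing edge is added. -/
noncomputable def processProb (n : ℕ) (E : Set (EdgeOrdering n)) : ℝ :=
  (E.ncard : ℝ) / (Nat.card (EdgeOrdering n) : ℝ)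

/-- The first time at which the graph process has the property `P`. -/
noncomputable def hittingTime {n : ℕ} (P : SimpleGraph (Fin n) → Prop) (π : EdgeOrdering n) : ℕ :=
  sInf {m : ℕ | P (processGraph π m)}

/-! ### Closed graphs and the closure of the dynamics -/

section Dynamics

variable {W V : Type*}

/-! Necessity is easy: if every vertex of `H` has degree at least two, an edge at `v` is activated
only when another edge at `v` is already active, so isolated vertices stay isolated. For sufficiency
there is a fixed finite graph `B`, the gadget, such that every connected graph containing `B`
percolates (`exists_isSparse_forall_percolates`), and `B` appears in the process well before
connectivity.

The hypothesis on the density is used through `exists_isSparse_deleteEdge`: for some edge `xy`,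
every vertex set spans at most as many edges of `H - xy` as it has elements. So `H` has at most one
more edge than vertices, and the degrees exceed two by at most two in total. The gadget is `H - xy`
with many long pendant paths at each vertex, together with a disjoint triangle. Each extra vertex
brings one edge, so `B` is sparse too, and the second moment method finds it once the average degree
tends to infinity (`freq_not_contains_le`).

The deterministic core is `HasLegs.eq_top`. In a closed graph the gadget completes `H`; re-embedding
parts of `H` along the pendant paths produces a large complete bipartite graph, and a large clique
when `H` is not bipartite. A degree-two vertex of `H` then lets such a core absorb everything
connected to it (`IsDynamicsClosed.absorb`). For bipartite `H` the triangle is what merges the two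
sides.

For the hitting times, look at density `(4/5) log n / n`. With high probability `B` is present, some
vertex is isolated, no component has between two and `n/2` vertices, and no two isolated vertices
will have the edge between them as the first new edge at either. Until then neither property holds;
afterwards absence of isolated vertices already forces connectivity (`processGraph_connected`), so
connectivity and percolation hold at exactly the same times. The statements about `G(n,p)` follow
from the process at densities `c log n / n` with `c < 1` and `c > 1`, since the number of edges is
concentrated. -/

/-- `G` is closed under completing copies of `H`. -/
def IsDynamicsClosed (H : SimpleGraph W) (G : SimpleGraph V) : Prop :=
  ∀ ψ : W → V, Function.Injective ψ → ∀ x y, H.Adj x y →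
    (∀ a b, H.Adj a b → s(a, b) ≠ s(x, y) → G.Adj (ψ a) (ψ b)) → G.Adj (ψ x) (ψ y)

lemma completesCopy_iff {H : SimpleGraph W} {G : SimpleGraph V} {e : Sym2 V} :
    CompletesCopy H G e ↔ ∃ ψ : W → V, Function.Injective ψ ∧ ∃ x y, H.Adj x y ∧
      e = s(ψ x, ψ y) ∧ ∀ a b, H.Adj a b → s(a, b) ≠ s(x, y) → G.Adj (ψ a) (ψ b) := by
  constructor
  · rintro ⟨φ, he, h⟩
    refine ⟨φ, φ.injective, ?_⟩
    induction e using Sym2.ind with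
    | _ u v =>
    rw [SimpleGraph.Subgraph.mem_edgeSet] at he
    simp only [SimpleGraph.Copy.toSubgraph, SimpleGraph.Subgraph.map_adj] at he
    obtain ⟨x, y, hxy, rfl, rfl⟩ := he
    refine ⟨x, y, hxy, rfl, fun a b hab hne => ?_⟩
    have : s(φ a, φ b) ∈ φ.toSubgraph.edgeSet \ {s(φ x, φ y)} := by
      refine ⟨?_, fun h' => hne ?_⟩
      · rw [SimpleGraph.Subgraph.mem_edgeSet]
        simp only [SimpleGraph.Copy.toSubgraph, SimpleGraph.Subgraph.map_adj]
        exact ⟨a, b, hab, rfl, rfl⟩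
      · have := Sym2.map.injective φ.injective (a₁ := s(a, b)) (a₂ := s(x, y))
        exact this (by simpa using h')
    exact h this
  · rintro ⟨ψ, hψ, x, y, hxy, rfl, h⟩
    let φ : SimpleGraph.Copy H (⊤ : SimpleGraph V) :=
      ⟨⟨ψ, fun {a b} hab => by simpa using hψ.ne hab.ne⟩, hψ⟩
    refine ⟨φ, ?_, ?_⟩
    · rw [SimpleGraph.Subgraph.mem_edgeSet]
      simp only [SimpleGraph.Copy.toSubgraph, SimpleGraph.Subgraph.map_adj]
      exact ⟨x, y, hxy, rfl, rfl⟩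
    · rintro e ⟨he, hne⟩
      induction e using Sym2.ind with
      | _ u v =>
      rw [SimpleGraph.Subgraph.mem_edgeSet] at he
      simp only [SimpleGraph.Copy.toSubgraph, SimpleGraph.Subgraph.map_adj] at he
      obtain ⟨a, b, hab, rfl, rfl⟩ := he
      refine h a b hab fun h' => hne ?_
      exact congrArg (Sym2.map ψ) h'

lemma le_dynamicsStep (H : SimpleGraph W) (G : SimpleGraph V) : G ≤ dynamicsStep H G :=
  le_sup_left

lemma dynamicsStep_iterate_mono (H : SimpleGraph W) (G : SimpleGraph V) :
    Monotone fun t : ℕ => (dynamicsStep H)^[t] G :=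
  monotone_nat_of_le_succ fun t => by
    rw [Function.iterate_succ_apply']
    exact le_dynamicsStep H _

lemma le_dynamicsClosure (H : SimpleGraph W) (G : SimpleGraph V) : G ≤ dynamicsClosure H G :=
  le_iSup (fun t : ℕ => (dynamicsStep H)^[t] G) 0

lemma dynamicsClosure_adj {H : SimpleGraph W} {G : SimpleGraph V} {u v : V} :
    (dynamicsClosure H G).Adj u v ↔ ∃ t : ℕ, ((dynamicsStep H)^[t] G).Adj u v := by
  simp [dynamicsClosure, SimpleGraph.iSup_adj]

/-- Since `H` is finite, the edges needed for a copy are all active at one common time, and the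
missing edge is activated one step later. -/
lemma isDynamicsClosed_dynamicsClosure [Finite W] (H : SimpleGraph W) (G : SimpleGraph V) :
    IsDynamicsClosed H (dynamicsClosure H G) := by
  classical
  cases nonempty_fintype W
  intro ψ hψ x y hxy h
  have key : ∀ p : W × W, ∃ t : ℕ, H.Adj p.1 p.2 → s(p.1, p.2) ≠ s(x, y) →
      ((dynamicsStep H)^[t] G).Adj (ψ p.1) (ψ p.2) := by
    intro p
    by_cases h1 : H.Adj p.1 p.2
    · by_cases h2 : s(p.1, p.2) ≠ s(x, y)
      · obtain ⟨t, ht⟩ := dynamicsClosure_adj.1 (h _ _ h1 h2)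
        exact ⟨t, fun _ _ => ht⟩
      · exact ⟨0, fun _ h => absurd h h2⟩
    · exact ⟨0, fun h => absurd h h1⟩
  choose t ht using key
  refine dynamicsClosure_adj.2 ⟨Finset.univ.sup t + 1, ?_⟩
  rw [Function.iterate_succ_apply']
  refine Or.inr ?_
  rw [SimpleGraph.fromEdgeSet_adj]
  refine ⟨completesCopy_iff.2 ⟨ψ, hψ, x, y, hxy, rfl, fun a b hab hne => ?_⟩, hψ.ne hxy.ne⟩
  exact dynamicsStep_iterate_mono H G (Finset.le_sup (Finset.mem_univ (a, b))) (ht (a, b) hab hne)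

/-- If `H` has minimum degree at least two, then isolated vertices stay isolated. -/
lemma dynamicsClosure_isolated {H : SimpleGraph W}
    (hH : ∀ x y, H.Adj x y → ∃ z, z ≠ y ∧ H.Adj x z) {G : SimpleGraph V} {v : V}
    (hv : ∀ u, ¬ G.Adj v u) (u : V) : ¬ (dynamicsClosure H G).Adj v u := by
  rw [dynamicsClosure_adj]
  rintro ⟨t, ht⟩
  induction t generalizing u with
  | zero => exact hv u ht
  | succ t ih =>
    rw [Function.iterate_succ_apply'] at ht
    rcases ht with ht | ht
    · exact ih u ht
    · rw [SimpleGraph.fromEdgeSet_adj] at ht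
      obtain ⟨ψ, hψ, x, y, hxy, he, h⟩ := completesCopy_iff.1 ht.1
      have aux : ∀ x y, H.Adj x y → v = ψ x →
          (∀ a b, H.Adj a b → s(a, b) ≠ s(x, y) → ((dynamicsStep H)^[t] G).Adj (ψ a) (ψ b)) →
          False := by
        rintro x y hxy rfl h
        -- The vertex of `H` placed at `v` has a second neighbour, whose edge would have to be
        -- active already.
        obtain ⟨z, hzy, hxz⟩ := hH x y hxy
        exact ih _ (h x z hxz fun h' => hzy (Sym2.congr_right.1 h'))
      rcases Sym2.eq_iff.1 he with ⟨h1, -⟩ | ⟨h1, -⟩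
      · exact aux x y hxy h1 h
      · exact aux y x hxy.symm h1 fun a b hab hne => h a b hab (by rwa [Sym2.eq_swap (a := x)])

end Dynamics

/-! ### Absorbing a connected graph into a clique or a biclique -/

section Absorption

variable {W V ι : Type*}

lemma SimpleGraph.Preconnected.forall_of_adj {G : SimpleGraph V} (hG : G.Preconnected)
    {P : V → Prop} {a : V} (ha : P a) (h : ∀ u v, G.Adj u v → P u → P v) (v : V) : P v := by
  have := (SimpleGraph.reachable_iff_reflTransGen a v).1 (hG a v)
  induction this with
  | refl => exact ha
  | tail _ h1 ih => exact h _ _ h1 ih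

/-- This places the unconstrained vertices of `H` in prescribed blocks, away from a few forbidden
vertices. One embedding of all of `W` is chosen per block; disjointness of the blocks makes the
combined map injective. -/
lemma exists_injective_mem_of_card [Fintype W] [DecidableEq V] {S : ι → Finset V}
    (hS : Pairwise fun i j => Disjoint (S i) (S j)) (χ : W → ι) (F : Finset V)
    (hcard : ∀ i, Fintype.card W + F.card ≤ (S i).card) :
    ∃ g : W → V, Function.Injective g ∧ ∀ a, g a ∈ S (χ a) ∧ g a ∉ F := by
  have h1 : ∀ i, Nonempty (W ↪ {x // x ∈ S i \ F}) := fun i => by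
    apply Function.Embedding.nonempty_of_card_le
    rw [Fintype.card_coe]
    have := Finset.le_card_sdiff F (S i)
    have := hcard i
    omega
  let f i := (h1 i).some
  have hf : ∀ i a, (f i a : V) ∈ S i ∧ (f i a : V) ∉ F := fun i a => by
    exact Finset.mem_sdiff.1 (f i a).2
  refine ⟨fun a => f (χ a) a, fun a b hab => ?_, fun a => hf _ _⟩
  by_cases h : χ a = χ b
  · have : (f (χ a) a : V) = f (χ b) b := hab
    rw [← h] at this
    exact (f (χ a)).injective (Subtype.ext this)
  · exact absurd (show (f (χ a) a : V) = f (χ b) b from hab)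
      (Finset.disjoint_iff_ne.1 (hS h) _ (hf _ a).1 _ (hf _ b).1)

/-- A vertex of degree two of `H` whose neighbours are `z₁` and `z₂`. -/
def HasTwoNeighbors (H : SimpleGraph W) (w z₁ z₂ : W) : Prop :=
  z₁ ≠ z₂ ∧ ∀ a, H.Adj w a ↔ a = z₁ ∨ a = z₂

lemma HasTwoNeighbors.symm {H : SimpleGraph W} {w z₁ z₂ : W} (h : HasTwoNeighbors H w z₁ z₂) :
    HasTwoNeighbors H w z₂ z₁ :=
  ⟨h.1.symm, fun a => by rw [h.2, or_comm]⟩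

/-- Put the degree-two vertex `w` at `v`, its neighbours `z₁`, `z₂` at `u`, `x`, and the rest of `H`
in the core given by `S`. Every edge of this copy except `vx` is present, so `vx` is too. The effect
is that a neighbour of `u` becomes a neighbour of `x`. The three extra elements per block leave room
to avoid `u`, `x`, `v`. -/
lemma IsDynamicsClosed.absorb [Fintype W] {H : SimpleGraph W} {G : SimpleGraph V}
    (hG : IsDynamicsClosed H G) {w z₁ z₂ : W} (hw : HasTwoNeighbors H w z₁ z₂)
    {S : ι → Finset V} (hS : Pairwise fun i j => Disjoint (S i) (S j)) (χ : W → ι)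
    (hcard : ∀ i, Fintype.card W + 3 ≤ (S i).card)
    (hSG : ∀ a b, H.Adj a b → ∀ s ∈ S (χ a), ∀ t ∈ S (χ b), s ≠ t → G.Adj s t)
    {u x v : V} (hux : u ≠ x) (hvu : G.Adj v u) (hvx : v ≠ x)
    (hu : ∀ a, H.Adj z₁ a → ∀ s ∈ S (χ a), s ≠ u → G.Adj u s)
    (hx : ∀ a, H.Adj z₂ a → ∀ s ∈ S (χ a), s ≠ x → G.Adj x s)
    (hz : H.Adj z₁ z₂ → G.Adj u x) : G.Adj v x := by
  classical
  obtain ⟨g, hginj, hg⟩ := exists_injective_mem_of_card hS χ {u, x, v}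
    (fun i => le_trans (by gcongr; exact Finset.card_le_three) (hcard i))
  have hgu : ∀ a, g a ≠ u := fun a h => (hg a).2 (by simp [h])
  have hgx : ∀ a, g a ≠ x := fun a h => (hg a).2 (by simp [h])
  have hgv : ∀ a, g a ≠ v := fun a h => (hg a).2 (by simp [h])
  have hwz₁ : H.Adj w z₁ := (hw.2 _).2 (Or.inl rfl)
  have hwz₂ : H.Adj w z₂ := (hw.2 _).2 (Or.inr rfl)
  have hz₁₂ := hw.1
  let ψ : W → V := fun a => if a = w then v else if a = z₁ then u else if a = z₂ then x else g a
  have hψw : ψ w = v := by simp [ψ]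
  have hψz₁ : ψ z₁ = u := by simp [ψ, hwz₁.ne']
  have hψz₂ : ψ z₂ = x := by simp [ψ, hwz₂.ne', hz₁₂.symm]
  have hψ : ∀ a, a ≠ w → a ≠ z₁ → a ≠ z₂ → ψ a = g a := fun a h1 h2 h3 => by simp [ψ, h1, h2, h3]
  have hinj : Function.Injective ψ := by
    intro a b hab
    simp only [ψ] at hab
    have := hvu.ne
    split_ifs at hab <;> first | (subst_vars; rfl) | (exact hginj hab) | (exfalso; subst_vars; grind)
  have half : ∀ a b, H.Adj a b → b ≠ w → a ≠ w → a = z₁ ∨ a = z₂ → G.Adj (ψ a) (ψ b) := by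
    rintro a b hab hb ha (rfl | rfl)
    · by_cases hb₂ : b = z₂
      · subst hb₂; rw [hψz₁, hψz₂]; exact hz hab
      · rw [hψz₁, hψ b hb hab.ne' hb₂]
        exact hu b hab _ (hg b).1 (hgu b)
    · by_cases hb₂ : b = z₁
      · subst hb₂; rw [hψz₁, hψz₂]; exact (hz hab.symm).symm
      · rw [hψz₂, hψ b hb hb₂ hab.ne']
        exact hx b hab _ (hg b).1 (hgx b)
  have main := hG ψ hinj w z₂ hwz₂ fun a b hab hne => by
    by_cases haw : a = w
    · subst haw
      rcases (hw.2 b).1 hab with rfl | rfl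
      · rwa [hψw, hψz₁]
      · exact absurd rfl hne
    by_cases hbw : b = w
    · subst hbw
      rcases (hw.2 a).1 hab.symm with rfl | rfl
      · rw [hψw, hψz₁]; exact hvu.symm
      · exact absurd Sym2.eq_swap hne
    by_cases ha : a = z₁ ∨ a = z₂
    · exact half a b hab hbw haw ha
    by_cases hb : b = z₁ ∨ b = z₂
    · exact (half b a hab.symm haw hbw hb).symm
    push Not at ha hb
    rw [hψ a haw ha.1 ha.2, hψ b hbw hb.1 hb.2]
    exact hSG a b hab _ (hg a).1 _ (hg b).1 (hginj.ne hab.ne)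
  rwa [hψw, hψz₂] at main

/-- A connected closed graph which contains a large clique is complete. -/
lemma IsDynamicsClosed.eq_top_of_clique [Fintype W] {H : SimpleGraph W} {G : SimpleGraph V}
    (hG : IsDynamicsClosed H G) (hconn : G.Preconnected) {w z₁ z₂ : W}
    (hw : HasTwoNeighbors H w z₁ z₂) {K : Finset V} (hcard : Fintype.card W + 3 ≤ K.card)
    (hK : ∀ s ∈ K, ∀ t ∈ K, s ≠ t → G.Adj s t) : G = ⊤ := by
  classical
  let S : Unit → Finset V := fun _ => K
  have hS : Pairwise fun i j => Disjoint (S i) (S j) := fun i j h => absurd rfl h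
  -- Neighbours pass from `u` to `x` when both are joined to all of `K`; one of them lying in `K`
  -- supplies the edge `ux`, which is needed when `z₁` and `z₂` are adjacent.
  have key : ∀ u x v, (∀ s ∈ K, s ≠ u → G.Adj u s) → (∀ s ∈ K, s ≠ x → G.Adj x s) →
      (u ∈ K ∨ x ∈ K) → G.Adj v u → v ≠ x → G.Adj v x := by
    intro u x v hu hx hux hvu hvx
    by_cases h : u = x
    · exact h ▸ hvu
    · refine hG.absorb hw hS (fun _ => ()) (fun _ => hcard) (fun _ _ _ => hK) h hvu hvx
        (fun _ _ => hu) (fun _ _ => hx) fun _ => ?_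
      rcases hux with h' | h'
      · exact (hx u h' h).symm
      · exact hu x h' (Ne.symm h)
  -- Being joined to all of `K` spreads along edges, hence to the whole connected graph.
  have hX : ∀ v, ∀ s ∈ K, s ≠ v → G.Adj v s := by
    obtain ⟨s₀, hs₀⟩ : K.Nonempty := Finset.card_pos.1 (by omega)
    refine hconn.forall_of_adj (a := s₀) (fun s hs h => hK _ hs₀ _ hs h.symm) ?_
    intro u v huv hu s hs hsv
    exact key u s v hu (fun t ht h => hK s hs t ht h.symm) (Or.inr hs) huv.symm hsv.symm
  ext v u
  rw [SimpleGraph.top_adj]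
  refine ⟨fun h => h.ne, fun h => ?_⟩
  obtain ⟨s, hs, hs'⟩ : ∃ s ∈ K, s ∉ ({u, v} : Finset V) := by
    apply Finset.exists_mem_notMem_of_card_lt_card
    have := Finset.card_le_two (a := u) (b := v)
    omega
  exact key s u v (fun t ht h => hK s hs t ht h.symm) (hX u) (Or.inl hs)
    (hX v s hs (by simp at hs'; tauto)) h

/-- If `H` is bipartite, then a connected closed graph which contains a large complete bipartite
graph and a triangle is complete. -/
lemma IsDynamicsClosed.eq_top_of_biclique [Fintype W] {H : SimpleGraph W} {G : SimpleGraph V}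
    (hG : IsDynamicsClosed H G) (hconn : G.Preconnected) {w z₁ z₂ : W}
    (hw : HasTwoNeighbors H w z₁ z₂) {χ : W → Bool} (hχ : ∀ a b, H.Adj a b → χ a ≠ χ b)
    {S : Bool → Finset V} (hS : Disjoint (S true) (S false))
    (hcard : ∀ i, Fintype.card W + 3 ≤ (S i).card)
    (hSG : ∀ s ∈ S true, ∀ t ∈ S false, G.Adj s t)
    {c₁ c₂ c₃ : V} (h₁₂ : G.Adj c₁ c₂) (h₂₃ : G.Adj c₂ c₃) (h₁₃ : G.Adj c₁ c₃) : G = ⊤ := by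
  classical
  have hS' : Pairwise fun i j => Disjoint (S i) (S j) := by
    rintro (_ | _) (_ | _) h
    exacts [absurd rfl h, hS.symm, hS, absurd rfl h]
  have hSG' : ∀ i, ∀ s ∈ S i, ∀ t ∈ S (!i), G.Adj s t := by
    rintro (_ | _) s hs t ht
    · exact (hSG t ht s hs).symm
    · exact hSG s hs t ht
  -- Swapping the two colours everywhere makes the colour of `w` prescribable, so the core can be
  -- used from either side.
  have hχ' : ∀ i : Bool, ∃ χ : W → Bool, (∀ a b, H.Adj a b → χ b = !(χ a)) ∧ χ w = i := by
    intro i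
    refine ⟨fun a => xor (χ a) (xor (χ w) i), fun a b hab => ?_, by simp⟩
    have := hχ a b hab
    cases h1 : χ a <;> cases h2 : χ b <;> simp_all
  have key : ∀ i, ∀ u x v, (∀ s ∈ S (!i), s ≠ u → G.Adj u s) → (∀ s ∈ S (!i), s ≠ x → G.Adj x s) →
      G.Adj v u → v ≠ x → G.Adj v x := by
    intro i u x v hu hx hvu hvx
    by_cases h : u = x
    · exact h ▸ hvu
    obtain ⟨χ, hχ, hχw⟩ := hχ' (!i)
    have hz₁ : χ z₁ = i := by rw [hχ w z₁ ((hw.2 _).2 (Or.inl rfl)), hχw, Bool.not_not]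
    have hz₂ : χ z₂ = i := by rw [hχ w z₂ ((hw.2 _).2 (Or.inr rfl)), hχw, Bool.not_not]
    refine hG.absorb hw hS' χ hcard ?_ h hvu hvx ?_ ?_ ?_
    · intro a b hab s hs t ht _
      rw [hχ a b hab] at ht
      exact hSG' _ s hs t ht
    · intro a ha
      rwa [hχ _ _ ha, hz₁]
    · intro a ha
      rwa [hχ _ _ ha, hz₂]
    · intro ha
      have := hχ _ _ ha
      rw [hz₁, hz₂] at this
      cases i <;> simp at this
  -- `X i v` says that `v` can play the role of a vertex of `S i`. Moving along an edge switches the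
  -- side.
  let X : Bool → V → Prop := fun i v => ∀ s ∈ S (!i), s ≠ v → G.Adj v s
  have hSX : ∀ i, ∀ s ∈ S i, X i s := fun i s hs t ht _ => hSG' i s hs t ht
  have step : ∀ i u v, G.Adj u v → X i u → X (!i) v := by
    intro i u v huv hu s hs hsv
    rw [Bool.not_not] at hs
    exact key i u s v hu (hSX i s hs) huv.symm hsv.symm
  have cover : ∀ v, X true v ∨ X false v := by
    obtain ⟨s₀, hs₀⟩ : (S true).Nonempty := Finset.card_pos.1 (by have := hcard true; omega)
    refine hconn.forall_of_adj (a := s₀) (Or.inl (hSX _ _ hs₀)) ?_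
    rintro u v huv (h | h)
    · exact Or.inr (step _ u v huv h)
    · exact Or.inl (step _ u v huv h)
  -- An edge between two vertices of the same type gives one of its ends the other type as well.
  have both : ∀ i a b, G.Adj a b → X i a → X i b → ∃ a, X true a ∧ X false a := by
    intro i a b hab ha hb
    refine ⟨a, ?_⟩
    have := step i b a hab.symm hb
    cases i
    · exact ⟨this, ha⟩
    · exact ⟨ha, this⟩
  -- Two of the three corners of the triangle have the same type. Having both types then spreads
  -- along edges.
  obtain ⟨a, ha⟩ : ∃ a, X true a ∧ X false a := by
    rcases cover c₁ with h1 | h1 <;> rcases cover c₂ with h2 | h2 <;> rcases cover c₃ with h3 | h3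
    all_goals first
      | exact both _ _ _ h₁₂ h1 h2 | exact both _ _ _ h₂₃ h2 h3 | exact both _ _ _ h₁₃ h1 h3
  have all : ∀ v, X true v ∧ X false v :=
    hconn.forall_of_adj ha fun u v huv h => ⟨step _ u v huv h.2, step _ u v huv h.1⟩
  ext v u
  rw [SimpleGraph.top_adj]
  refine ⟨fun h => h.ne, fun h => ?_⟩
  obtain ⟨s, hs, hs'⟩ : ∃ s ∈ S true, s ∉ ({u, v} : Finset V) := by
    apply Finset.exists_mem_notMem_of_card_lt_card
    have := Finset.card_le_two (a := u) (b := v)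
    have := hcard true
    omega
  exact key true s u v (hSX true s hs) (all u).1 ((all v).2 s hs (by simp at hs'; tauto)) h

end Absorption

/-! ### Pendant paths generate bicliques and cliques -/

section Legs

variable {W V J : Type*}

/-- `leg v j 0, …, leg v j L` are paths in `G` which start at `leg v j 0 = φ v` and are otherwise
disjoint. -/
structure HasLegs (G : SimpleGraph V) (φ : W → V) (L : ℕ) (leg : W → J → ℕ → V) : Prop where
  zero : ∀ v j, leg v j 0 = φ v
  adj : ∀ v j t, t < L → G.Adj (leg v j t) (leg v j (t + 1))
  inj : ∀ v j t v' j' t', t ≤ L → t' ≤ L → leg v j t = leg v' j' t' →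
    t = t' ∧ v = v' ∧ (t = 0 ∨ j = j')

namespace HasLegs

variable {G : SimpleGraph V} {φ : W → V} {L : ℕ} {leg : W → J → ℕ → V}

lemma adj_root (h : HasLegs G φ L leg) (hL : 1 ≤ L) (v : W) (j : J) : G.Adj (φ v) (leg v j 1) :=
  h.zero v j ▸ h.adj v j 0 hL

lemma injective [Nonempty J] (h : HasLegs G φ L leg) : Function.Injective φ := fun a b hab => by
  obtain ⟨j⟩ := ‹Nonempty J›
  rw [← h.zero a j, ← h.zero b j] at hab
  exact (h.inj _ _ _ _ _ _ (Nat.zero_le _) (Nat.zero_le _) hab).2.1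

lemma root_ne (h : HasLegs G φ L leg) {v a : W} {j : J} {t : ℕ} (ht : t ≤ L) (h0 : t ≠ 0) :
    φ a ≠ leg v j t := fun hab => by
  rw [← h.zero a j] at hab
  exact h0 (h.inj _ _ _ _ _ _ (Nat.zero_le _) ht hab).1.symm

lemma leg_ne (h : HasLegs G φ L leg) {v v' : W} {j j' : J} {t t' : ℕ} (ht : t ≤ L) (ht' : t' ≤ L)
    (h0 : t ≠ 0) (hne : (v, j, t) ≠ (v', j', t')) : leg v j t ≠ leg v' j' t' := fun hab => by
  have := h.inj _ _ _ _ _ _ ht ht' hab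
  apply hne
  ext <;> simp <;> tauto

end HasLegs

/-- `G` contains a complete bipartite graph with parts of size `s`. -/
def HasBiclique (G : SimpleGraph V) (s : ℕ) : Prop :=
  ∃ S : Bool → Finset V, Disjoint (S true) (S false) ∧ (∀ i, (S i).card = s) ∧
    ∀ a ∈ S true, ∀ b ∈ S false, G.Adj a b

/-- `G` contains a complete graph on `s` vertices. -/
def HasClique (G : SimpleGraph V) (s : ℕ) : Prop :=
  ∃ K : Finset V, K.card = s ∧ ∀ a ∈ K, ∀ b ∈ K, a ≠ b → G.Adj a b

/-- The Boolean index reserves separate legs for the two sides, even when both sides use legs at the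
same root. -/
lemma hasBiclique_of_injective {G : SimpleGraph V} {s : ℕ} {g : Bool × Fin s → V}
    (hg : Function.Injective g) (h : ∀ i j, G.Adj (g (true, i)) (g (false, j))) :
    HasBiclique G s := by
  classical
  refine ⟨fun b => Finset.univ.image fun i => g (b, i), ?_, fun b => ?_, ?_⟩
  · rw [Finset.disjoint_left]
    simp only [Finset.mem_image, Finset.mem_univ, true_and]
    rintro _ ⟨i, rfl⟩ ⟨j, hj⟩
    simpa using hg hj
  · rw [Finset.card_image_of_injective, Finset.card_univ, Fintype.card_fin]
    intro i j hij
    simpa using hg hij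
  · simp only [Finset.mem_image, Finset.mem_univ, true_and]
    rintro _ ⟨i, rfl⟩ _ ⟨j, rfl⟩
    exact h i j

lemma hasClique_of_injective {G : SimpleGraph V} {s : ℕ} {g : Bool × Fin s → V}
    (hg : Function.Injective g) (h : ∀ i j, i ≠ j → G.Adj (g i) (g j)) : HasClique G s := by
  classical
  refine ⟨Finset.univ.image fun i => g (true, i), ?_, ?_⟩
  · rw [Finset.card_image_of_injective, Finset.card_univ, Fintype.card_fin]
    intro i j hij
    simpa using hg hij
  · simp only [Finset.mem_image, Finset.mem_univ, true_and]
    rintro _ ⟨i, rfl⟩ _ ⟨j, rfl⟩ hne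
    exact h _ _ fun h' => hne (by rw [h'])

variable {H : SimpleGraph W} {G : SimpleGraph V} {φ : W → V} {L s : ℕ}
  {leg : W → Bool × Fin s → ℕ → V}

/-- Two adjacent vertices of degree two of `H` generate a large complete bipartite graph. -/
lemma HasLegs.hasBiclique_of_adj (h : HasLegs G φ L leg) (hL : 1 ≤ L) [Nonempty (Fin s)]
    (hG : IsDynamicsClosed H G) (hφ : ∀ a b, H.Adj a b → G.Adj (φ a) (φ b)) {w₁ w₂ z₁ z₂ : W}
    (hw₁ : HasTwoNeighbors H w₁ w₂ z₁) (hw₂ : HasTwoNeighbors H w₂ w₁ z₂) : HasBiclique G s := by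
  classical
  have h12 : H.Adj w₁ w₂ := (hw₁.2 _).2 (Or.inl rfl)
  have h1 : H.Adj w₁ z₁ := (hw₁.2 _).2 (Or.inr rfl)
  have h2 : H.Adj w₂ z₂ := (hw₂.2 _).2 (Or.inr rfl)
  have n1 := hw₁.1
  have n2 := hw₂.1
  -- The sides are first leg vertices at `z₁` and at `z₂`. Replacing `w₁` and `w₂` in the copy of
  -- `H` by one vertex of each side leaves only the edge between them to be completed. The case `z₁
  -- = z₂` is allowed.
  let g : Bool × Fin s → V := fun k => leg (if k.1 then z₁ else z₂) k 1
  refine hasBiclique_of_injective (g := g) (fun k k' hk => ?_) fun i j => ?_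
  · simpa using (h.inj _ _ _ _ _ _ hL hL hk).2.2
  let ψ : W → V := fun a => if a = w₁ then g (true, i) else if a = w₂ then g (false, j) else φ a
  have hψ₁ : ψ w₁ = g (true, i) := by simp [ψ]
  have hψ₂ : ψ w₂ = g (false, j) := by simp [ψ, h12.ne']
  have hψ : ∀ a, a ≠ w₁ → a ≠ w₂ → ψ a = φ a := fun a h1 h2 => by simp [ψ, h1, h2]
  have hinj : Function.Injective ψ := by
    have e1 : ∀ a k, φ a ≠ g k := fun a k => h.root_ne hL one_ne_zero
    have e2 : g (true, i) ≠ g (false, j) := h.leg_ne hL hL one_ne_zero (by simp)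
    intro a b hab
    have := @(h.injective)
    simp only [ψ] at hab
    split_ifs at hab <;> first | (subst_vars; rfl) | (exact h.injective hab) | grind
  have main := hG ψ hinj w₁ w₂ h12 fun a b hab hne => by
    have half : ∀ a b, H.Adj a b → s(a, b) ≠ s(w₁, w₂) → a = w₁ ∨ a = w₂ →
        G.Adj (ψ a) (ψ b) := by
      rintro a b hab hne (rfl | rfl)
      · rcases (hw₁.2 b).1 hab with rfl | rfl
        · exact absurd rfl hne
        · rw [hψ₁, hψ b h1.ne' n1.symm]
          exact (h.adj_root hL b (true, i)).symm
      · rcases (hw₂.2 b).1 hab with rfl | rfl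
        · exact absurd Sym2.eq_swap hne
        · rw [hψ₂, hψ b n2.symm h2.ne']
          exact (h.adj_root hL b (false, j)).symm
    by_cases ha : a = w₁ ∨ a = w₂
    · exact half a b hab hne ha
    by_cases hb : b = w₁ ∨ b = w₂
    · exact (half b a hab.symm (by rwa [Sym2.eq_swap]) hb).symm
    push Not at ha hb
    rw [hψ a ha.1 ha.2, hψ b hb.1 hb.2]
    exact hφ a b hab
  rwa [hψ₁, hψ₂] at main

/-- An odd cycle of `H` which is attached to the rest of `H` in at most one vertex generates a
large clique. -/
lemma HasLegs.hasClique_of_odd (h : HasLegs G φ L leg) [Nonempty (Fin s)]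
    (hG : IsDynamicsClosed H G) (hφ : ∀ a b, H.Adj a b → G.Adj (φ a) (φ b)) {m : ℕ} (hm : 1 ≤ m)
    (hL : m ≤ L) {f : ℕ → W} (hper : ∀ i, f (i + (2 * m + 1)) = f i)
    (hadj : ∀ i, H.Adj (f i) (f (i + 1)))
    (hinj : ∀ i j, i < 2 * m + 1 → j < 2 * m + 1 → f i = f j → i = j)
    (hdeg : ∀ i, i < 2 * m → ∀ a, H.Adj (f (i + 1)) a → a = f i ∨ a = f (i + 2)) :
    HasClique G s := by
  classical
  let g : Bool × Fin s → V := fun k => leg (f 0) k m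
  refine hasClique_of_injective (g := g) (fun k k' hk => ?_) fun i j hij => ?_
  · have := (h.inj _ _ _ _ _ _ hL hL hk).2.2
    rcases this with h' | h'
    · omega
    · exact h'
  -- The odd cycle is unrolled from its root `f 0` along two legs: `f t` goes to position `t` of leg
  -- `i` for `t ≤ m`, and to position `2 * m + 1 - t` of leg `j` afterwards. The only edge not
  -- covered is that between `f m` and `f (m + 1)`, which joins the vertices at distance `m` on the
  -- two legs.
  let ψ : W → V := fun a => if ha : ∃ t, t < 2 * m + 1 ∧ f t = a then
      (if ha.choose ≤ m then leg (f 0) i ha.choose else leg (f 0) j (2 * m + 1 - ha.choose))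
    else φ a
  have hψ : ∀ a, (∀ t, t < 2 * m + 1 → f t ≠ a) → ψ a = φ a := fun a ha =>
    dif_neg fun ⟨t, ht, h'⟩ => ha t ht h'
  have hψf : ∀ t, t < 2 * m + 1 →
      ψ (f t) = if t ≤ m then leg (f 0) i t else leg (f 0) j (2 * m + 1 - t) := by
    intro t ht
    have hex : ∃ t', t' < 2 * m + 1 ∧ f t' = f t := ⟨t, ht, rfl⟩
    have : hex.choose = t := hinj _ _ hex.choose_spec.1 ht hex.choose_spec.2
    simp only [ψ]
    rw [dif_pos hex, this]
  have hψ₁ : ∀ t, t ≤ m → ψ (f t) = leg (f 0) i t := fun t ht => by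
    rw [hψf t (by omega), if_pos ht]
  -- Including `t = 2 * m + 1`, where the cycle returns to the root, makes the last step of the
  -- cycle like the others.
  have hψ₂ : ∀ t, m < t → t ≤ 2 * m + 1 → ψ (f t) = leg (f 0) j (2 * m + 1 - t) := fun t ht ht' => by
    rcases ht'.lt_or_eq with h' | rfl
    · rw [hψf t h', if_neg (by omega)]
    · have : f (2 * m + 1) = f 0 := by simpa using hper 0
      rw [this, hψ₁ 0 (by omega), Nat.sub_self, h.zero, h.zero]
  have hψinj : Function.Injective ψ := by
    have e1 : ∀ t t', t < 2 * m + 1 → t' < 2 * m + 1 → t < t' → ψ (f t) ≠ ψ (f t') := by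
      intro t t' ht ht' hlt
      rcases le_or_gt t' m with h1 | h1
      · rw [hψ₁ t (by omega), hψ₁ t' h1]
        exact (h.leg_ne (by omega) (by omega) (by omega) (by simp; omega)).symm
      · rw [hψ₂ t' h1 ht'.le]
        rcases le_or_gt t m with h2 | h2
        · rw [hψ₁ t h2]
          exact (h.leg_ne (by omega) (by omega) (by omega) (by simp [hij.symm])).symm
        · rw [hψ₂ t h2 ht.le]
          exact h.leg_ne (by omega) (by omega) (by omega) (by simp; omega)
    have e2 : ∀ t a, t < 2 * m + 1 → (∀ t, t < 2 * m + 1 → f t ≠ a) → ψ (f t) ≠ ψ a := by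
      intro t a ht ha
      rw [hψ a ha]
      by_cases h0 : t = 0
      · subst h0
        rw [hψ₁ 0 (by omega), h.zero]
        exact h.injective.ne (ha 0 ht)
      · rcases le_or_gt t m with h2 | h2
        · rw [hψ₁ t h2]
          exact (h.root_ne (by omega) h0).symm
        · rw [hψ₂ t h2 ht.le]
          exact (h.root_ne (by omega) (by omega)).symm
    intro a b hab
    by_cases ha : ∃ t, t < 2 * m + 1 ∧ f t = a <;> by_cases hb : ∃ t, t < 2 * m + 1 ∧ f t = b
    · obtain ⟨t, ht, rfl⟩ := ha
      obtain ⟨t', ht', rfl⟩ := hb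
      rcases lt_trichotomy t t' with h' | rfl | h'
      · exact absurd hab (e1 t t' ht ht' h')
      · rfl
      · exact absurd hab.symm (e1 t' t ht' ht h')
    · obtain ⟨t, ht, rfl⟩ := ha
      push Not at hb
      exact absurd hab (e2 t b ht hb)
    · obtain ⟨t, ht, rfl⟩ := hb
      push Not at ha
      exact absurd hab.symm (e2 t a ht ha)
    · push Not at ha hb
      rw [hψ a ha, hψ b hb] at hab
      exact h.injective hab
  have hstep : ∀ t, t < 2 * m + 1 → t ≠ m → G.Adj (ψ (f t)) (ψ (f (t + 1))) := by
    intro t ht htm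
    rcases le_or_gt t m with h1 | h1
    · rw [hψ₁ t h1, hψ₁ (t + 1) (by omega)]
      exact h.adj _ _ _ (by omega)
    · rw [hψ₂ t h1 ht.le, hψ₂ (t + 1) (by omega) (by omega)]
      have : 2 * m + 1 - t = 2 * m + 1 - (t + 1) + 1 := by omega
      rw [this]
      exact (h.adj _ _ _ (by omega)).symm
  have main := hG ψ hψinj (f m) (f (m + 1)) (hadj m) fun a b hab hne => by
    have half : ∀ a b, H.Adj a b → s(a, b) ≠ s(f m, f (m + 1)) →
        (∃ t, t < 2 * m ∧ a = f (t + 1)) → G.Adj (ψ a) (ψ b) := by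
      rintro a b hab hne ⟨t, ht, rfl⟩
      rcases hdeg t ht b hab with rfl | rfl
      · refine (hstep t (by omega) ?_).symm
        rintro rfl
        exact hne Sym2.eq_swap
      · refine hstep (t + 1) (by omega) ?_
        rintro rfl
        exact hne rfl
    by_cases ha : ∃ t, t < 2 * m ∧ a = f (t + 1)
    · exact half a b hab hne ha
    by_cases hb : ∃ t, t < 2 * m ∧ b = f (t + 1)
    · exact (half b a hab.symm (by rwa [Sym2.eq_swap]) hb).symm
    have hroot : ∀ a, (¬ ∃ t, t < 2 * m ∧ a = f (t + 1)) → ψ a = φ a := by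
      intro a ha
      by_cases h0 : a = f 0
      · rw [h0, hψ₁ 0 (by omega), h.zero]
      · refine hψ a fun t ht hta => ?_
        rcases Nat.eq_zero_or_eq_succ_pred t with h' | h'
        · exact h0 (by rw [← hta, h'])
        · exact ha ⟨t - 1, by omega, by rw [← hta, show t - 1 + 1 = t by omega]⟩
    rw [hroot a ha, hroot b hb]
    exact hφ a b hab
  rw [hψ₁ m le_rfl, hψ₂ (m + 1) (by omega) (by omega)] at main
  rwa [show 2 * m + 1 - (m + 1) = m by omega] at main

/-- If `H` is bipartite after deleting one edge inside a colour class, then large complete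
bipartite graphs generate large cliques. -/
lemma IsDynamicsClosed.hasClique_of_hasBiclique [Fintype W] (hG : IsDynamicsClosed H G)
    (hs : Fintype.card W + 2 ≤ s) (hS : HasBiclique G s) {χ : W → Bool} {x y : W}
    (hxy : H.Adj x y) (hχxy : χ x = χ y)
    (hχ : ∀ a b, H.Adj a b → s(a, b) ≠ s(x, y) → χ a ≠ χ b) : HasClique G s := by
  classical
  obtain ⟨S, hdisj, hcard, hadj⟩ := hS
  refine ⟨S true, hcard _, fun u hu v hv huv => ?_⟩
  -- The colouring is normalised so that `x` and `y` both get the side `S true` containing `u` and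
  -- `v`.
  obtain ⟨χ, hχx, hχy, hχ⟩ : ∃ χ : W → Bool, χ x = true ∧ χ y = true ∧
      ∀ a b, H.Adj a b → s(a, b) ≠ s(x, y) → χ a ≠ χ b := by
    refine ⟨fun a => χ a == χ x, by simp, by simp [hχxy], fun a b hab hne => ?_⟩
    have := hχ a b hab hne
    cases h1 : χ a <;> cases h2 : χ b <;> cases h3 : χ x <;> simp_all
  have hS' : Pairwise fun i j => Disjoint (S i) (S j) := by
    rintro (_ | _) (_ | _) h
    exacts [absurd rfl h, hdisj.symm, hdisj, absurd rfl h]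
  obtain ⟨g, hginj, hg⟩ := exists_injective_mem_of_card hS' χ {u, v}
    (fun i => le_trans (by gcongr; exact Finset.card_le_two) (hs.trans_eq (hcard i).symm))
  have hgu : ∀ a, g a ≠ u := fun a h => (hg a).2 (by simp [h])
  have hgv : ∀ a, g a ≠ v := fun a h => (hg a).2 (by simp [h])
  -- With `x`, `y` at `u`, `v`, every other edge of `H` crosses the biclique, so `uv` is completed.
  let ψ : W → V := fun a => if a = x then u else if a = y then v else g a
  have hψx : ψ x = u := by simp [ψ]
  have hψy : ψ y = v := by simp [ψ, hxy.ne']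
  have hinj : Function.Injective ψ := by
    intro a b hab
    simp only [ψ] at hab
    split_ifs at hab <;> first | (subst_vars; rfl) | (exact hginj hab) | grind
  have hψ : ∀ a, ψ a ∈ S (χ a) := by
    intro a
    simp only [ψ]
    split_ifs with h1 h2
    · rwa [h1, hχx]
    · rwa [h2, hχy]
    · exact (hg a).1
  have main := hG ψ hinj x y hxy fun a b hab hne => by
    have h1 := hψ a
    have h2 := hψ b
    have h3 := hχ a b hab hne
    cases h4 : χ a <;> cases h5 : χ b <;> rw [h4] at h1 h3 <;> rw [h5] at h2 h3
    · exact absurd rfl h3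
    · exact (hadj _ h2 _ h1).symm
    · exact hadj _ h1 _ h2
    · exact absurd rfl h3
  rwa [hψx, hψy] at main

end Legs

/-! ### The two exceptional graphs: the diamond and K₂,₃ -/

section Exceptional

variable {W V : Type*} {H : SimpleGraph W} {G : SimpleGraph V} {φ : W → V} {L s : ℕ}
  {leg : W → Bool × Fin s → ℕ → V}

/-- Leaves attached to a neighbour of a vertex of degree two become twins of that vertex. -/
lemma HasLegs.adj_of_hasTwoNeighbors (h : HasLegs G φ L leg) (hL : 1 ≤ L) [Nonempty (Fin s)]
    (hG : IsDynamicsClosed H G) (hφ : ∀ a b, H.Adj a b → G.Adj (φ a) (φ b)) {w c c' : W}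
    (hw : HasTwoNeighbors H w c c') (k : Bool × Fin s) : G.Adj (leg c k 1) (φ c') := by
  classical
  have h1 : H.Adj w c := (hw.2 _).2 (Or.inl rfl)
  have h2 : H.Adj w c' := (hw.2 _).2 (Or.inr rfl)
  have n := hw.1
  let ψ : W → V := fun a => if a = w then leg c k 1 else φ a
  have hψw : ψ w = leg c k 1 := by simp [ψ]
  have hψ : ∀ a, a ≠ w → ψ a = φ a := fun a h1 => by simp [ψ, h1]
  have hinj : Function.Injective ψ := by
    have e1 : ∀ a, φ a ≠ leg c k 1 := fun a => h.root_ne hL one_ne_zero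
    intro a b hab
    simp only [ψ] at hab
    split_ifs at hab <;> first | (subst_vars; rfl) | (exact h.injective hab) | grind
  have main := hG ψ hinj w c' h2 fun a b hab hne => by
    by_cases ha : a = w
    · subst ha
      rcases (hw.2 b).1 hab with rfl | rfl
      · rw [hψw, hψ b h1.ne']
        exact (h.adj_root hL b k).symm
      · exact absurd rfl hne
    by_cases hb : b = w
    · subst hb
      rcases (hw.2 a).1 hab.symm with rfl | rfl
      · rw [hψw, hψ a h1.ne']
        exact h.adj_root hL a k
      · exact absurd Sym2.eq_swap hne
    rw [hψ a ha, hψ b hb]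
    exact hφ a b hab
  rwa [hψw, hψ c' h2.ne'] at main

/-- Here `H` is `K₄` minus the edge `ww₂`. The leaves at `c` are joined to `φ c` and, as twins of
`w`, to `φ c'`. Place `c`, `w` at `φ c`, `φ c'`, and `c'`, `w₂` at two leaves: only the edge between
the leaves is missing. -/
lemma HasLegs.hasBiclique_of_diamond (h : HasLegs G φ L leg) (hL : 2 ≤ L) [Nonempty (Fin s)]
    (hG : IsDynamicsClosed H G) (hφ : ∀ a b, H.Adj a b → G.Adj (φ a) (φ b)) {c c' w w₂ : W}
    (hcc : H.Adj c c') (hww : w ≠ w₂) (hw : HasTwoNeighbors H w c c')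
    (hw₂ : HasTwoNeighbors H w₂ c c') (hall : ∀ a, a = c ∨ a = c' ∨ a = w ∨ a = w₂) :
    HasBiclique G s := by
  classical
  refine hasBiclique_of_injective (g := fun k => leg c k 1) (fun k k' hk => ?_) fun i j => ?_
  · simpa using (h.inj _ _ _ _ _ _ (by omega) (by omega) hk).2.2
  have hp := h.adj_of_hasTwoNeighbors (by omega) hG hφ hw
  have hr := h.adj_root (by omega : 1 ≤ L) c
  have e1 : ∀ a k, φ a ≠ leg c k 1 := fun a k => h.root_ne (by omega) one_ne_zero
  have e2 : leg c (true, i) 1 ≠ leg c (false, j) 1 :=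
    h.leg_ne (by omega) (by omega) one_ne_zero (by simp)
  have hcw := ((hw.2 c).2 (Or.inl rfl)).ne'
  have hcw' := ((hw.2 c').2 (Or.inr rfl)).ne'
  have hcw₂ := ((hw₂.2 c).2 (Or.inl rfl)).ne'
  have hcw₂' := ((hw₂.2 c').2 (Or.inr rfl)).ne'
  have hne := h.injective.ne hcc.ne
  let ψ : W → V := fun a => if a = c then φ c else if a = c' then leg c (true, i) 1 else
    if a = w then φ c' else leg c (false, j) 1
  have h1 : ψ c = φ c := by simp [ψ]
  have h2 : ψ c' = leg c (true, i) 1 := by simp [ψ, hcc.ne']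
  have h3 : ψ w = φ c' := by simp [ψ, hcw.symm, hcw'.symm]
  have h4 : ψ w₂ = leg c (false, j) 1 := by simp [ψ, hcw₂.symm, hcw₂'.symm, hww.symm]
  have hinj : Function.Injective ψ := by
    intro a b hab
    have e1c := e1 c
    have e1c' := e1 c'
    rcases hall a with rfl | rfl | rfl | rfl <;> rcases hall b with rfl | rfl | rfl | rfl <;>
      first | rfl | (exfalso; grind)
  have hw₂c' : H.Adj c' w₂ := ((hw₂.2 c').2 (Or.inr rfl)).symm
  have main := hG ψ hinj c' w₂ hw₂c' fun a b hab hne' => by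
    have hcw₁ : ¬ H.Adj w w₂ := fun h' => by
      rcases (hw.2 _).1 h' with rfl | rfl
      · exact hcw₂ rfl
      · exact hcw₂' rfl
    rcases hall a with rfl | rfl | rfl | rfl <;> rcases hall b with rfl | rfl | rfl | rfl <;>
      first
      | exact absurd rfl hab.ne
      | exact absurd rfl hne'
      | exact absurd Sym2.eq_swap hne'
      | exact absurd hab hcw₁
      | exact absurd hab.symm hcw₁
      | simp only [h1, h2, h3, h4]
    · exact hr _
    · exact hφ _ _ hcc
    · exact hr _
    · exact (hr _).symm
    · exact hp _
    · exact (hφ _ _ hcc).symm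
    · exact (hp _).symm
    · exact (hr _).symm
  rwa [h2, h4] at main

/-- Here `H` is bipartite, with classes `{c, c'}` and `{w, w₂, w₃}`, so the two sides of the
biclique are taken at distances of different parity from the root. Place `c`, `c'` at first vertices
of two legs at `c`; these are joined to `φ c` and `φ c'`, which host `w` and `w₂`. The vertex `w₃`
goes to the second vertex of the leg hosting `c`; the missing edge joins it to the first vertex of
the other leg. -/
lemma HasLegs.hasBiclique_of_K23 (h : HasLegs G φ L leg) (hL : 2 ≤ L) [Nonempty (Fin s)]
    (hG : IsDynamicsClosed H G) (hφ : ∀ a b, H.Adj a b → G.Adj (φ a) (φ b)) {c c' w w₂ w₃ : W}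
    (hne : c ≠ c') (hcc : ¬ H.Adj c c') (h₁₂ : w ≠ w₂) (h₁₃ : w ≠ w₃) (h₂₃ : w₂ ≠ w₃)
    (hw : HasTwoNeighbors H w c c') (hw₂ : HasTwoNeighbors H w₂ c c')
    (hw₃ : HasTwoNeighbors H w₃ c c') (hall : ∀ a, a = c ∨ a = c' ∨ a = w ∨ a = w₂ ∨ a = w₃) :
    HasBiclique G s := by
  classical
  let g : Bool × Fin s → V := fun k => leg c k (if k.1 then 1 else 2)
  refine hasBiclique_of_injective (g := g) (fun k k' hk => ?_) fun i j => ?_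
  · have hb : ∀ b : Bool, (if b then 1 else 2) ≤ L ∧ (if b then 1 else 2) ≠ 0 := by
      rintro (_ | _) <;> simp <;> omega
    have := (h.inj _ _ _ _ _ _ (hb _).1 (hb _).1 hk).2.2
    rcases this with h' | h'
    · exact absurd h' (hb _).2
    · exact h'
  have hp := h.adj_of_hasTwoNeighbors (by omega) hG hφ hw
  have hr := h.adj_root (by omega : 1 ≤ L) c
  have e1 : ∀ a k, φ a ≠ leg c k 1 := fun a k => h.root_ne (by omega) one_ne_zero
  have e2 : ∀ a k, φ a ≠ leg c k 2 := fun a k => h.root_ne (by omega) two_ne_zero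
  have e3 : ∀ k k', leg c k 1 ≠ leg c k' 2 := fun k k' =>
    h.leg_ne (by omega) (by omega) one_ne_zero (by simp)
  have e4 : leg c (true, i) 1 ≠ leg c (false, j) 1 :=
    h.leg_ne (by omega) (by omega) one_ne_zero (by simp)
  have hcw := ((hw.2 c).2 (Or.inl rfl)).ne'
  have hcw' := ((hw.2 c').2 (Or.inr rfl)).ne'
  have hcw₂ := ((hw₂.2 c).2 (Or.inl rfl)).ne'
  have hcw₂' := ((hw₂.2 c').2 (Or.inr rfl)).ne'
  have hcw₃ := ((hw₃.2 c).2 (Or.inl rfl)).ne'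
  have hcw₃' := ((hw₃.2 c').2 (Or.inr rfl)).ne'
  have hne' := h.injective.ne hne
  let ψ : W → V := fun a => if a = c then leg c (false, j) 1 else if a = c' then leg c (true, i) 1
    else if a = w then φ c else if a = w₂ then φ c' else leg c (false, j) 2
  have h1 : ψ c = leg c (false, j) 1 := by simp [ψ]
  have h2 : ψ c' = leg c (true, i) 1 := by simp [ψ, hne.symm]
  have h3 : ψ w = φ c := by simp [ψ, hcw.symm, hcw'.symm]
  have h4 : ψ w₂ = φ c' := by simp [ψ, hcw₂.symm, hcw₂'.symm, h₁₂.symm]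
  have h5 : ψ w₃ = leg c (false, j) 2 := by
    simp [ψ, hcw₃.symm, hcw₃'.symm, h₁₃.symm, h₂₃.symm]
  have hinj : Function.Injective ψ := by
    intro a b hab
    have e1c := e1 c
    have e1c' := e1 c'
    have e2c := e2 c
    have e2c' := e2 c'
    have e3' := e3 (true, i) (false, j)
    have e3'' := e3 (false, j) (false, j)
    rcases hall a with rfl | rfl | rfl | rfl | rfl <;>
      rcases hall b with rfl | rfl | rfl | rfl | rfl <;>
      first | rfl | (exfalso; grind)
  have hadj₃ : H.Adj c' w₃ := ((hw₃.2 c').2 (Or.inr rfl)).symm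
  have hr₂ : G.Adj (leg c (false, j) 1) (leg c (false, j) 2) := h.adj c (false, j) 1 (by omega)
  have main := hG ψ hinj c' w₃ hadj₃ fun a b hab hne' => by
    have half : ∀ a b, H.Adj a b → s(a, b) ≠ s(c', w₃) → (a = c ∨ a = c') →
        G.Adj (ψ a) (ψ b) := by
      rintro a b hab hne' (rfl | rfl)
      · rcases hall b with rfl | rfl | rfl | rfl | rfl
        · exact absurd rfl hab.ne
        · exact absurd hab hcc
        · rw [h1, h3]; exact (hr _).symm
        · rw [h1, h4]; exact hp _
        · rw [h1, h5]; exact hr₂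
      · rcases hall b with rfl | rfl | rfl | rfl | rfl
        · exact absurd hab.symm hcc
        · exact absurd rfl hab.ne
        · rw [h2, h3]; exact (hr _).symm
        · rw [h2, h4]; exact hp _
        · exact absurd rfl hne'
    by_cases ha : a = c ∨ a = c'
    · exact half a b hab hne' ha
    · have hb : b = c ∨ b = c' := by
        rcases hall a with rfl | rfl | rfl | rfl | rfl
        · simp at ha
        · simp at ha
        · exact (hw.2 b).1 hab
        · exact (hw₂.2 b).1 hab
        · exact (hw₃.2 b).1 hab
      exact (half b a hab.symm (by rwa [Sym2.eq_swap]) hb).symm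
  rw [h2, h5] at main
  exact main

end Exceptional

/-! ### Odd cycles in graphs that are not bipartite -/

section OddCycle

variable {W : Type*}

/-- A graph which is not bipartite contains an odd cycle, given here as a periodic sequence. -/
lemma SimpleGraph.exists_odd_cycle {H : SimpleGraph W}
    (hH : ¬ ∃ χ : W → Bool, ∀ a b, H.Adj a b → χ a ≠ χ b) :
    ∃ (m : ℕ) (f : ℕ → W), 1 ≤ m ∧ (∀ i, f (i + (2 * m + 1)) = f i) ∧
      (∀ i, H.Adj (f i) (f (i + 1))) ∧
      ∀ i j, f i = f j → i % (2 * m + 1) = j % (2 * m + 1) := by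
  classical
  -- `P n` says that there is an odd closed walk of length `n`. In a shortest one, a repeated vertex
  -- would split it into two closed walks, one of them odd and shorter.
  let P : ℕ → Prop := fun n => Odd n ∧ ∃ f : ℕ → W, f n = f 0 ∧ ∀ i < n, H.Adj (f i) (f (i + 1))
  have hP : ∃ n, P n := by
    by_contra hP
    apply hH
    have hcol : H.Colorable 2 := by
      rw [SimpleGraph.two_colorable_iff_forall_loop_even]
      intro u p
      by_contra h
      refine hP ⟨p.length, Nat.not_even_iff_odd.1 h, p.getVert, by simp, fun i hi => ?_⟩
      exact p.adj_getVert_succ hi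
    obtain ⟨C⟩ := hcol
    refine ⟨fun a => C a = 0, fun a b hab h => C.valid hab ?_⟩
    have := decide_eq_decide.1 h
    omega
  have hmin := fun k (hk : k < Nat.find hP) => Nat.find_min hP hk
  obtain ⟨hodd, f, hf0, hf⟩ := Nat.find_spec hP
  set n := Nat.find hP with hn
  have hinj : ∀ i j, i < j → j < n → f i ≠ f j := by
    intro i j hij hj heq
    rcases Nat.even_or_odd (j - i) with he | ho
    · refine hmin (n - (j - i)) (by omega) ⟨?_, fun k => if k ≤ i then f k else f (k + (j - i)), ?_, ?_⟩
      · rw [Nat.odd_sub (by omega)]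
        simp [hodd, he]
      · beta_reduce
        rw [if_neg (by omega), if_pos (by omega), ← hf0]
        congr 1
        omega
      · intro k hk
        rcases lt_trichotomy k i with h | rfl | h
        · simp only [if_pos h.le, if_pos (show k + 1 ≤ i by omega)]
          exact hf k (by omega)
        · simp only [if_pos le_rfl, if_neg (show ¬ k + 1 ≤ k by omega)]
          rw [heq, show k + 1 + (j - k) = j + 1 by omega]
          exact hf j hj
        · simp only [if_neg (show ¬ k ≤ i by omega), if_neg (show ¬ k + 1 ≤ i by omega)]
          rw [show k + 1 + (j - i) = k + (j - i) + 1 by omega]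
          exact hf _ (by omega)
    -- An odd segment between the repetitions is itself a shorter odd closed walk.
    · refine hmin (j - i) (by omega) ⟨ho, fun k => f (i + k), ?_, ?_⟩
      · simp only [add_zero]
        rw [heq]
        congr 1
        omega
      · intro k hk
        exact hf (i + k) (by omega)
  obtain ⟨m, hm⟩ := hodd
  have hm1 : 1 ≤ m := by
    by_contra h
    have : n = 1 := by omega
    have h1 := hf 0 (by omega)
    rw [zero_add, ← this, hf0] at h1
    exact H.irrefl h1
  refine ⟨m, fun i => f (i % n), hm1, fun i => ?_, fun i => ?_, fun i j hij => ?_⟩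
  · simp only [hm, Nat.add_mod_right]
  · have hlt : i % n < n := Nat.mod_lt _ (by omega)
    have h1 := hf (i % n) hlt
    beta_reduce
    rcases Nat.lt_or_ge (i % n + 1) n with h | h
    · rwa [show (i + 1) % n = i % n + 1 by
        rw [Nat.add_mod, Nat.mod_eq_of_lt (show 1 < n by omega), Nat.mod_eq_of_lt h]]
    · have h2 : i % n + 1 = n := by omega
      rw [h2, hf0] at h1
      rwa [show (i + 1) % n = 0 by
        rw [Nat.add_mod, Nat.mod_eq_of_lt (show 1 < n by omega), h2, Nat.mod_self]]
  · rw [← hm]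
    have hi : i % n < n := Nat.mod_lt _ (by omega)
    have hj : j % n < n := Nat.mod_lt _ (by omega)
    rcases lt_trichotomy (i % n) (j % n) with h | h | h
    · exact absurd hij (hinj _ _ h hj)
    · exact h
    · exact absurd hij.symm (hinj _ _ h hi)

end OddCycle

/-! ### Structure of graphs with degree excess at most two -/

section Structure

variable {W V : Type*} [Fintype W] {H : SimpleGraph W} [DecidableRel H.Adj]

lemma exists_hasTwoNeighbors {w : W} (hw : H.degree w = 2) :
    ∃ z₁ z₂, HasTwoNeighbors H w z₁ z₂ := by
  classical
  rw [← SimpleGraph.card_neighborFinset_eq_degree, Finset.card_eq_two] at hw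
  obtain ⟨z₁, z₂, hne, h⟩ := hw
  refine ⟨z₁, z₂, hne, fun a => ?_⟩
  rw [← SimpleGraph.mem_neighborFinset, h]
  simp

lemma hasTwoNeighbors_of_adj {w a b : W} (hw : H.degree w = 2) (ha : H.Adj w a) (hb : H.Adj w b)
    (hab : a ≠ b) : HasTwoNeighbors H w a b := by
  obtain ⟨z₁, z₂, h⟩ := exists_hasTwoNeighbors hw
  rcases (h.2 a).1 ha with rfl | rfl <;> rcases (h.2 b).1 hb with rfl | rfl
  · exact absurd rfl hab
  · exact h
  · exact h.symm
  · exact absurd rfl hab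

lemma exists_hasTwoNeighbors_of_adj {w a : W} (hw : H.degree w = 2) (ha : H.Adj w a) :
    ∃ b, HasTwoNeighbors H w a b := by
  obtain ⟨z₁, z₂, h⟩ := exists_hasTwoNeighbors hw
  rcases (h.2 a).1 ha with rfl | rfl
  exacts [⟨_, h⟩, ⟨_, h.symm⟩]

/-- A graph of minimum degree two with at most one more edge than vertices and two vertices of
degree at least three. -/
lemma degree_eq_of_sum_le (hdeg : ∀ v, 2 ≤ H.degree v)
    (hsum : ∑ v, H.degree v ≤ 2 * Fintype.card W + 2) {c c' : W} (hne : c ≠ c')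
    (hc : H.degree c ≠ 2) (hc' : H.degree c' ≠ 2) :
    H.degree c = 3 ∧ H.degree c' = 3 ∧ ∀ a, a ≠ c → a ≠ c' → H.degree a = 2 := by
  classical
  -- The total excess over degree two is at most two, so two vertices of larger degree use it up.
  have h1 : ∑ v, (H.degree v - 2) ≤ 2 := by
    have : ∑ v, (H.degree v - 2) + ∑ _v : W, 2 = ∑ v, H.degree v := by
      rw [← Finset.sum_add_distrib]
      exact Finset.sum_congr rfl fun v _ => Nat.sub_add_cancel (hdeg v)
    simp at this
    omega
  have hpair : ∑ v ∈ {c, c'}, (H.degree v - 2) ≤ ∑ v, (H.degree v - 2) :=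
    Finset.sum_le_sum_of_subset (Finset.subset_univ _)
  rw [Finset.sum_pair hne] at hpair
  have hd := hdeg c
  have hd' := hdeg c'
  refine ⟨by omega, by omega, fun a ha ha' => ?_⟩
  have htriple : ∑ v ∈ {a, c, c'}, (H.degree v - 2) ≤ ∑ v, (H.degree v - 2) :=
    Finset.sum_le_sum_of_subset (Finset.subset_univ _)
  rw [Finset.sum_insert (by simp [ha, ha']), Finset.sum_pair hne] at htriple
  have hda := hdeg a
  omega

variable {G : SimpleGraph V} {φ : W → V} {L s : ℕ} {leg : W → Bool × Fin s → ℕ → V}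

/-- If no two vertices of degree two are adjacent, the neighbours `c`, `c'` of one such vertex are
the only vertices of degree three, and every other vertex is joined to exactly these two. Counting
the neighbours of `c` leaves the diamond if `cc'` is an edge, and `K₂,₃` otherwise. -/
lemma HasLegs.hasBiclique (h : HasLegs G φ L leg) (hL : 2 ≤ L) [Nonempty (Fin s)]
    (hG : IsDynamicsClosed H G) (hφ : ∀ a b, H.Adj a b → G.Adj (φ a) (φ b))
    (hdeg : ∀ v, 2 ≤ H.degree v) (hsum : ∑ v, H.degree v ≤ 2 * Fintype.card W + 2)
    {w : W} (hw : H.degree w = 2) : HasBiclique G s := by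
  classical
  by_cases hadj : ∃ w₁ w₂, H.Adj w₁ w₂ ∧ H.degree w₁ = 2 ∧ H.degree w₂ = 2
  · obtain ⟨w₁, w₂, h12, h1, h2⟩ := hadj
    obtain ⟨z₁, hz₁⟩ := exists_hasTwoNeighbors_of_adj h1 h12
    obtain ⟨z₂, hz₂⟩ := exists_hasTwoNeighbors_of_adj h2 h12.symm
    exact h.hasBiclique_of_adj (by omega) hG hφ hz₁ hz₂
  push Not at hadj
  obtain ⟨c, c', hcc'⟩ := exists_hasTwoNeighbors hw
  have hc := hadj w c ((hcc'.2 _).2 (Or.inl rfl)) hw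
  have hc' := hadj w c' ((hcc'.2 _).2 (Or.inr rfl)) hw
  obtain ⟨hc3, hc3', hoth⟩ := degree_eq_of_sum_le hdeg hsum hcc'.1 hc hc'
  have hmem : ∀ a b, H.degree a = 2 → H.Adj a b → b = c ∨ b = c' := fun a b ha hab => by
    by_contra hb
    push Not at hb
    exact hadj a b hab ha (hoth b hb.1 hb.2)
  have htwo : ∀ a, a ≠ c → a ≠ c' → HasTwoNeighbors H a c c' := fun a ha ha' => by
    have hda := hoth a ha ha'
    obtain ⟨z₁, z₂, hz⟩ := exists_hasTwoNeighbors hda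
    have n := hz.1
    rcases hmem a z₁ hda ((hz.2 _).2 (Or.inl rfl)) with rfl | rfl <;>
      rcases hmem a z₂ hda ((hz.2 _).2 (Or.inr rfl)) with rfl | rfl
    · exact absurd rfl n
    · exact hz
    · exact hz.symm
    · exact absurd rfl n
  rw [← SimpleGraph.card_neighborFinset_eq_degree] at hc3
  by_cases hcc : H.Adj c c'
  · have h2 : ((H.neighborFinset c).erase c').card = 2 := by
      rw [Finset.card_erase_of_mem (by simpa using hcc), hc3]
    obtain ⟨w₁, w₂, hne, hw₁₂⟩ := Finset.card_eq_two.1 h2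
    have hw' : ∀ a, (a ≠ c' ∧ H.Adj c a) ↔ a = w₁ ∨ a = w₂ := fun a => by
      rw [← SimpleGraph.mem_neighborFinset, ← Finset.mem_erase, hw₁₂]; simp
    have hw₁ := (hw' w₁).2 (Or.inl rfl)
    have hw₂ := (hw' w₂).2 (Or.inr rfl)
    refine h.hasBiclique_of_diamond hL hG hφ hcc hne (htwo _ hw₁.2.ne' hw₁.1)
      (htwo _ hw₂.2.ne' hw₂.1) fun a => ?_
    by_cases ha : a = c
    · exact Or.inl ha
    by_cases ha' : a = c'
    · exact Or.inr (Or.inl ha')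
    · exact Or.inr (Or.inr ((hw' a).1 ⟨ha', (((htwo a ha ha').2 c).2 (Or.inl rfl)).symm⟩))
  · obtain ⟨w₁, w₂, w₃, h12, h13, h23, hw₁₂₃⟩ := Finset.card_eq_three.1 hc3
    have hw' : ∀ a, H.Adj c a ↔ a = w₁ ∨ a = w₂ ∨ a = w₃ := fun a => by
      rw [← SimpleGraph.mem_neighborFinset, hw₁₂₃]; simp
    have hw₁ := (hw' w₁).2 (Or.inl rfl)
    have hw₂ := (hw' w₂).2 (Or.inr (Or.inl rfl))
    have hw₃ := (hw' w₃).2 (Or.inr (Or.inr rfl))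
    have hnec : ∀ {a}, H.Adj c a → a ≠ c' := fun ha h' => hcc (h' ▸ ha)
    refine h.hasBiclique_of_K23 hL hG hφ hcc'.1 hcc h12 h13 h23 (htwo _ hw₁.ne' (hnec hw₁))
      (htwo _ hw₂.ne' (hnec hw₂)) (htwo _ hw₃.ne' (hnec hw₃)) fun a => ?_
    by_cases ha : a = c
    · exact Or.inl ha
    by_cases ha' : a = c'
    · exact Or.inr (Or.inl ha')
    · exact Or.inr (Or.inr ((hw' a).1 (((htwo a ha ha').2 c).2 (Or.inl rfl)).symm))

/-- If each odd cycle has two vertices of degree above two, there are exactly two such vertices `c`,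
`c'`, both of degree three and both on every odd cycle. Deleting `c` leaves a bipartite graph, and
giving `c` the colour opposite to the majority of its three neighbours leaves at most one bad edge.
-/
lemma exists_coloring_of_odd_cycles (hdeg : ∀ v, 2 ≤ H.degree v)
    (hsum : ∑ v, H.degree v ≤ 2 * Fintype.card W + 2)
    (hH : ¬ ∃ χ : W → Bool, ∀ a b, H.Adj a b → χ a ≠ χ b)
    (hodd : ∀ (m : ℕ) (f : ℕ → W), 1 ≤ m → (∀ i, f (i + (2 * m + 1)) = f i) →
      (∀ i, H.Adj (f i) (f (i + 1))) → (∀ i j, f i = f j → i % (2 * m + 1) = j % (2 * m + 1)) →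
      ∃ i < 2 * m, H.degree (f (i + 1)) ≠ 2) :
    ∃ (χ : W → Bool) (x y : W), H.Adj x y ∧ χ x = χ y ∧
      ∀ a b, H.Adj a b → s(a, b) ≠ s(x, y) → χ a ≠ χ b := by
  classical
  have htwo : ∀ (m : ℕ) (f : ℕ → W), 1 ≤ m → (∀ i, f (i + (2 * m + 1)) = f i) →
      (∀ i, H.Adj (f i) (f (i + 1))) → (∀ i j, f i = f j → i % (2 * m + 1) = j % (2 * m + 1)) →
      ∃ i j, f i ≠ f j ∧ H.degree (f i) ≠ 2 ∧ H.degree (f j) ≠ 2 := by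
    intro m f hm hper hadj hinj
    obtain ⟨i, hi, hdi⟩ := hodd m f hm hper hadj hinj
    -- The hypothesis ignores the root of the cycle. Rotating the cycle so that the vertex just
    -- found is the root yields a second one.
    obtain ⟨j, hj, hdj⟩ := hodd m (fun k => f (k + (i + 1))) hm
      (fun k => by
        rw [show k + (2 * m + 1) + (i + 1) = k + (i + 1) + (2 * m + 1) by ring, hper])
      (fun k => by
        rw [show k + 1 + (i + 1) = k + (i + 1) + 1 by ring]; exact hadj _)
      (fun k l hkl => Nat.ModEq.add_right_cancel' (i + 1) (hinj _ _ hkl))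
    refine ⟨i + 1, j + 1 + (i + 1), fun h => ?_, hdi, hdj⟩
    have h1 : 0 + (i + 1) ≡ j + 1 + (i + 1) [MOD 2 * m + 1] := by
      rw [zero_add]; exact hinj _ _ h
    have h2 := Nat.ModEq.add_right_cancel' _ h1
    have h3 : 0 % (2 * m + 1) = (j + 1) % (2 * m + 1) := h2
    rw [Nat.zero_mod, Nat.mod_eq_of_lt (by omega)] at h3
    omega
  obtain ⟨m, f, hm, hper, hadj, hinj⟩ := SimpleGraph.exists_odd_cycle hH
  obtain ⟨i, j, hij, hi, hj⟩ := htwo m f hm hper hadj hinj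
  set c := f i
  set c' := f j
  obtain ⟨hc3, -, hoth⟩ := degree_eq_of_sum_le hdeg hsum hij hi hj
  -- The edges at `c` are removed but `c` is kept as a vertex. An odd cycle of `H'` would contain
  -- two vertices of degree above two in `H`, both necessarily `c'`.
  let H' : SimpleGraph W :=
    { Adj := fun a b => H.Adj a b ∧ a ≠ c ∧ b ≠ c
      symm := ⟨fun a b h => ⟨h.1.symm, h.2.2, h.2.1⟩⟩
      loopless := ⟨fun a h => H.irrefl h.1⟩ }
  have hH' : ∃ χ : W → Bool, ∀ a b, H'.Adj a b → χ a ≠ χ b := by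
    by_contra hnb
    obtain ⟨m, f, hm, hper, hadj, hinj⟩ := SimpleGraph.exists_odd_cycle hnb
    obtain ⟨k, l, hkl, hk, hl⟩ := htwo m f hm hper (fun i => (hadj i).1) hinj
    have h1 : ∀ k, H.degree (f k) ≠ 2 → f k = c' := fun k hk => by
      by_contra h'
      exact hk (hoth _ (hadj k).2.1 h')
    exact hkl ((h1 k hk).trans (h1 l hl).symm)
  obtain ⟨χ, hχ⟩ := hH'
  rw [← SimpleGraph.card_neighborFinset_eq_degree, Finset.card_eq_three] at hc3
  obtain ⟨a₁, a₂, a₃, -, -, -, ha⟩ := hc3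
  have hc : ∀ a, H.Adj c a ↔ a = a₁ ∨ a = a₂ ∨ a = a₃ := fun a => by
    rw [← SimpleGraph.mem_neighborFinset, ha]; simp
  -- Two of the three neighbours of `c` share a colour `β`; the third is `y`.
  obtain ⟨β, y, hy, hβ⟩ : ∃ (β : Bool) (y : W), H.Adj c y ∧ ∀ a, H.Adj c a → a ≠ y → χ a = β := by
    by_cases h12 : χ a₁ = χ a₂
    · refine ⟨χ a₁, a₃, by simp [hc], fun a h1 h2 => ?_⟩
      rcases (hc a).1 h1 with rfl | rfl | rfl
      exacts [rfl, h12.symm, absurd rfl h2]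
    by_cases h13 : χ a₁ = χ a₃
    · refine ⟨χ a₁, a₂, by simp [hc], fun a h1 h2 => ?_⟩
      rcases (hc a).1 h1 with rfl | rfl | rfl
      exacts [rfl, absurd rfl h2, h13.symm]
    · refine ⟨χ a₂, a₁, by simp [hc], fun a h1 h2 => ?_⟩
      rcases (hc a).1 h1 with rfl | rfl | rfl
      · exact absurd rfl h2
      · rfl
      · cases h : χ a₁ <;> cases h' : χ a₂ <;> cases h'' : χ a <;> simp_all
  have hχ' : ∀ a b, H.Adj a b → s(a, b) ≠ s(c, y) →
      Function.update χ c (!β) a ≠ Function.update χ c (!β) b := by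
    have half : ∀ b, H.Adj c b → b ≠ y →
        Function.update χ c (!β) c ≠ Function.update χ c (!β) b := by
      intro b hb hby
      rw [Function.update_self, Function.update_of_ne hb.ne', hβ b hb hby]
      simp
    intro a b hab hne
    by_cases hac : a = c
    · subst hac
      exact half b hab fun h => hne (by rw [h])
    by_cases hbc : b = c
    · subst hbc
      exact (half a hab.symm fun h => hne (by rw [h, Sym2.eq_swap])).symm
    · rw [Function.update_of_ne hac, Function.update_of_ne hbc]
      exact hχ a b ⟨hab, hac, hbc⟩
  refine ⟨Function.update χ c (!β), c, y, hy, ?_, hχ'⟩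
  -- Otherwise `c` and `y` would differ and the colouring would be proper on all of `H`.
  by_contra hcy
  refine hH ⟨Function.update χ c (!β), fun a b hab => ?_⟩
  by_cases hne : s(a, b) = s(c, y)
  · rcases Sym2.eq_iff.1 hne with ⟨rfl, rfl⟩ | ⟨rfl, rfl⟩
    exacts [hcy, Ne.symm hcy]
  · exact hχ' a b hab hne

/-- A connected closed graph which contains `H` minus an edge with many long legs, and a triangle,
is complete. -/
theorem HasLegs.eq_top (h : HasLegs G φ L leg) (hL : Fintype.card W ≤ L)
    (hs : Fintype.card W + 3 ≤ s) (hG : IsDynamicsClosed H G) (hconn : G.Preconnected)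
    (hdeg : ∀ v, 2 ≤ H.degree v) (hsum : ∑ v, H.degree v ≤ 2 * Fintype.card W + 2)
    {w : W} (hw : H.degree w = 2) {x y : W} (hxy : H.Adj x y)
    (hφ : ∀ a b, H.Adj a b → s(a, b) ≠ s(x, y) → G.Adj (φ a) (φ b))
    {c₁ c₂ c₃ : V} (h₁₂ : G.Adj c₁ c₂) (h₂₃ : G.Adj c₂ c₃) (h₁₃ : G.Adj c₁ c₃) : G = ⊤ := by
  classical
  have : Nonempty (Fin s) := ⟨⟨0, by omega⟩⟩
  -- Closedness supplies the deleted edge `xy`.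
  have hφ' : ∀ a b, H.Adj a b → G.Adj (φ a) (φ b) := by
    have hx := hG φ h.injective x y hxy hφ
    intro a b hab
    by_cases hne : s(a, b) = s(x, y)
    · rcases Sym2.eq_iff.1 hne with ⟨rfl, rfl⟩ | ⟨rfl, rfl⟩
      exacts [hx, hx.symm]
    · exact hφ a b hab hne
  have hL2 : 2 ≤ L := by
    have := Fintype.one_lt_card_iff.2 ⟨x, y, hxy.ne⟩
    omega
  have hB := h.hasBiclique hL2 hG hφ' hdeg hsum hw
  obtain ⟨z₁, z₂, hz⟩ := exists_hasTwoNeighbors hw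
  by_cases hH : ∃ χ : W → Bool, ∀ a b, H.Adj a b → χ a ≠ χ b
  · obtain ⟨χ, hχ⟩ := hH
    obtain ⟨S, hdisj, hcard, hadj⟩ := hB
    exact hG.eq_top_of_biclique hconn hz hχ hdisj (fun i => hs.trans_eq (hcard i).symm) hadj
      h₁₂ h₂₃ h₁₃
  have hK : HasClique G s := by
    -- Either every odd cycle meets a vertex of degree above two apart from its root, and the
    -- biclique is turned into a clique through a single bad edge, or some odd cycle is attached at
    -- its root only and can be unrolled along the legs.
    by_cases hodd : ∀ (m : ℕ) (f : ℕ → W), 1 ≤ m → (∀ i, f (i + (2 * m + 1)) = f i) →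
      (∀ i, H.Adj (f i) (f (i + 1))) → (∀ i j, f i = f j → i % (2 * m + 1) = j % (2 * m + 1)) →
      ∃ i < 2 * m, H.degree (f (i + 1)) ≠ 2
    · obtain ⟨χ, x, y, hxy, hχxy, hχ⟩ := exists_coloring_of_odd_cycles hdeg hsum hH hodd
      exact hG.hasClique_of_hasBiclique (by omega) hB hxy hχxy hχ
    push Not at hodd
    obtain ⟨m, f, hm, hper, hadj, hinj, hd⟩ := hodd
    have hinj' : ∀ i j, i < 2 * m + 1 → j < 2 * m + 1 → f i = f j → i = j := by
      intro i j hi hj hij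
      have := hinj i j hij
      rwa [Nat.mod_eq_of_lt hi, Nat.mod_eq_of_lt hj] at this
    -- The cycle fits into `H`, which is why legs of length `Fintype.card W` are long enough.
    have hm' : 2 * m + 1 ≤ Fintype.card W := by
      have := Fintype.card_le_of_injective (fun i : Fin (2 * m + 1) => f i)
        fun i j hij => Fin.ext (hinj' i j i.2 j.2 hij)
      simpa using this
    refine h.hasClique_of_odd hG hφ' hm (by omega) hper hadj hinj' fun i hi a ha => ?_
    have hne : f i ≠ f (i + 2) := fun h' => by
      have h1 : 0 + i ≡ 2 + i [MOD 2 * m + 1] := by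
        rw [zero_add, add_comm 2]; exact hinj _ _ h'
      have h3 : 0 % (2 * m + 1) = 2 % (2 * m + 1) := Nat.ModEq.add_right_cancel' _ h1
      rw [Nat.zero_mod, Nat.mod_eq_of_lt (by omega)] at h3
      omega
    exact ((hasTwoNeighbors_of_adj (hd i hi) (hadj i).symm (hadj (i + 1)) hne).2 a).1 ha
  obtain ⟨K, hcard, hK⟩ := hK
  exact hG.eq_top_of_clique hconn hz (hs.trans_eq hcard.symm) hK

end Structure

/-! ### Sparsity from the activation density -/

section Sparse

/-- Every set of vertices spans at most as many edges of `B` as it has elements. -/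
def SimpleGraph.IsSparse {β : Type*} (B : SimpleGraph β) : Prop :=
  ∀ S : Finset β, {e ∈ B.edgeSet | ∀ v ∈ e, v ∈ S}.ncard ≤ S.card

variable {W : Type*}

lemma ncard_edges_le_choose {β : Type*} (B : SimpleGraph β) (S : Finset β) :
    {e ∈ B.edgeSet | ∀ v ∈ e, v ∈ S}.ncard ≤ S.card.choose 2 := by
  classical
  rw [← Sym2.card_image_offDiag, ← Set.ncard_coe_finset]
  refine Set.ncard_le_ncard ?_ (Finset.finite_toSet _)
  rintro e ⟨he, hS⟩
  induction e using Sym2.ind with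
  | _ a b =>
  simp only [Finset.coe_image, Set.mem_image, Finset.mem_coe, Finset.mem_offDiag]
  exact ⟨(a, b), ⟨hS a (by simp), hS b (by simp), SimpleGraph.Adj.ne he⟩, rfl⟩

/-- If the critical activation density of `H` is one, then deleting a suitable edge makes `H`
sparse. -/
lemma exists_isSparse_deleteEdge [Fintype W] {H : SimpleGraph W} (hρ : activationDensity H = 1) :
    ∃ x y, H.Adj x y ∧ (H.deleteEdges {s(x, y)}).IsSparse := by
  classical
  -- The slack is such that `(1 + 1 / (|W| + 1)) * |S|` stays below `|S| + 1`, so that an integer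
  -- below it is at most `|S|`.
  have hlt : activationDensity H < ENNReal.ofReal (1 + 1 / (Fintype.card W + 1)) := by
    rw [hρ, ← ENNReal.ofReal_one]
    refine (ENNReal.ofReal_lt_ofReal_iff (by positivity)).2 ?_
    have : (0 : ℝ) < 1 / (Fintype.card W + 1) := by positivity
    linarith
  simp only [activationDensity, iInf_lt_iff] at hlt
  obtain ⟨k, A, e, he, hF⟩ := hlt
  -- The dynamics from `A` activates something, so its first step must find a copy of `H` with at
  -- most one edge missing.
  obtain ⟨ψ, hψ, x, y, hxy, hcopy⟩ : ∃ ψ : W → Fin k, Function.Injective ψ ∧ ∃ x y, H.Adj x y ∧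
      ∀ a b, H.Adj a b → s(a, b) ≠ s(x, y) → A.Adj (ψ a) (ψ b) := by
    by_contra hno
    have hfix : dynamicsStep H A = A := by
      refine le_antisymm (sup_le le_rfl fun u v huv => ?_) (le_dynamicsStep H A)
      rw [SimpleGraph.fromEdgeSet_adj] at huv
      obtain ⟨ψ, hψ, x, y, hxy, -, h⟩ := completesCopy_iff.1 huv.1
      exact absurd ⟨ψ, hψ, x, y, hxy, h⟩ hno
    have : dynamicsClosure H A = A := by
      simp [dynamicsClosure, Function.iterate_fixed hfix]
    rw [this] at he
    exact he.2 he.1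
  refine ⟨x, y, hxy, fun S => ?_⟩
  set T := {e' ∈ (H.deleteEdges {s(x, y)}).edgeSet | ∀ v ∈ e', v ∈ S} with hT
  have hTmem : ∀ p q, s(p, q) ∈ T ↔ (H.Adj p q ∧ s(p, q) ≠ s(x, y)) ∧ p ∈ S ∧ q ∈ S := by
    intro p q
    simp [hT]
  -- Small sets are treated directly, so that below `F` has at least three vertices.
  rcases le_or_gt S.card 2 with hS | hS
  · refine (ncard_edges_le_choose _ S).trans ?_
    interval_cases S.card <;> simp
  -- `F` is the image of the edges of `H - xy` inside `S`, together with `e`. The edge `e` need not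
  -- belong to this copy of `H`; it adds at most two vertices, which the `- 2` in the density
  -- compensates, and it adds exactly one edge as it is not in `A`.
  let F : (A ⊔ SimpleGraph.fromEdgeSet {e}).Subgraph :=
    { verts := ψ '' S ∪ {v | v ∈ e}
      Adj := fun a b => s(a, b) ∈ Sym2.map ψ '' T ∪ {e}
      adj_sub := by
        rintro a b (⟨f, hf, hab⟩ | hab)
        · induction f using Sym2.ind with
          | _ p q =>
          have := (hTmem p q).1 hf
          have h1 : A.Adj (ψ p) (ψ q) := hcopy p q this.1.1 this.1.2
          have h2 : s(a, b) ∈ A.edgeSet := by rw [← hab]; exact h1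
          exact Or.inl h2
        · refine Or.inr ?_
          rw [SimpleGraph.fromEdgeSet_adj]
          refine ⟨hab, ?_⟩
          have h3 : s(a, b) ∈ (dynamicsClosure H A).edgeSet := hab ▸ he.1
          exact ((dynamicsClosure H A).mem_edgeSet.1 h3).ne
      edge_vert := by
        rintro a b (⟨f, hf, hab⟩ | hab)
        · induction f using Sym2.ind with
          | _ p q =>
          have := (hTmem p q).1 hf
          rcases Sym2.eq_iff.1 hab with ⟨h1, -⟩ | ⟨-, h1⟩
          · exact Or.inl ⟨p, this.2.1, h1⟩
          · exact Or.inl ⟨q, this.2.2, h1⟩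
        · refine Or.inr ?_
          change a ∈ e
          rw [← show s(a, b) = e from hab]
          simp
      symm := ⟨fun a b h => by rwa [Sym2.eq_swap]⟩ }
  have hFe : F.edgeSet = Sym2.map ψ '' T ∪ {e} := by
    ext f
    induction f using Sym2.ind with
    | _ a b => rfl
  have hcardE : F.edgeSet.ncard = T.ncard + 1 := by
    rw [hFe, Set.union_singleton, Set.ncard_insert_of_notMem, Set.ncard_image_of_injective]
    · exact Sym2.map.injective hψ
    · rintro ⟨f, hf, hfe⟩
      induction f using Sym2.ind with
      | _ p q =>
      have := (hTmem p q).1 hf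
      apply he.2
      rw [← hfe]
      exact hcopy p q this.1.1 this.1.2
  have hcardV : F.verts.ncard ≤ S.card + 2 := by
    refine (Set.ncard_union_le _ _).trans (Nat.add_le_add ?_ ?_)
    · rw [Set.ncard_image_of_injective _ hψ, Set.ncard_coe_finset]
    · induction e using Sym2.ind with
      | _ a b =>
      have : {v | v ∈ s(a, b)} = ({a, b} : Set (Fin k)) := by ext; simp
      rw [this]
      refine (Set.ncard_insert_le a {b}).trans ?_
      rw [Set.ncard_singleton]
  have hcardV' : S.card ≤ F.verts.ncard := by
    have : (ψ '' S).ncard = S.card := by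
      rw [Set.ncard_image_of_injective _ hψ, Set.ncard_coe_finset]
    rw [← this]
    exact Set.ncard_le_ncard Set.subset_union_left (Set.toFinite _)
  have h1 : ENNReal.ofReal (((F.edgeSet.ncard : ℝ) - 1) / ((F.verts.ncard : ℝ) - 2)) <
      ENNReal.ofReal (1 + 1 / (Fintype.card W + 1)) := by
    refine lt_of_le_of_lt ?_ hF
    exact le_iSup₂_of_le F (by rw [hFe]; exact Or.inr rfl) (le_iSup_of_le (by omega) le_rfl)
  rw [ENNReal.ofReal_lt_ofReal_iff (by positivity), hcardE] at h1
  have hV3 : (3 : ℝ) ≤ F.verts.ncard := by exact_mod_cast (by omega : 3 ≤ F.verts.ncard)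
  have hVS : (F.verts.ncard : ℝ) ≤ S.card + 2 := by exact_mod_cast hcardV
  have hSW : (S.card : ℝ) ≤ Fintype.card W := by exact_mod_cast S.card_le_univ
  have hW0 : (0 : ℝ) < Fintype.card W + 1 := by positivity
  rw [div_lt_iff₀ (by linarith)] at h1
  push_cast at h1
  have h2 : (T.ncard : ℝ) < S.card + 1 := by
    calc (T.ncard : ℝ) = (T.ncard : ℝ) + 1 - 1 := by ring
      _ < (1 + 1 / (Fintype.card W + 1)) * ((F.verts.ncard : ℝ) - 2) := h1
      _ ≤ (1 + 1 / (Fintype.card W + 1)) * S.card := by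
          gcongr
          linarith
      _ = S.card + S.card / (Fintype.card W + 1) := by ring
      _ ≤ S.card + 1 := by
          gcongr
          rw [div_le_one hW0]
          linarith
  have h3 : T.ncard < S.card + 1 := by exact_mod_cast h2
  omega

end Sparse

/-! ### The gadget, and percolation of connected graphs containing it -/

section Gadget

variable {W : Type*}

/-- The vertices of the legs and of the triangle in the gadget of `H`. -/
abbrev GadgetExtra (W : Type*) (s L : ℕ) : Type _ := (W × (Bool × Fin s) × Fin L) ⊕ Fin 3

/-- The `t`-th vertex on a leg of the gadget. -/
def gadgetLeg {s L : ℕ} (v : W) (j : Bool × Fin s) (t : ℕ) : W ⊕ GadgetExtra W s L :=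
  -- Position `t` with `1 ≤ t ≤ L` is stored at index `t - 1`; position `0` is the root, which is
  -- also the default value beyond `L`.
  if ht : t - 1 < L ∧ t ≠ 0 then Sum.inr (Sum.inl (v, j, ⟨t - 1, ht.1⟩)) else Sum.inl v

/-- Each of the extra vertices of the gadget is joined to its parent. -/
def gadgetParent {s L : ℕ} : GadgetExtra W s L → W ⊕ GadgetExtra W s L
  -- The vertex stored at index `t` has position `t + 1`, so its parent has position `t`. The
  -- corners of the triangle have each other as parents, cyclically.
  | Sum.inl (v, j, t) => gadgetLeg v j t
  | Sum.inr i => Sum.inr (Sum.inr (i + 1))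

/-- The gadget of a graph `D`: it consists of `D`, of `2 * s` paths of length `L` attached at each
vertex, and of a triangle. -/
def gadget (D : SimpleGraph W) (s L : ℕ) : SimpleGraph (W ⊕ GadgetExtra W s L) :=
  SimpleGraph.fromEdgeSet
    (Sym2.map Sum.inl '' D.edgeSet ∪ Set.range fun u => s(Sum.inr u, gadgetParent u))

/-- Each edge outside `D` is charged to the extra vertex whose parent edge it is, so a set
containing `k` extra vertices gains at most `k` edges. -/
lemma gadget_isSparse [Finite W] {D : SimpleGraph W} (hD : D.IsSparse) (s L : ℕ) :
    (gadget D s L).IsSparse := by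
  classical
  intro S
  let S₁ : Finset W := S.preimage Sum.inl Sum.inl_injective.injOn
  let S₂ : Finset (GadgetExtra W s L) := S.preimage Sum.inr Sum.inr_injective.injOn
  have hS : S₁.card + S₂.card = S.card := by
    have h1 : S₁ = S.toLeft := by ext; simp [S₁]
    have h2 : S₂ = S.toRight := by ext; simp [S₂]
    rw [h1, h2, Finset.card_toLeft_add_card_toRight]
  have hsub : {e ∈ (gadget D s L).edgeSet | ∀ v ∈ e, v ∈ S} ⊆
      Sym2.map Sum.inl '' {e ∈ D.edgeSet | ∀ v ∈ e, v ∈ S₁} ∪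
        (fun u => s(Sum.inr u, gadgetParent u)) '' (S₂ : Set (GadgetExtra W s L)) := by
    rintro e ⟨he, hv⟩
    rw [gadget, SimpleGraph.edgeSet_fromEdgeSet] at he
    rcases he.1 with ⟨f, hf, rfl⟩ | ⟨u, rfl⟩
    · refine Or.inl ⟨f, ⟨hf, fun v hvf => ?_⟩, rfl⟩
      simpa [S₁] using hv (Sum.inl v) (Sym2.mem_map.2 ⟨v, hvf, rfl⟩)
    · refine Or.inr ⟨u, ?_, rfl⟩
      simpa [S₂] using hv (Sum.inr u) (by simp)
  calc _ ≤ _ := Set.ncard_le_ncard hsub (Set.toFinite _)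
    _ ≤ _ := Set.ncard_union_le _ _
    _ ≤ {e ∈ D.edgeSet | ∀ v ∈ e, v ∈ S₁}.ncard + (S₂ : Set (GadgetExtra W s L)).ncard :=
        Nat.add_le_add (Set.ncard_image_le (Set.toFinite _)) (Set.ncard_image_le (Set.toFinite _))
    _ ≤ S₁.card + S₂.card := Nat.add_le_add (hD S₁) (Set.ncard_coe_finset S₂).le
    _ = S.card := hS

lemma gadgetLeg_inj {s L : ℕ} {v v' : W} {j j' : Bool × Fin s} {t t' : ℕ} (ht : t ≤ L)
    (ht' : t' ≤ L) (h : (gadgetLeg v j t : W ⊕ GadgetExtra W s L) = gadgetLeg v' j' t') :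
    t = t' ∧ v = v' ∧ (t = 0 ∨ j = j') := by
  unfold gadgetLeg at h
  split_ifs at h with h1 h2 h2
  · simp only [Sum.inr.injEq, Sum.inl.injEq, Prod.mk.injEq, Fin.mk.injEq] at h
    exact ⟨by omega, h.1, Or.inr h.2.1⟩
  · simp only [Sum.inl.injEq] at h
    exact ⟨by omega, h, Or.inl (by omega)⟩

lemma gadget_adj_leg (D : SimpleGraph W) {s L : ℕ} (v : W) (j : Bool × Fin s) {t : ℕ}
    (ht : t < L) : (gadget D s L).Adj (gadgetLeg v j t) (gadgetLeg v j (t + 1)) := by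
  rw [gadget, SimpleGraph.fromEdgeSet_adj]
  refine ⟨Or.inr ⟨Sum.inl (v, j, ⟨t, ht⟩), ?_⟩, fun h => ?_⟩
  · simp only [gadgetParent]
    rw [Sym2.eq_swap]
    congr 2
    simp [gadgetLeg, ht]
  · have := (gadgetLeg_inj ht.le ht h).1
    omega

lemma gadget_adj_triangle (D : SimpleGraph W) {s L : ℕ} (i : Fin 3) :
    (gadget D s L).Adj (Sum.inr (Sum.inr i)) (Sum.inr (Sum.inr (i + 1))) := by
  rw [gadget, SimpleGraph.fromEdgeSet_adj]
  refine ⟨Or.inr ⟨Sum.inr i, rfl⟩, fun h => ?_⟩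
  simp only [Sum.inr.injEq] at h
  revert h
  revert i
  decide

/-- Suppose that `ρ(H) = 1` and `δ(H) = 2`. Then there is a finite sparse graph `B` such that every
connected graph which contains `B` is `H`-percolating. -/
theorem exists_isSparse_forall_percolates {W : Type*} [Fintype W] (H : SimpleGraph W)
    [DecidableRel H.Adj] (hρ : activationDensity H = 1) (hδ : H.minDegree = 2) :
    ∃ (β : Type) (_ : Fintype β) (B : SimpleGraph β), B.IsSparse ∧
      ∀ {V : Type} (G : SimpleGraph V) (φ : β → V), Function.Injective φ →
        (∀ a b, B.Adj a b → G.Adj (φ a) (φ b)) → G.Connected → Percolates H G := by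
  classical
  obtain ⟨x, y, hxy, hsparse⟩ := exists_isSparse_deleteEdge hρ
  have hdeg : ∀ v, 2 ≤ H.degree v := fun v => hδ ▸ H.minDegree_le_degree v
  -- Sparsity of `H - xy` on the full vertex set bounds its edges by `|W|`; the deleted edge
  -- accounts for the extra `2`.
  have hsum : ∑ v, H.degree v ≤ 2 * Fintype.card W + 2 := by
    have h1 := hsparse Finset.univ
    simp only [Finset.mem_univ, implies_true, and_true, Set.ofPred_mem_eq, Finset.card_univ,
      SimpleGraph.edgeSet_deleteEdges] at h1
    have h2 : H.edgeSet.ncard = (H.edgeSet \ {s(x, y)}).ncard + 1 :=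
      (Set.ncard_sdiff_singleton_add_one (show s(x, y) ∈ H.edgeSet from hxy) (Set.toFinite _)).symm
    rw [SimpleGraph.sum_degrees_eq_twice_card_edges]
    have h3 : H.edgeSet.ncard = H.edgeFinset.card := by
      rw [← SimpleGraph.coe_edgeFinset, Set.ncard_coe_finset]
    omega
  have : Nonempty W := ⟨x⟩
  obtain ⟨w, hw⟩ := H.exists_minimal_degree_vertex
  rw [hδ] at hw
  -- The size `s` is what absorption needs from the core, and `L` suffices to unroll any odd cycle
  -- of `H`.
  let s := Fintype.card W + 3
  let L := Fintype.card W
  let β := W ⊕ GadgetExtra W s L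
  let B : SimpleGraph β := gadget (H.deleteEdges {s(x, y)}) s L
  -- The gadget is transported to `Fin n`, since `W` may live in a higher universe than the required
  -- `Type`.
  let n := Fintype.card β
  let ε : Fin n ≃ β := (Fintype.equivFin β).symm
  refine ⟨Fin n, inferInstance, B.comap ε, ?_, ?_⟩
  · intro S
    have h1 := gadget_isSparse hsparse s L (S.map ε.toEmbedding)
    rw [Finset.card_map] at h1
    refine le_trans ?_ h1
    rw [← Set.ncard_image_of_injective _ (Sym2.map.injective ε.injective)]
    refine Set.ncard_le_ncard ?_ (Set.toFinite _)
    rintro _ ⟨e, ⟨he, hv⟩, rfl⟩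
    induction e using Sym2.ind with
    | _ a b =>
    refine ⟨he, fun v hv' => ?_⟩
    obtain ⟨u, hu, rfl⟩ := Sym2.mem_map.1 hv'
    exact Finset.mem_map_of_mem _ (hv u hu)
  · intro V G φ hφ hBG hconn
    let θ : β → V := φ ∘ ε.symm
    have hθ : Function.Injective θ := hφ.comp ε.symm.injective
    have hle := le_dynamicsClosure H G
    have hθB : ∀ a b, B.Adj a b → (dynamicsClosure H G).Adj (θ a) (θ b) := by
      intro a b hab
      exact hle (hBG _ _ (by simpa [SimpleGraph.comap_adj] using hab))
    have hlegs : HasLegs (dynamicsClosure H G) (θ ∘ Sum.inl) L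
        (fun v (j : Bool × Fin s) t => θ (gadgetLeg v j t)) := by
      refine ⟨fun v j => ?_, fun v j t ht => ?_, fun v j t v' j' t' ht ht' h => ?_⟩
      · simp [gadgetLeg]
      · exact hθB _ _ (gadget_adj_leg _ v j ht)
      · exact gadgetLeg_inj ht ht' (hθ h)
    refine hlegs.eq_top le_rfl le_rfl (isDynamicsClosed_dynamicsClosure H G)
      (hconn.preconnected.mono hle) hdeg hsum hw.symm hxy (fun a b hab hne => ?_)
      (hθB _ _ (gadget_adj_triangle _ 0)) (hθB _ _ (gadget_adj_triangle _ 1))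
      (hθB _ _ (gadget_adj_triangle _ 2)).symm
    refine hθB _ _ ?_
    rw [show B = gadget (H.deleteEdges {s(x, y)}) s L from rfl, gadget, SimpleGraph.fromEdgeSet_adj]
    refine ⟨Or.inl ⟨s(a, b), ?_, rfl⟩, fun h => hab.ne (Sum.inl_injective h)⟩
    rw [SimpleGraph.edgeSet_deleteEdges]
    exact ⟨hab, hne⟩

/-- If `δ(H) = 2`, then a percolating graph has no isolated vertices. -/
lemma Percolates.exists_adj {W V : Type*} [Fintype W] {H : SimpleGraph W} [DecidableRel H.Adj]
    (hδ : H.minDegree = 2) {G : SimpleGraph V} [Nontrivial V] (hG : Percolates H G) (v : V) :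
    ∃ u, G.Adj v u := by
  classical
  by_contra hv
  push Not at hv
  obtain ⟨u, hu⟩ := exists_ne v
  refine dynamicsClosure_isolated (H := H) (fun x y _ => ?_) hv u ?_
  · have h2 : 1 < (H.neighborFinset x).card := by
      rw [SimpleGraph.card_neighborFinset_eq_degree]
      have := H.minDegree_le_degree x
      omega
    obtain ⟨z, hz, hzy⟩ := Finset.exists_mem_ne h2 y
    exact ⟨z, hzy, by simpa using hz⟩
  · rw [show dynamicsClosure H G = ⊤ from hG, SimpleGraph.top_adj]
    exact hu.symm

end Gadget

/-! ### Uniform frequencies and the second moment method -/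

section Uniform

/-- The fraction of the elements of a finite type which satisfy a predicate. -/
noncomputable def freq {Ω : Type*} (P : Ω → Prop) : ℝ := ({ω | P ω}.ncard : ℝ) / Nat.card Ω

lemma freq_nonneg {Ω : Type*} (P : Ω → Prop) : 0 ≤ freq P := by unfold freq; positivity

lemma freq_mono {Ω : Type*} [Finite Ω] {P Q : Ω → Prop} (h : ∀ ω, P ω → Q ω) : freq P ≤ freq Q := by
  unfold freq
  have : {ω | P ω}.ncard ≤ {ω | Q ω}.ncard := Set.ncard_le_ncard (fun ω => h ω) (Set.toFinite _)
  gcongr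

lemma freq_or_le {Ω : Type*} (P Q : Ω → Prop) : freq (fun ω => P ω ∨ Q ω) ≤ freq P + freq Q := by
  unfold freq
  rw [← add_div]
  gcongr
  exact_mod_cast Set.ncard_union_le {ω | P ω} {ω | Q ω}

lemma freq_exists_le {Ω ι : Type*} [Finite Ω] (s : Finset ι) (P : ι → Ω → Prop) :
    freq (fun ω => ∃ i ∈ s, P i ω) ≤ ∑ i ∈ s, freq (P i) := by
  classical
  induction s using Finset.induction_on with
  | empty => simp [freq]
  | insert a s ha ih =>
    rw [Finset.sum_insert ha]
    refine le_trans (freq_mono ?_) ((freq_or_le (P a) (fun ω => ∃ i ∈ s, P i ω)).trans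
      (by gcongr))
    rintro ω ⟨i, hi, h⟩
    rcases Finset.mem_insert.1 hi with rfl | hi
    exacts [Or.inl h, Or.inr ⟨i, hi, h⟩]

lemma freq_add_freq_not {Ω : Type*} [Finite Ω] [Nonempty Ω] (P : Ω → Prop) :
    freq P + freq (fun ω => ¬ P ω) = 1 := by
  unfold freq
  rw [← add_div, div_eq_one_iff_eq (by exact_mod_cast Nat.card_pos.ne')]
  have := Set.ncard_add_ncard_compl {ω | P ω}
  exact_mod_cast this

lemma freq_le_one {Ω : Type*} [Finite Ω] (P : Ω → Prop) : freq P ≤ 1 := by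
  unfold freq
  refine div_le_one_of_le₀ ?_ (by positivity)
  have := Set.ncard_le_ncard (Set.subset_univ {ω | P ω}) (Set.toFinite _)
  rw [Set.ncard_univ] at this
  exact_mod_cast this

lemma freq_eq_sum {Ω : Type*} [Fintype Ω] (P : Ω → Prop) [DecidablePred P] :
    freq P = (∑ ω, if P ω then (1 : ℝ) else 0) / Fintype.card Ω := by
  rw [freq, Nat.card_eq_fintype_card, Finset.sum_boole, Set.ncard_eq_toFinset_card']
  congr 3
  ext
  simp

/-- The second moment method. -/
lemma freq_eq_zero_le {Ω : Type*} [Fintype Ω] [Nonempty Ω] (X : Ω → ℝ) {μ δ : ℝ} (hμ : 0 < μ)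
    (h1 : (∑ ω, X ω) / Fintype.card Ω = μ) (h2 : (∑ ω, X ω ^ 2) / Fintype.card Ω ≤ (1 + δ) * μ ^ 2) :
    freq (fun ω => X ω = 0) ≤ δ := by
  classical
  have hc : (0 : ℝ) < Fintype.card Ω := by exact_mod_cast Fintype.card_pos
  rw [freq_eq_sum]
  -- Each outcome with `X = 0` contributes `μ ^ 2` to the variance sum.
  have h3 : (∑ ω, if X ω = 0 then (1 : ℝ) else 0) * μ ^ 2 ≤ ∑ ω, (X ω - μ) ^ 2 := by
    rw [Finset.sum_mul]
    refine Finset.sum_le_sum fun ω _ => ?_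
    split_ifs with h
    · rw [h]; simp
    · rw [zero_mul]; positivity
  have h4 : ∑ ω, (X ω - μ) ^ 2 = ∑ ω, X ω ^ 2 - 2 * μ * ∑ ω, X ω + Fintype.card Ω * μ ^ 2 := by
    simp only [sub_sq, Finset.sum_add_distrib, Finset.sum_sub_distrib, Finset.sum_const,
      Finset.card_univ, nsmul_eq_mul, Finset.mul_sum]
    congr 2
    exact Finset.sum_congr rfl fun ω _ => by ring
  rw [div_eq_iff hc.ne'] at h1
  rw [div_le_iff₀ hc] at h2
  rw [div_le_iff₀ hc]
  have h5 : (∑ ω, if X ω = 0 then (1 : ℝ) else 0) * μ ^ 2 ≤ δ * Fintype.card Ω * μ ^ 2 := by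
    rw [h4, h1] at h3
    nlinarith
  exact le_of_mul_le_mul_right h5 (by positivity)

end Uniform

/-! ### The first elements of a random ordering -/

section FirstSet

variable {X : Type*} [Fintype X] {N : ℕ}

/-- The set of the first `m` elements of an ordering. -/
def firstSet (π : Fin N ≃ X) (m : ℕ) : Finset X := {x | (π.symm x : ℕ) < m}

lemma mem_firstSet {π : Fin N ≃ X} {m : ℕ} {x : X} : x ∈ firstSet π m ↔ (π.symm x : ℕ) < m := by
  simp [firstSet]

lemma firstSet_mono (π : Fin N ≃ X) {m m' : ℕ} (h : m ≤ m') : firstSet π m ⊆ firstSet π m' :=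
  fun _ hx => mem_firstSet.2 ((mem_firstSet.1 hx).trans_le h)

lemma card_firstSet (π : Fin N ≃ X) {m : ℕ} (hm : m ≤ N) : (firstSet π m).card = m := by
  have : firstSet π m = (Finset.univ.filter fun i : Fin N => (i : ℕ) < m).map π.toEmbedding := by
    ext x
    simp only [mem_firstSet, Finset.mem_map_equiv, Finset.mem_filter, Finset.mem_univ, true_and]
  rw [this, Finset.card_map, Fin.card_filter_val_lt]
  omega

/-- Composing with a permutation of `X` that carries `A` to `A'` is a bijection between the two sets
of orderings. -/
lemma ncard_firstSet_eq [DecidableEq X] {m : ℕ} {A A' : Finset X} (h : A.card = A'.card) :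
    {π : Fin N ≃ X | firstSet π m = A}.ncard = {π : Fin N ≃ X | firstSet π m = A'}.ncard := by
  let e : {x // x ∈ A} ≃ {x // x ∈ A'} := Fintype.equivOfCardEq (by simpa using h)
  let σ : Equiv.Perm X := e.extendSubtype
  have hσ : ∀ x, σ x ∈ A' ↔ x ∈ A := fun x => by
    refine ⟨fun hx => ?_, fun hx => e.extendSubtype_mem x hx⟩
    by_contra hA
    exact e.extendSubtype_not_mem x hA hx
  refine Set.ncard_congr (fun π _ => π.trans σ) ?_ ?_ ?_
  · intro π hπ
    ext x
    have : x ∈ A' ↔ σ.symm x ∈ A := by rw [← hσ, Equiv.apply_symm_apply]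
    rw [this, ← show firstSet π m = A from hπ, mem_firstSet, mem_firstSet, Equiv.symm_trans_apply]
  · intro π π' _ _ hππ
    ext i
    exact σ.injective (Equiv.congr_fun hππ i)
  · intro π hπ
    refine ⟨π.trans σ.symm, ?_, by ext; simp⟩
    ext x
    rw [← hσ, ← show firstSet π m = A' from hπ, mem_firstSet, mem_firstSet, Equiv.symm_trans_apply,
      Equiv.symm_symm]

/-- The set of the first `m` elements of a random ordering is a uniformly random `m`-set. -/
lemma freq_firstSet (hN : Fintype.card X = N) {m : ℕ} (hm : m ≤ N) (Q : Finset X → Prop)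
    [DecidablePred Q] : freq (fun π : Fin N ≃ X => Q (firstSet π m)) =
      (((Finset.powersetCard m Finset.univ).filter Q).card : ℝ) / N.choose m := by
  classical
  -- Orderings are counted by their set of first `m` elements; all fibres have the same size, which
  -- cancels.
  let c : Finset X → ℕ := fun A => {π : Fin N ≃ X | firstSet π m = A}.ncard
  have key : ∀ Q : Finset X → Prop, [DecidablePred Q] → {π : Fin N ≃ X | Q (firstSet π m)}.ncard =
      ∑ A ∈ (Finset.powersetCard m Finset.univ).filter Q, c A := by
    intro Q _
    have := Finset.card_eq_sum_card_fiberwise (s := Finset.univ.filter fun π : Fin N ≃ X =>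
      Q (firstSet π m)) (t := (Finset.powersetCard m Finset.univ).filter Q)
      (f := fun π => firstSet π m) (fun π hπ => by
        simp only [Finset.coe_filter, Finset.mem_univ, true_and, Set.mem_ofPred_eq] at hπ
        simp [hπ, card_firstSet π hm])
    rw [Set.ncard_eq_toFinset_card', Set.toFinset_ofPred, this]
    refine Finset.sum_congr rfl fun A hA => ?_
    simp only [c]
    rw [Set.ncard_eq_toFinset_card', Set.toFinset_ofPred, Finset.filter_filter]
    congr 1
    ext π
    simp only [Finset.mem_filter, Finset.mem_univ, true_and, and_iff_right_iff_imp]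
    rintro rfl
    exact (Finset.mem_filter.1 hA).2
  obtain ⟨A₀, -, hA₀⟩ := Finset.exists_subset_card_eq (s := (Finset.univ : Finset X)) (n := m)
    (by simpa [hN] using hm)
  have hc : ∀ A ∈ Finset.powersetCard m (Finset.univ : Finset X), c A = c A₀ := fun A hA =>
    ncard_firstSet_eq ((Finset.mem_powersetCard.1 hA).2.trans hA₀.symm)
  have hQ : ({π : Fin N ≃ X | Q (firstSet π m)}.ncard : ℝ) =
      ((Finset.powersetCard m Finset.univ).filter Q).card * c A₀ := by
    rw [key Q, Finset.sum_congr rfl fun A hA => hc A (Finset.mem_filter.1 hA).1]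
    simp
  have hT : (Nat.card (Fin N ≃ X) : ℝ) = N.choose m * c A₀ := by
    have := key (fun _ => True)
    rw [Finset.filter_true_of_mem (fun _ _ => trivial), Finset.sum_congr rfl hc] at this
    simp [hN, Set.ncard_univ] at this
    rw [← Nat.card_eq_fintype_card] at this
    exact_mod_cast this
  have hne : (Nat.card (Fin N ≃ X) : ℝ) ≠ 0 := by
    have : Nonempty (Fin N ≃ X) := ⟨(Fintype.equivFinOfCardEq hN).symm⟩
    exact_mod_cast Nat.card_pos.ne'
  rw [freq, hQ, hT, mul_div_mul_right]
  intro h0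
  rw [hT, h0, mul_zero] at hne
  exact hne rfl

lemma card_powersetCard_subset_disjoint [DecidableEq X] (hN : Fintype.card X = N) {m : ℕ} {T U : Finset X}
    (hTU : Disjoint T U) (hT : T.card ≤ m) :
    ((Finset.powersetCard m (Finset.univ : Finset X)).filter
      fun A => T ⊆ A ∧ Disjoint U A).card = (N - T.card - U.card).choose (m - T.card) := by
  have : (N - T.card - U.card) = (Finset.univ \ (T ∪ U)).card := by
    rw [Finset.card_sdiff_of_subset (Finset.subset_univ _), Finset.card_union_of_disjoint hTU,
      Finset.card_univ, hN]
    omega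
  rw [this, ← Finset.card_powersetCard]
  symm
  refine Finset.card_bij' (fun A _ => A ∪ T) (fun A _ => A \ T) ?_ ?_ ?_ ?_
  · intro A hA
    rw [Finset.mem_powersetCard] at hA
    have hAT : Disjoint A T := Finset.disjoint_left.2 fun x hx hxT => by
      have := hA.1 hx
      simp [hxT] at this
    have hAU : Disjoint U A := Finset.disjoint_right.2 fun x hx hxU => by
      have := hA.1 hx
      simp [hxU] at this
    simp only [Finset.mem_filter, Finset.mem_powersetCard, Finset.subset_univ, true_and]
    refine ⟨?_, Finset.subset_union_right, ?_⟩
    · rw [Finset.card_union_of_disjoint hAT, hA.2]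
      omega
    · rw [Finset.disjoint_union_right]
      exact ⟨hAU, hTU.symm⟩
  · intro A hA
    simp only [Finset.mem_filter, Finset.mem_powersetCard, Finset.subset_univ, true_and] at hA
    rw [Finset.mem_powersetCard]
    refine ⟨fun x hx => ?_, ?_⟩
    · rw [Finset.mem_sdiff] at hx
      simp only [Finset.mem_sdiff, Finset.mem_univ, true_and, Finset.mem_union, not_or]
      exact ⟨hx.2, fun hU => Finset.disjoint_left.1 hA.2.2 hU hx.1⟩
    · rw [Finset.card_sdiff_of_subset hA.2.1, hA.1]
  · intro A hA
    rw [Finset.mem_powersetCard] at hA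
    have hAT : Disjoint A T := Finset.disjoint_left.2 fun x hx hxT => by
      have := hA.1 hx
      simp [hxT] at this
    exact Finset.union_sdiff_cancel_right hAT
  · intro A hA
    simp only [Finset.mem_filter] at hA
    exact Finset.sdiff_union_of_subset hA.2.1

/-- The probability that the first `m` elements contain `T` and avoid `U`. -/
lemma freq_subset_disjoint [DecidableEq X] (hN : Fintype.card X = N) {m : ℕ} (hm : m ≤ N) {T U : Finset X}
    (hTU : Disjoint T U) (hT : T.card ≤ m) :
    freq (fun π : Fin N ≃ X => T ⊆ firstSet π m ∧ Disjoint U (firstSet π m)) =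
      ((N - T.card - U.card).choose (m - T.card) : ℝ) / N.choose m := by
  classical
  rw [freq_firstSet hN hm (fun A => T ⊆ A ∧ Disjoint U A),
    card_powersetCard_subset_disjoint hN hTU hT]

end FirstSet

/-! ### Estimates for ratios of binomial coefficients -/

section Choose

/-- Factor by factor, `(a - i) / (b - i) ≤ a / b` because `a ≤ b`. -/
lemma descFactorial_mul_pow_le {a b : ℕ} (hab : a ≤ b) (k : ℕ) :
    a.descFactorial k * b ^ k ≤ b.descFactorial k * a ^ k := by
  induction k with
  | zero => simp
  | succ k ih =>
    rw [Nat.descFactorial_succ, Nat.descFactorial_succ, pow_succ, pow_succ]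
    have : (a - k) * b ≤ (b - k) * a := by
      rw [Nat.sub_mul, Nat.sub_mul, mul_comm b a]
      exact Nat.sub_le_sub_left (Nat.mul_le_mul_left k hab) _
    calc (a - k) * a.descFactorial k * (b ^ k * b)
        = ((a - k) * b) * (a.descFactorial k * b ^ k) := by ring
      _ ≤ ((b - k) * a) * (b.descFactorial k * a ^ k) := Nat.mul_le_mul this ih
      _ = _ := by ring

lemma descFactorial_div_le {a b : ℕ} (hab : a ≤ b) {k : ℕ} (hk : k ≤ b) :
    (a.descFactorial k : ℝ) / b.descFactorial k ≤ ((a : ℝ) / b) ^ k := by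
  rcases Nat.eq_zero_or_pos k with rfl | hk0
  · simp
  have hb : (0 : ℝ) < b := by exact_mod_cast (by omega : 0 < b)
  have hbk : (0 : ℝ) < b.descFactorial k := by
    exact_mod_cast Nat.pos_of_ne_zero (by simpa [Nat.descFactorial_eq_zero_iff_lt] using hk)
  rw [div_pow, div_le_div_iff₀ hbk (by positivity)]
  have := descFactorial_mul_pow_le hab k
  rw [mul_comm (b.descFactorial k)] at this
  exact_mod_cast this

lemma choose_div_choose (a b k : ℕ) :
    (a.choose k : ℝ) / b.choose k = (a.descFactorial k : ℝ) / b.descFactorial k := by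
  rw [Nat.descFactorial_eq_factorial_mul_choose, Nat.descFactorial_eq_factorial_mul_choose]
  push_cast
  rw [mul_div_mul_left]
  exact_mod_cast Nat.factorial_ne_zero k

lemma choose_sub_div_choose {N m t : ℕ} (htm : t ≤ m) (hmN : m ≤ N) :
    ((N - t).choose (m - t) : ℝ) / N.choose m = (m.descFactorial t : ℝ) / N.descFactorial t := by
  rw [← choose_div_choose, div_eq_div_iff]
  · have := Nat.choose_mul (n := N) (k := m) (s := t) htm
    rw [mul_comm ((m.choose t : ℕ) : ℝ)]
    rw [mul_comm (((N - t).choose (m - t) : ℕ) : ℝ)]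
    exact_mod_cast this.symm
  · exact_mod_cast (Nat.choose_pos hmN).ne'
  · exact_mod_cast (Nat.choose_pos (htm.trans hmN)).ne.symm

/-- Upper bound for the probability that the first `m` of `N` elements contain `t` given elements
and avoid `u` others. -/
lemma choose_sub_sub_div_choose_le {N m t u : ℕ} (htm : t ≤ m) (hmN : m ≤ N) :
    ((N - t - u).choose (m - t) : ℝ) / N.choose m ≤
      ((m : ℝ) / N) ^ t * Real.exp (-(u * (m - t) / N)) := by
  have h0 : (0 : ℝ) < (N - t).choose (m - t) := by
    exact_mod_cast Nat.choose_pos (by omega)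
  -- The first factor is the probability of containing the `t` elements, the second the conditional
  -- probability of avoiding the other `u`.
  have h1 : ((N - t - u).choose (m - t) : ℝ) / N.choose m =
      ((m.descFactorial t : ℝ) / N.descFactorial t) *
        (((N - t - u).descFactorial (m - t) : ℝ) / (N - t).descFactorial (m - t)) := by
    rw [← choose_sub_div_choose htm hmN, ← choose_div_choose]
    field_simp
  rw [h1]
  refine mul_le_mul (descFactorial_div_le hmN (htm.trans hmN)) ?_ (by positivity) (by positivity)
  refine (descFactorial_div_le (Nat.sub_le _ _) (by omega)).trans ?_
  rcases Nat.eq_zero_or_pos (m - t) with h2 | h2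
  · have h3 : m = t := by omega
    subst h3
    simp
  have hNt : (0 : ℝ) < ((N - t : ℕ) : ℝ) := by exact_mod_cast (by omega : 0 < N - t)
  have hN : (0 : ℝ) < N := by exact_mod_cast (by omega : 0 < N)
  have hmt : ((m : ℝ) - t) = ((m - t : ℕ) : ℝ) := by rw [Nat.cast_sub htm]
  rcases le_or_gt u (N - t) with hu | hu
  · have h4 : (((N - t - u : ℕ) : ℝ) / (N - t : ℕ)) ≤ Real.exp (-(u / (N : ℝ))) := by
      calc (((N - t - u : ℕ) : ℝ) / (N - t : ℕ)) = 1 - u / ((N - t : ℕ) : ℝ) := by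
            rw [Nat.cast_sub hu, sub_div, div_self hNt.ne']
        _ ≤ 1 - u / (N : ℝ) := by
            gcongr
            omega
        _ ≤ _ := by
            have := Real.add_one_le_exp (-(u / (N : ℝ)))
            linarith
    calc _ ≤ Real.exp (-(u / (N : ℝ))) ^ (m - t) := by gcongr
      _ = _ := by
        rw [← Real.exp_nat_mul, hmt]
        congr 1
        ring
  · rw [Nat.sub_eq_zero_of_le hu.le]
    simp only [Nat.cast_zero, zero_div]
    rw [zero_pow h2.ne']
    positivity

/-- Lower bound for the probability that the first `m` of `N` elements contain `t` given ones. -/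
lemma pow_le_choose_sub_div_choose {N m t : ℕ} (htm : t ≤ m) (hmN : m ≤ N) :
    (((m : ℝ) - t) / N) ^ t ≤ ((N - t).choose (m - t) : ℝ) / N.choose m := by
  rw [choose_sub_div_choose htm hmN, div_pow]
  have h1 : (0 : ℝ) < N.descFactorial t := by
    exact_mod_cast Nat.pos_of_ne_zero
      (by simpa [Nat.descFactorial_eq_zero_iff_lt] using htm.trans hmN)
  refine div_le_div₀ (by positivity) ?_ h1 ?_
  · rw [← Nat.cast_sub htm]
    have h2 : (m - t) ^ t ≤ m.descFactorial t :=
      (Nat.pow_le_pow_left (by omega) t).trans (Nat.pow_sub_le_descFactorial m t)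
    exact_mod_cast h2
  · exact_mod_cast Nat.descFactorial_le_pow N t

end Choose

/-! ### The graph process as a random ordering of edges -/

section GraphProcess

lemma card_edgeSet_top (n : ℕ) :
    Fintype.card (⊤ : SimpleGraph (Fin n)).edgeSet = n.choose 2 := by
  rw [← SimpleGraph.edgeFinset_card, SimpleGraph.card_edgeFinset_top_eq_card_choose_two,
    Fintype.card_fin]

instance (n : ℕ) : Nonempty (EdgeOrdering n) :=
  ⟨(Fintype.equivFinOfCardEq (card_edgeSet_top n)).symm⟩

lemma processProb_eq_freq (n : ℕ) (P : EdgeOrdering n → Prop) :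
    processProb n {π | P π} = freq P := rfl

/-- The edge of the complete graph with the given ends. -/
def topEdge {n : ℕ} {u v : Fin n} (h : u ≠ v) : (⊤ : SimpleGraph (Fin n)).edgeSet :=
  ⟨s(u, v), h⟩

lemma processGraph_adj {n : ℕ} {π : EdgeOrdering n} {m : ℕ} {u v : Fin n} :
    (processGraph π m).Adj u v ↔ ∃ h : u ≠ v, topEdge h ∈ firstSet π m := by
  rw [processGraph, SimpleGraph.fromEdgeSet_adj]
  constructor
  · rintro ⟨⟨i, hi, hiuv⟩, h⟩
    refine ⟨h, ?_⟩
    have : topEdge h = π i := Subtype.ext hiuv.symm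
    rw [mem_firstSet, this, Equiv.symm_apply_apply]
    exact hi
  · rintro ⟨h, hm⟩
    exact ⟨⟨π.symm (topEdge h), mem_firstSet.1 hm, by rw [Equiv.apply_symm_apply]; rfl⟩, h⟩

lemma processGraph_mono {n : ℕ} (π : EdgeOrdering n) {m m' : ℕ} (h : m ≤ m') :
    processGraph π m ≤ processGraph π m' := fun _ _ huv => by
  obtain ⟨h1, h2⟩ := processGraph_adj.1 huv
  exact processGraph_adj.2 ⟨h1, firstSet_mono π h h2⟩

end GraphProcess

/-! ### Appearance of sparse graphs by the second moment method -/

section Subgraph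

variable {β : Type*} {n : ℕ}

/-- The images of the edges of `B` under a placement of its vertices. -/
def edgeImage (B : SimpleGraph β) (φ : β ↪ Fin n) :
    B.edgeSet ↪ (⊤ : SimpleGraph (Fin n)).edgeSet where
  toFun e := ⟨Sym2.map φ e, by
    obtain ⟨e, he⟩ := e
    induction e using Sym2.ind with
    | _ a b => exact φ.injective.ne (B.mem_edgeSet.1 he).ne⟩
  inj' e e' h := Subtype.ext (Sym2.map.injective φ.injective (congrArg Subtype.val h))

lemma edgeImage_subset_firstSet {B : SimpleGraph β} [Fintype B.edgeSet] {φ : β ↪ Fin n}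
    {π : EdgeOrdering n} {m : ℕ} (h : Finset.univ.map (edgeImage B φ) ⊆ firstSet π m) (a b : β)
    (hab : B.Adj a b) : (processGraph π m).Adj (φ a) (φ b) := by
  refine processGraph_adj.2 ⟨φ.injective.ne hab.ne, h ?_⟩
  rw [Finset.mem_map]
  exact ⟨⟨s(a, b), hab⟩, Finset.mem_univ _, rfl⟩

variable [Fintype β]

/-- A common edge of the two copies, pulled back along `ψ`, is an edge of `B` with both ends mapped
into the range of `φ`. Sparsity bounds the number of these by the number of such vertices. -/
lemma card_inter_edgeImage_le {B : SimpleGraph β} [Fintype B.edgeSet] (hB : B.IsSparse)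
    (φ ψ : β ↪ Fin n) :
    (Finset.univ.map (edgeImage B φ) ∩ Finset.univ.map (edgeImage B ψ)).card ≤
      (Finset.univ.filter fun j => ψ j ∈ Set.range φ).card := by
  classical
  set S := Finset.univ.filter fun j => ψ j ∈ Set.range φ
  refine le_trans ?_ (hB S)
  have hsub : Finset.univ.map (edgeImage B φ) ∩ Finset.univ.map (edgeImage B ψ) ⊆
      (Finset.univ.filter fun e : B.edgeSet => ∀ v ∈ (e : Sym2 β), v ∈ S).map (edgeImage B ψ) := by
    intro f hf
    rw [Finset.mem_inter, Finset.mem_map, Finset.mem_map] at hf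
    obtain ⟨⟨e, -, he⟩, ⟨e', -, rfl⟩⟩ := hf
    refine Finset.mem_map_of_mem _ (Finset.mem_filter.2 ⟨Finset.mem_univ _, fun v hv => ?_⟩)
    have h1 : ψ v ∈ Sym2.map ψ (e' : Sym2 β) := Sym2.mem_map.2 ⟨v, hv, rfl⟩
    have h2 : Sym2.map φ (e : Sym2 β) = Sym2.map ψ (e' : Sym2 β) := congrArg Subtype.val he
    rw [← h2, Sym2.mem_map] at h1
    obtain ⟨u, -, hu⟩ := h1
    exact Finset.mem_filter.2 ⟨Finset.mem_univ _, ⟨u, hu⟩⟩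
  refine (Finset.card_le_card hsub).trans ?_
  rw [Finset.card_map, ← Set.ncard_coe_finset, ← Set.ncard_image_of_injective _
    (Subtype.val_injective)]
  refine Set.ncard_le_ncard ?_ (Set.toFinite _)
  rintro _ ⟨e, he, rfl⟩
  exact ⟨e.2, (Finset.mem_filter.1 he).2⟩

/-- Extended from injections to all maps, the sum factorises over the vertices, with weight `n` on
the range of `φ` and `1` elsewhere; one factor is at most `|β| * n + n`. -/
lemma sum_pow_card_le (φ : β ↪ Fin n) :
    ∑ ψ : β ↪ Fin n, (n : ℝ) ^ (Finset.univ.filter fun j => ψ j ∈ Set.range φ).card ≤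
      (((Fintype.card β : ℝ) + 1) * n) ^ Fintype.card β := by
  classical
  let w : Fin n → ℝ := fun x => if x ∈ Set.range φ then (n : ℝ) else 1
  have h1 : ∀ ψ : β → Fin n, (n : ℝ) ^ (Finset.univ.filter fun j => ψ j ∈ Set.range φ).card =
      ∏ j, w (ψ j) := by
    intro ψ
    simp only [w]
    rw [Finset.prod_ite, Finset.prod_const, Finset.prod_const_one, mul_one]
  have hw : ∀ x, 0 ≤ w x := fun x => by simp only [w]; split_ifs <;> positivity
  calc _ = ∑ ψ : β ↪ Fin n, ∏ j, w (ψ j) := Finset.sum_congr rfl fun ψ _ => h1 ψ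
    _ = ∑ ψ ∈ Finset.univ.map ⟨fun ψ : β ↪ Fin n => (ψ : β → Fin n), DFunLike.coe_injective⟩,
          ∏ j, w (ψ j) := by rw [Finset.sum_map]; rfl
    _ ≤ ∑ ψ : β → Fin n, ∏ j, w (ψ j) :=
        Finset.sum_le_univ_sum_of_nonneg fun ψ => Finset.prod_nonneg fun j _ => hw _
    _ = (∑ x, w x) ^ Fintype.card β := by
        have := Finset.prod_univ_sum (ι := β) (fun _ => (Finset.univ : Finset (Fin n)))
          (fun _ x => w x)
        rw [Fintype.piFinset_univ] at this
        rw [← this, Finset.prod_const, Finset.card_univ]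
    _ ≤ _ := by
        refine pow_le_pow_left₀ (Finset.sum_nonneg fun x _ => hw x) ?_ _
        · calc ∑ x, w x ≤ ∑ x, ((if x ∈ Set.range φ then (n : ℝ) else 0) + 1) := by
                refine Finset.sum_le_sum fun x _ => ?_
                simp only [w]
                split_ifs <;> simp
            _ = (Fintype.card β : ℝ) * n + n := by
                rw [Finset.sum_add_distrib, ← Finset.sum_filter, Finset.sum_const,
                  Finset.sum_const, Finset.card_univ, Fintype.card_fin]
                have : (Finset.univ.filter fun x => x ∈ Set.range φ) = Finset.univ.map φ := by
                  ext; simp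
                rw [this, Finset.card_map, Finset.card_univ]
                simp
            _ = _ := by ring

/-- The second moment bound for the appearance of a sparse graph in the random graph process. -/
lemma freq_not_contains_le {B : SimpleGraph β} [Fintype B.edgeSet] (hB : B.IsSparse) {m : ℕ}
    (hm : 2 * Fintype.card B.edgeSet < m) (hmN : m ≤ n.choose 2) (hnm : n.choose 2 ≤ n * m)
    (hn : Fintype.card β < n) :
    freq (fun π : EdgeOrdering n => ¬ ∃ φ : β → Fin n, Function.Injective φ ∧
        ∀ a b, B.Adj a b → (processGraph π m).Adj (φ a) (φ b)) ≤
      ((m : ℝ) / (m - Fintype.card B.edgeSet)) ^ (2 * Fintype.card B.edgeSet) *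
        (1 + (n.choose 2 : ℝ) / (n * m) * ((Fintype.card β : ℝ) + 1) ^ Fintype.card β *
          ((n : ℝ) / (n - Fintype.card β)) ^ Fintype.card β) - 1 := by
  classical
  set η := Fintype.card B.edgeSet with hη
  set b := Fintype.card β with hb
  set N := n.choose 2 with hN
  set a : ℝ := (m : ℝ) / N with ha
  let T : (β ↪ Fin n) → Finset (⊤ : SimpleGraph (Fin n)).edgeSet := fun φ =>
    Finset.univ.map (edgeImage B φ)
  have hT : ∀ φ, (T φ).card = η := fun φ => by simp [T, hη]
  let X : EdgeOrdering n → ℝ := fun π => ∑ φ : β ↪ Fin n, if T φ ⊆ firstSet π m then 1 else 0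
  have hm0 : (0 : ℝ) < m := by exact_mod_cast (by omega : 0 < m)
  have hN0 : (0 : ℝ) < N := by exact_mod_cast (by omega : 0 < N)
  have hn0 : (0 : ℝ) < n := by exact_mod_cast (by omega : 0 < n)
  have ha0 : 0 < a := by positivity
  have hηm : (0 : ℝ) < m - η := by
    have : ((2 * η : ℕ) : ℝ) < m := by exact_mod_cast hm
    push_cast at this
    have h0 : (0 : ℝ) ≤ η := by positivity
    linarith
  have hbn : (0 : ℝ) < n - b := by
    have : (b : ℝ) < n := by exact_mod_cast hn
    linarith
  set q : Finset (⊤ : SimpleGraph (Fin n)).edgeSet → ℝ := fun S =>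
    freq (fun π : EdgeOrdering n => S ⊆ firstSet π m) with hq
  have hqS : ∀ S : Finset (⊤ : SimpleGraph (Fin n)).edgeSet, S.card ≤ m → q S =
      ((N - S.card).choose (m - S.card) : ℝ) / N.choose m := by
    intro S hS
    have := freq_subset_disjoint (card_edgeSet_top n) hmN (Finset.disjoint_empty_right S) hS
    simpa using this
  have hqle : ∀ S : Finset (⊤ : SimpleGraph (Fin n)).edgeSet, S.card ≤ m → q S ≤ a ^ S.card := by
    intro S hS
    rw [hqS S hS]
    have := choose_sub_sub_div_choose_le (u := 0) hS hmN
    simpa using this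
  have havg : ∀ S : Finset (⊤ : SimpleGraph (Fin n)).edgeSet,
      (∑ π : EdgeOrdering n, if S ⊆ firstSet π m then (1 : ℝ) else 0) /
        Fintype.card (EdgeOrdering n) = q S := fun S => by
    rw [hq]
    simp only
    rw [freq_eq_sum]
  set g : ℝ := ((N - η).choose (m - η) : ℝ) / N.choose m with hg
  have hgq : ∀ φ, q (T φ) = g := fun φ => by rw [hqS _ (by rw [hT]; omega), hT]
  have hglow : ((m - η) / N : ℝ) ^ η ≤ g := pow_le_choose_sub_div_choose (by omega) hmN
  have hg0 : 0 < g := lt_of_lt_of_le (by positivity) hglow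
  set I : ℝ := (Fintype.card (β ↪ Fin n) : ℝ) with hI
  have hIlow : ((n : ℝ) - b) ^ b ≤ I := by
    rw [hI, Fintype.card_embedding_eq, Fintype.card_fin, ← Nat.cast_sub hn.le]
    exact_mod_cast (Nat.pow_le_pow_left (by omega) b).trans (Nat.pow_sub_le_descFactorial n b)
  have hI0 : 0 < I := lt_of_lt_of_le (by positivity) hIlow
  have h1 : (∑ π, X π) / Fintype.card (EdgeOrdering n) = I * g := by
    simp only [X]
    rw [Finset.sum_comm, Finset.sum_div, Finset.sum_congr rfl fun φ _ => (havg (T φ)).trans (hgq φ)]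
    simp [hI]
  have hna : 1 ≤ (n : ℝ) * a := by
    rw [ha, ← mul_div_assoc, one_le_div hN0]
    exact_mod_cast hnm
  -- With `r` common edges and `s` common vertices the correlation factor is `a⁻ʳ`. For `r ≥ 1` it
  -- equals `nʳ / (n * a)ʳ`, which is at most `nˢ / (n * a)` since `n * a ≥ 1` and `r ≤ s`.
  have hpair : ∀ φ ψ, q (T φ ∪ T ψ) ≤ a ^ (2 * η) * (1 + (n * a)⁻¹ *
      (n : ℝ) ^ (Finset.univ.filter fun j => ψ j ∈ Set.range φ).card) := by
    intro φ ψ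
    have hr := card_inter_edgeImage_le hB φ ψ
    have hcard := Finset.card_union_add_card_inter (T φ) (T ψ)
    rw [hT, hT] at hcard
    change (T φ ∩ T ψ).card ≤ _ at hr
    set r := (T φ ∩ T ψ).card
    set s := (Finset.univ.filter fun j => ψ j ∈ Set.range φ).card
    refine (hqle _ (by omega)).trans ?_
    have h2 : a ^ (2 * η) = a ^ (T φ ∪ T ψ).card * a ^ r := by
      rw [← pow_add]
      congr 1
      omega
    rw [h2, mul_assoc]
    refine le_mul_of_one_le_right (by positivity) ?_
    rcases Nat.eq_zero_or_pos r with h0 | h0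
    · rw [h0, pow_zero, one_mul]
      have : 0 ≤ (n * a)⁻¹ * (n : ℝ) ^ s := by positivity
      linarith
    · calc (1 : ℝ) ≤ (n * a) ^ (r - 1) := one_le_pow₀ hna
        _ = a ^ r * ((n * a)⁻¹ * (n : ℝ) ^ r) := by
            have : r = r - 1 + 1 := by omega
            rw [this, pow_succ a, pow_succ (n : ℝ), Nat.add_sub_cancel, mul_pow]
            field_simp
        _ ≤ a ^ r * ((n * a)⁻¹ * (n : ℝ) ^ s) := by
            gcongr
            exact_mod_cast (by omega : 1 ≤ n)
        _ ≤ _ := by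
            gcongr
            linarith
  have hX2 : (∑ π, X π ^ 2) / Fintype.card (EdgeOrdering n) = ∑ φ, ∑ ψ, q (T φ ∪ T ψ) := by
    have : ∀ π, X π ^ 2 = ∑ φ, ∑ ψ, if T φ ∪ T ψ ⊆ firstSet π m then (1 : ℝ) else 0 := by
      intro π
      simp only [X]
      rw [sq, Finset.sum_mul_sum]
      refine Finset.sum_congr rfl fun φ _ => Finset.sum_congr rfl fun ψ _ => ?_
      simp only [Finset.union_subset_iff, ite_and]
      split_ifs <;> simp
    simp only [this]
    rw [Finset.sum_comm, Finset.sum_div]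
    refine Finset.sum_congr rfl fun φ _ => ?_
    rw [Finset.sum_comm, Finset.sum_div]
    exact Finset.sum_congr rfl fun ψ _ => havg _
  have h2 : (∑ π, X π ^ 2) / Fintype.card (EdgeOrdering n) ≤
      a ^ (2 * η) * (I ^ 2 + (n * a)⁻¹ * (I * ((b + 1) * n) ^ b)) := by
    rw [hX2]
    calc _ ≤ ∑ φ : β ↪ Fin n, a ^ (2 * η) * (I + (n * a)⁻¹ * ((b + 1) * n) ^ b) := by
          refine Finset.sum_le_sum fun φ _ => ?_
          calc _ ≤ _ := Finset.sum_le_sum fun ψ _ => hpair φ ψ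
            _ = a ^ (2 * η) * (I + (n * a)⁻¹ *
                ∑ ψ : β ↪ Fin n, (n : ℝ) ^ (Finset.univ.filter fun j => ψ j ∈ Set.range φ).card) := by
                rw [← Finset.mul_sum, Finset.sum_add_distrib, ← Finset.mul_sum]
                simp [hI]
            _ ≤ _ := by
                gcongr
                exact sum_pow_card_le φ
      _ = _ := by
          rw [Finset.sum_const, Finset.card_univ, nsmul_eq_mul, ← hI]
          ring
  set R := ((m : ℝ) / (m - η)) ^ (2 * η) * (1 + (N : ℝ) / (n * m) * ((b : ℝ) + 1) ^ b *
          ((n : ℝ) / (n - b)) ^ b) with hR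
  -- The bounds `g ≥ ((m - η) / N) ^ η` and `I ≥ (n - b) ^ b` turn the pair sum into a multiple of
  -- the squared mean `(I * g) ^ 2`.
  have h3 : a ^ (2 * η) * (I ^ 2 + (n * a)⁻¹ * (I * ((b + 1) * n) ^ b)) ≤ (1 + (R - 1)) * (I * g) ^ 2 := by
    have e1 : a ^ (2 * η) ≤ ((m : ℝ) / (m - η)) ^ (2 * η) * g ^ 2 := by
      have : a ^ (2 * η) = ((m : ℝ) / (m - η)) ^ (2 * η) * (((m - η) / N : ℝ) ^ η) ^ 2 := by
        rw [← pow_mul, mul_comm η 2, ← mul_pow, ha]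
        congr 1
        field_simp
      rw [this]
      gcongr
    have e2 : I ^ 2 + (n * a)⁻¹ * (I * ((b + 1) * n) ^ b) ≤
        (1 + (N : ℝ) / (n * m) * ((b : ℝ) + 1) ^ b * ((n : ℝ) / (n - b)) ^ b) * I ^ 2 := by
      have e3 : (n : ℝ) ^ b ≤ ((n : ℝ) / (n - b)) ^ b * I := by
        calc (n : ℝ) ^ b = ((n : ℝ) / (n - b)) ^ b * ((n : ℝ) - b) ^ b := by
              rw [← mul_pow]; congr 1; field_simp
          _ ≤ _ := by gcongr
      have e4 : (n * a)⁻¹ = (N : ℝ) / (n * m) := by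
        rw [ha]; field_simp
      rw [e4, mul_pow]
      calc I ^ 2 + (N : ℝ) / (n * m) * (I * ((b + 1) ^ b * n ^ b))
          = I ^ 2 + (N : ℝ) / (n * m) * (b + 1) ^ b * I * n ^ b := by ring
        _ ≤ I ^ 2 + (N : ℝ) / (n * m) * (b + 1) ^ b * I * (((n : ℝ) / (n - b)) ^ b * I) := by
            gcongr
        _ = _ := by ring
    calc _ ≤ (((m : ℝ) / (m - η)) ^ (2 * η) * g ^ 2) *
          ((1 + (N : ℝ) / (n * m) * ((b : ℝ) + 1) ^ b * ((n : ℝ) / (n - b)) ^ b) * I ^ 2) := by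
          gcongr
      _ = _ := by rw [hR]; ring
  refine le_trans (freq_mono fun π hπ => ?_) (freq_eq_zero_le X (by positivity) h1 (h2.trans h3))
  refine Finset.sum_eq_zero fun φ _ => if_neg fun hsub => hπ ⟨φ, φ.injective, ?_⟩
  exact edgeImage_subset_firstSet hsub

end Subgraph

/-! ### Stars, inner edges and edge cuts -/

section Star

variable {n : ℕ}

/-- The edges of the complete graph which contain a given vertex. -/
def starEdges (v : Fin n) : Finset (⊤ : SimpleGraph (Fin n)).edgeSet :=
  Finset.univ.filter fun e => v ∈ (e : Sym2 (Fin n))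

/-- The edges of the complete graph with both ends in a given set. -/
def innerEdges (S : Finset (Fin n)) : Finset (⊤ : SimpleGraph (Fin n)).edgeSet :=
  Finset.univ.filter fun e => ∀ v ∈ (e : Sym2 (Fin n)), v ∈ S

/-- The edges of the complete graph with exactly one end in a given set. -/
def cutEdges (S : Finset (Fin n)) : Finset (⊤ : SimpleGraph (Fin n)).edgeSet :=
  Finset.univ.filter fun e => (∃ v ∈ (e : Sym2 (Fin n)), v ∈ S) ∧ ∃ v ∈ (e : Sym2 (Fin n)), v ∉ S

lemma mem_starEdges {v : Fin n} {e : (⊤ : SimpleGraph (Fin n)).edgeSet} :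
    e ∈ starEdges v ↔ v ∈ (e : Sym2 (Fin n)) := by simp [starEdges]

lemma exists_topEdge (e : (⊤ : SimpleGraph (Fin n)).edgeSet) :
    ∃ (u v : Fin n) (h : u ≠ v), e = topEdge h := by
  obtain ⟨e, he⟩ := e
  induction e using Sym2.ind with
  | _ u v => exact ⟨u, v, he, rfl⟩

lemma exists_topEdge_of_mem {v : Fin n} {e : (⊤ : SimpleGraph (Fin n)).edgeSet}
    (he : v ∈ (e : Sym2 (Fin n))) : ∃ (u : Fin n) (h : v ≠ u), e = topEdge h := by
  obtain ⟨a, b, h, rfl⟩ := exists_topEdge e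
  rcases Sym2.mem_iff.1 he with rfl | rfl
  · exact ⟨b, h, rfl⟩
  · exact ⟨a, h.symm, Subtype.ext Sym2.eq_swap⟩

lemma card_starEdges (v : Fin n) : (starEdges v).card = n - 1 := by
  have h1 : (Finset.univ.erase v).card = n - 1 := by
    rw [Finset.card_erase_of_mem (Finset.mem_univ v), Finset.card_univ, Fintype.card_fin]
  rw [← h1]
  symm
  refine Finset.card_bij (fun u hu => topEdge (Finset.ne_of_mem_erase hu).symm) ?_ ?_ ?_
  · intro u hu
    rw [mem_starEdges]
    simp [topEdge]
  · intro u hu u' hu' h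
    exact Sym2.congr_right.1 (congrArg Subtype.val h)
  · intro e he
    obtain ⟨u, h, rfl⟩ := exists_topEdge_of_mem (mem_starEdges.1 he)
    exact ⟨u, by simp [h.symm], rfl⟩

lemma card_starEdges_union {u v : Fin n} (h : u ≠ v) :
    (starEdges u ∪ starEdges v).card = 2 * (n - 1) - 1 := by
  have h1 : starEdges u ∩ starEdges v = {topEdge h} := by
    ext e
    rw [Finset.mem_inter, mem_starEdges, mem_starEdges, Finset.mem_singleton, Sym2.mem_and_mem_iff h,
      Subtype.ext_iff]
    rfl
  have h2 := Finset.card_union_add_card_inter (starEdges u) (starEdges v)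
  rw [h1, Finset.card_singleton, card_starEdges, card_starEdges] at h2
  omega

lemma card_innerEdges_le (S : Finset (Fin n)) : (innerEdges S).card ≤ S.card.choose 2 := by
  classical
  rw [← Sym2.card_image_offDiag, ← Finset.card_map (Function.Embedding.subtype _)]
  refine Finset.card_le_card fun e he => ?_
  obtain ⟨e', he', rfl⟩ := Finset.mem_map.1 he
  obtain ⟨a, b, h, rfl⟩ := exists_topEdge e'
  have h2 := (Finset.mem_filter.1 he').2
  exact Finset.mem_image.2 ⟨(a, b), Finset.mem_offDiag.2 ⟨h2 a (Sym2.mem_mk_left a b),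
    h2 b (Sym2.mem_mk_right a b), h⟩, rfl⟩

lemma card_cutEdges (S : Finset (Fin n)) : S.card * (n - S.card) ≤ (cutEdges S).card := by
  classical
  have h1 : (S ×ˢ Sᶜ).card = S.card * (n - S.card) := by
    rw [Finset.card_product, Finset.card_compl, Fintype.card_fin]
  have hne : ∀ p ∈ S ×ˢ Sᶜ, p.1 ≠ p.2 := fun p hp h => by
    rw [Finset.mem_product, Finset.mem_compl, h] at hp
    exact hp.2 hp.1
  have hinj : Set.InjOn (fun p : Fin n × Fin n => s(p.1, p.2)) (S ×ˢ Sᶜ : Finset _) := by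
    rintro ⟨a, b⟩ hp ⟨a', b'⟩ hp' h
    rw [Finset.mem_coe, Finset.mem_product, Finset.mem_compl] at hp hp'
    rcases Sym2.eq_iff.1 h with ⟨rfl, rfl⟩ | ⟨rfl, rfl⟩
    · rfl
    · exact absurd hp'.1 hp.2
  rw [← h1, ← Finset.card_image_of_injOn hinj,
    ← Finset.card_map (Function.Embedding.subtype _) (s := cutEdges S)]
  refine Finset.card_le_card fun e he => ?_
  obtain ⟨⟨a, b⟩, hp, rfl⟩ := Finset.mem_image.1 he
  rw [Finset.mem_map]
  have hab := hne _ hp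
  rw [Finset.mem_product, Finset.mem_compl] at hp
  exact ⟨topEdge hab, Finset.mem_filter.2 ⟨Finset.mem_univ _, ⟨a, Sym2.mem_mk_left a b, hp.1⟩,
    ⟨b, Sym2.mem_mk_right a b, hp.2⟩⟩, rfl⟩

lemma disjoint_cutEdges_innerEdges (S : Finset (Fin n)) :
    Disjoint (innerEdges S) (cutEdges S) := by
  rw [Finset.disjoint_left]
  intro e he he'
  obtain ⟨-, v, hv, hvS⟩ := (Finset.mem_filter.1 he').2
  exact hvS ((Finset.mem_filter.1 he).2 v hv)

lemma isolated_iff {π : EdgeOrdering n} {m : ℕ} {v : Fin n} :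
    (∀ u, ¬ (processGraph π m).Adj v u) ↔ Disjoint (starEdges v) (firstSet π m) := by
  rw [Finset.disjoint_left]
  constructor
  · intro h e he hm
    obtain ⟨u, hvu, rfl⟩ := exists_topEdge_of_mem (mem_starEdges.1 he)
    exact h u (processGraph_adj.2 ⟨hvu, hm⟩)
  · intro h u hu
    obtain ⟨hvu, hm⟩ := processGraph_adj.1 hu
    exact h (mem_starEdges.2 (Sym2.mem_mk_left v u)) hm

end Star

/-! ### Connectivity from the absence of isolated vertices -/

section Deterministic

variable {n : ℕ}

/-- There is a set of at least two and at most half of the vertices which is disconnected from the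
rest, but contains at least as many edges as a spanning tree. -/
def HasSmallComponent (π : EdgeOrdering n) (m : ℕ) : Prop :=
  ∃ S : Finset (Fin n), (2 ≤ S.card ∧ 2 * S.card ≤ n) ∧
    ∃ T ∈ Finset.powersetCard (S.card - 1) (innerEdges S),
      T ⊆ firstSet π m ∧ Disjoint (cutEdges S) (firstSet π m)

/-- There are two vertices which are isolated at time `m`, and the next edge at any of these joins
them. -/
def HasIsolatedEdge (π : EdgeOrdering n) (m : ℕ) : Prop :=
  ∃ p : Fin n × Fin n, ∃ h : p.1 ≠ p.2,
    Disjoint (starEdges p.1 ∪ starEdges p.2) (firstSet π m) ∧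
      ∀ d ∈ starEdges p.1 ∪ starEdges p.2, π.symm (topEdge h) ≤ π.symm d

/-- An edge at `v` would make the component of `v` a forbidden small component: it cannot leave `S`,
so it has at most half of the vertices, and it has at least two. -/
lemma not_adj_of_not_hasSmallComponent {π : EdgeOrdering n} {m : ℕ} (h : ¬ HasSmallComponent π m)
    {S : Finset (Fin n)} (hS : 2 * S.card ≤ n)
    (hcut : ∀ u v, u ∈ S → v ∉ S → ¬ (processGraph π m).Adj u v) {v : Fin n} (hv : v ∈ S)
    (u : Fin n) : ¬ (processGraph π m).Adj v u := by
  classical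
  intro hvu
  set G := processGraph π m with hG
  let C := G.connectedComponentMk v
  let K : Finset (Fin n) := Finset.univ.filter fun a => a ∈ C.supp
  have hK : ∀ a, a ∈ K ↔ G.Reachable v a := fun a => by
    simp only [K, C, Finset.mem_filter, Finset.mem_univ, true_and,
      SimpleGraph.ConnectedComponent.mem_supp_iff, SimpleGraph.ConnectedComponent.eq]
    exact ⟨fun h => h.symm, fun h => h.symm⟩
  have hKS : K ⊆ S := fun a ha => by
    have := (SimpleGraph.reachable_iff_reflTransGen v a).1 ((hK a).1 ha)
    induction this with
    | refl => exact hv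
    | tail h1 h2 ih =>
      by_contra hb
      exact hcut _ _ (ih ((hK _).2 ((SimpleGraph.reachable_iff_reflTransGen _ _).2 h1))) hb h2
  have hK2 : 2 ≤ K.card := by
    have : ({v, u} : Finset (Fin n)) ⊆ K := by
      intro a ha
      rw [Finset.mem_insert, Finset.mem_singleton] at ha
      rcases ha with rfl | rfl
      · exact (hK _).2 (SimpleGraph.Reachable.refl _)
      · exact (hK _).2 hvu.reachable
    rw [← Finset.card_pair hvu.ne]
    exact Finset.card_le_card this
  -- A connected graph has at least as many edges as a spanning tree; a set `T` of exactly that many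
  -- is selected below.
  have hedges : K.card - 1 ≤ (innerEdges K ∩ firstSet π m).card := by
    have h1 := C.connected_toSimpleGraph.card_vert_le_card_edgeSet_add_one
    have h2 : Nat.card C = K.card := by
      rw [← Set.ncard_coe_finset]
      simp only [K, Finset.coe_filter, Finset.mem_univ, true_and]
      rfl
    let g : C.toSimpleGraph.edgeSet → (⊤ : SimpleGraph (Fin n)).edgeSet := fun e =>
      ⟨Sym2.map Subtype.val e.1, by
        obtain ⟨e, he⟩ := e
        induction e using Sym2.ind with
        | _ a b => exact fun h => (C.toSimpleGraph.mem_edgeSet.1 he).ne (Subtype.ext h)⟩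
    have hg : Function.Injective g := fun e e' h =>
      Subtype.ext (Sym2.map.injective Subtype.val_injective (congrArg Subtype.val h))
    have hmem : ∀ e, g e ∈ innerEdges K ∩ firstSet π m := by
      rintro ⟨e, he⟩
      induction e using Sym2.ind with
      | _ a b =>
      have hab : G.Adj a b := he
      obtain ⟨hne, hm⟩ := processGraph_adj.1 hab
      refine Finset.mem_inter.2 ⟨Finset.mem_filter.2 ⟨Finset.mem_univ _, fun x hx => ?_⟩, hm⟩
      refine Finset.mem_filter.2 ⟨Finset.mem_univ _, ?_⟩
      rcases Sym2.mem_iff.1 hx with rfl | rfl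
      exacts [a.2, b.2]
    have h3 : Nat.card C.toSimpleGraph.edgeSet ≤ (innerEdges K ∩ firstSet π m).card := by
      rw [Nat.card_eq_fintype_card, ← Finset.card_univ,
        ← Finset.card_image_of_injective _ hg]
      refine Finset.card_le_card fun e he => ?_
      obtain ⟨e', -, rfl⟩ := Finset.mem_image.1 he
      exact hmem e'
    omega
  obtain ⟨T, hT, hTcard⟩ := Finset.exists_subset_card_eq hedges
  have hle := Finset.card_le_card hKS
  refine h ⟨K, ⟨hK2, by omega⟩, T, Finset.mem_powersetCard.2
    ⟨hT.trans Finset.inter_subset_left, hTcard⟩, hT.trans Finset.inter_subset_right, ?_⟩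
  rw [Finset.disjoint_left]
  intro e he hm
  obtain ⟨⟨a, ha, haK⟩, b, hb, hbK⟩ := (Finset.mem_filter.1 he).2
  obtain ⟨b', hne, rfl⟩ := exists_topEdge_of_mem ha
  have hadj : G.Adj a b' := processGraph_adj.2 ⟨hne, hm⟩
  rcases Sym2.mem_iff.1 hb with rfl | rfl
  · exact hbK haK
  · exact hbK ((hK _).2 (((hK _).1 haK).trans hadj.reachable))

/-- A later graph of the process without isolated vertices is connected, unless there was a small
component or two isolated vertices are joined to each other first. -/
theorem processGraph_connected [NeZero n] {π : EdgeOrdering n} {m t : ℕ} (hmt : m ≤ t)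
    (h₁ : ¬ HasSmallComponent π m) (h₂ : ¬ HasIsolatedEdge π m)
    (hiso : ∀ v, ∃ u, (processGraph π t).Adj v u) : (processGraph π t).Connected := by
  classical
  set G := processGraph π t with hG
  refine ⟨?_⟩
  by_contra hpre
  simp only [SimpleGraph.Preconnected, not_forall] at hpre
  obtain ⟨a₁, a₂, ha⟩ := hpre
  -- Two disjoint components cannot both contain more than half of the vertices.
  obtain ⟨a, ha⟩ : ∃ a, 2 * (Finset.univ.filter fun v => G.Reachable a v).card ≤ n := by
    have hdisj : Disjoint (Finset.univ.filter fun v => G.Reachable a₁ v)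
        (Finset.univ.filter fun v => G.Reachable a₂ v) := by
      rw [Finset.disjoint_left]
      intro v hv hv'
      simp only [Finset.mem_filter, Finset.mem_univ, true_and] at hv hv'
      exact ha (hv.trans hv'.symm)
    have hle := Finset.card_le_univ ((Finset.univ.filter fun v => G.Reachable a₁ v) ∪
      (Finset.univ.filter fun v => G.Reachable a₂ v))
    rw [Finset.card_union_of_disjoint hdisj, Fintype.card_fin] at hle
    by_contra hno
    push Not at hno
    have h1 := hno a₁
    have h2 := hno a₂
    omega
  set S := Finset.univ.filter fun v => G.Reachable a v with hS
  have hSmem : ∀ v, v ∈ S ↔ G.Reachable a v := fun v => by simp [hS]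
  have hclosed : ∀ {u v}, u ∈ S → G.Adj u v → v ∈ S := fun {u v} hu huv =>
    (hSmem _).2 (((hSmem _).1 hu).trans huv.reachable)
  -- No edge leaves `S` at time `t`, hence none at time `m`; without small components all vertices
  -- of `S` are isolated at time `m`.
  have hisoS : ∀ v ∈ S, Disjoint (starEdges v) (firstSet π m) := fun v hv =>
    isolated_iff.1 (not_adj_of_not_hasSmallComponent h₁ ha
      (fun u v hu hv huv => hv (hclosed hu (processGraph_mono π hmt huv))) hv)
  let F := (firstSet π t).filter fun e => ∃ v ∈ S, e ∈ starEdges v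
  have hF : F.Nonempty := by
    obtain ⟨u, hu⟩ := hiso a
    obtain ⟨hne, hm⟩ := processGraph_adj.1 hu
    exact ⟨topEdge hne, Finset.mem_filter.2 ⟨hm, a, (hSmem a).2 (SimpleGraph.Reachable.refl a),
      mem_starEdges.2 (Sym2.mem_mk_left _ _)⟩⟩
  -- The earliest edge that meets `S` stays inside `S`, so it joins two vertices that were isolated
  -- at time `m`.
  obtain ⟨e, he, hmin⟩ := F.exists_min_image (fun e => π.symm e) hF
  obtain ⟨het, u, hu, heu⟩ := Finset.mem_filter.1 he
  obtain ⟨v, huv, rfl⟩ := exists_topEdge_of_mem (mem_starEdges.1 heu)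
  have hv : v ∈ S := hclosed hu (processGraph_adj.2 ⟨huv, het⟩)
  refine h₂ ⟨(u, v), huv, Finset.disjoint_union_left.2 ⟨hisoS u hu, hisoS v hv⟩, fun d hd => ?_⟩
  by_contra hlt
  push Not at hlt
  refine absurd (hmin d (Finset.mem_filter.2 ⟨?_, ?_⟩)) (not_le.2 hlt)
  · rw [mem_firstSet] at het ⊢
    exact lt_trans hlt het
  · rcases Finset.mem_union.1 hd with hd | hd
    exacts [⟨u, hu, hd⟩, ⟨v, hv, hd⟩]

end Deterministic

/-! ### First and second moment bounds for the process -/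

section Bounds

/-- If `P` does not change under permutations of `D`, each element of `D` is equally likely to come
first given `P`; swapping `d₀` with another element matches these disjoint events. -/
lemma freq_first_le {X : Type*} [Fintype X] [DecidableEq X] {N : ℕ}
    (P : (Fin N ≃ X) → Prop) (D : Finset X)
    (hP : ∀ π (σ : Equiv.Perm X), (∀ x, x ∉ D → σ x = x) → (P π ↔ P (π.trans σ)))
    {d₀ : X} (hd₀ : d₀ ∈ D) :
    freq (fun π : Fin N ≃ X => P π ∧ ∀ d ∈ D, π.symm d₀ ≤ π.symm d) ≤ freq P / D.card := by
  classical
  have hD : (0 : ℝ) < D.card := by exact_mod_cast Finset.card_pos.2 ⟨d₀, hd₀⟩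
  let E : X → Finset (Fin N ≃ X) := fun d' =>
    Finset.univ.filter fun π => P π ∧ ∀ d ∈ D, π.symm d' ≤ π.symm d
  have hE : ∀ d' ∈ D, (E d').card = (E d₀).card := by
    intro d' hd'
    have hσ : ∀ x, x ∉ D → Equiv.swap d₀ d' x = x := fun x hx =>
      Equiv.swap_apply_of_ne_of_ne (fun h => hx (h ▸ hd₀)) (fun h => hx (h ▸ hd'))
    have hσD : ∀ x, x ∈ D → Equiv.swap d₀ d' x ∈ D := fun x hx => by
      rw [Equiv.swap_apply_def]
      split_ifs <;> assumption
    refine Finset.card_bij' (fun π _ => π.trans (Equiv.swap d₀ d'))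
      (fun π _ => π.trans (Equiv.swap d₀ d')) ?_ ?_ ?_ ?_
    · intro π hπ
      obtain ⟨h1, h2⟩ := (Finset.mem_filter.1 hπ).2
      refine Finset.mem_filter.2 ⟨Finset.mem_univ _, (hP π _ hσ).1 h1, fun d hd => ?_⟩
      simp only [Equiv.symm_trans_apply, Equiv.symm_swap, Equiv.swap_apply_left]
      exact h2 _ (hσD d hd)
    · intro π hπ
      obtain ⟨h1, h2⟩ := (Finset.mem_filter.1 hπ).2
      refine Finset.mem_filter.2 ⟨Finset.mem_univ _, (hP π _ hσ).1 h1, fun d hd => ?_⟩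
      simp only [Equiv.symm_trans_apply, Equiv.symm_swap, Equiv.swap_apply_right]
      exact h2 _ (hσD d hd)
    · intro π _
      ext; simp
    · intro π _
      ext; simp
  have hdisj : (D : Set X).PairwiseDisjoint E := by
    intro d hd d' hd' hne
    rw [Function.onFun, Finset.disjoint_left]
    intro π hπ hπ'
    have h1 := (Finset.mem_filter.1 hπ).2.2 d' hd'
    have h2 := (Finset.mem_filter.1 hπ').2.2 d hd
    exact hne (π.symm.injective (le_antisymm h1 h2))
  have hsum : D.card * (E d₀).card ≤ (Finset.univ.filter P).card := by
    rw [← smul_eq_mul, ← Finset.sum_const, ← Finset.sum_congr rfl hE, ← Finset.card_biUnion hdisj]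
    refine Finset.card_le_card fun π hπ => ?_
    obtain ⟨d, -, hπ⟩ := Finset.mem_biUnion.1 hπ
    exact Finset.mem_filter.2 ⟨Finset.mem_univ _, (Finset.mem_filter.1 hπ).2.1⟩
  have hconv : ∀ Q : (Fin N ≃ X) → Prop, freq Q = ((Finset.univ.filter Q).card : ℝ) /
      Nat.card (Fin N ≃ X) := fun Q => by
    rw [freq, Set.ncard_eq_toFinset_card', Set.toFinset_ofPred]
  rw [hconv, hconv, div_right_comm]
  refine div_le_div_of_nonneg_right ?_ (by positivity)
  rw [le_div_iff₀ hD, mul_comm]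
  have hsum' : (D.card : ℝ) * (E d₀).card ≤ (Finset.univ.filter P).card := by exact_mod_cast hsum
  refine le_trans (le_of_eq ?_) hsum'
  simp only [E]
  congr!

variable {n : ℕ}

lemma freq_disjoint_le {m : ℕ} (hm : m ≤ n.choose 2)
    (U : Finset (⊤ : SimpleGraph (Fin n)).edgeSet) :
    freq (fun π : EdgeOrdering n => Disjoint U (firstSet π m)) ≤
      Real.exp (-(U.card * m / (n.choose 2 : ℝ))) := by
  have h1 := freq_subset_disjoint (card_edgeSet_top n) hm (Finset.disjoint_empty_left U)
    (by simp)
  have h2 := choose_sub_sub_div_choose_le (u := U.card) (Nat.zero_le m) hm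
  simp only [Finset.empty_subset, true_and, Finset.card_empty] at h1
  rw [h1]
  simpa using h2

/-- The union bound over pairs gains a factor of about `1 / (2 n)` from symmetry among the edges of
the two stars. At density `c log n / n` the result is of order `n ^ (1 - 2c)`; without the gain it
would be `n ^ (2 - 2c)`, which is useless while isolated vertices exist. -/
lemma freq_hasIsolatedEdge_le {m : ℕ} (hm : m ≤ n.choose 2) :
    freq (fun π : EdgeOrdering n => HasIsolatedEdge π m) ≤
      (n : ℝ) ^ 2 * (Real.exp (-(((2 * (n - 1) - 1 : ℕ) : ℝ) * m / (n.choose 2 : ℝ))) /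
        (2 * (n - 1) - 1 : ℕ)) := by
  classical
  have h0 : freq (fun π : EdgeOrdering n => HasIsolatedEdge π m) ≤
      ∑ p ∈ (Finset.univ : Finset (Fin n × Fin n)), freq (fun π : EdgeOrdering n =>
        ∃ h : p.1 ≠ p.2, Disjoint (starEdges p.1 ∪ starEdges p.2) (firstSet π m) ∧
          ∀ d ∈ starEdges p.1 ∪ starEdges p.2, π.symm (topEdge h) ≤ π.symm d) := by
    refine le_trans (freq_mono ?_) (freq_exists_le _ _)
    rintro π ⟨p, hp⟩
    exact ⟨p, Finset.mem_univ _, hp⟩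
  refine h0.trans ?_
  have h1 : ∀ p ∈ (Finset.univ : Finset (Fin n × Fin n)), freq (fun π : EdgeOrdering n =>
        ∃ h : p.1 ≠ p.2, Disjoint (starEdges p.1 ∪ starEdges p.2) (firstSet π m) ∧
          ∀ d ∈ starEdges p.1 ∪ starEdges p.2, π.symm (topEdge h) ≤ π.symm d) ≤
      Real.exp (-(((2 * (n - 1) - 1 : ℕ) : ℝ) * m / (n.choose 2 : ℝ))) /
        (2 * (n - 1) - 1 : ℕ) := by
    rintro ⟨u, v⟩ -
    by_cases huv : u = v
    · have : freq (fun π : EdgeOrdering n => ∃ h : u ≠ v,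
          Disjoint (starEdges u ∪ starEdges v) (firstSet π m) ∧
          ∀ d ∈ starEdges u ∪ starEdges v, π.symm (topEdge h) ≤ π.symm d) = 0 := by
        simp [freq, huv]
      rw [this]
      positivity
    set D := starEdges u ∪ starEdges v with hD
    have hcard : D.card = 2 * (n - 1) - 1 := card_starEdges_union huv
    have hmem : topEdge huv ∈ D := Finset.mem_union_left _ (mem_starEdges.2 (Sym2.mem_mk_left u v))
    rw [← hcard]
    refine le_trans (freq_mono ?_) ((freq_first_le (fun π : EdgeOrdering n =>
      Disjoint D (firstSet π m)) D ?_ hmem).trans (div_le_div_of_nonneg_right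
        (freq_disjoint_le hm D) (by positivity)))
    · rintro π ⟨_, h⟩
      exact h
    · intro π σ hσ
      have hσD : ∀ x, σ x ∈ D ↔ x ∈ D := by
        intro x
        refine ⟨fun h => ?_, fun h => ?_⟩
        · by_contra hx
          exact hx (by rwa [hσ x hx] at h)
        · by_contra hx
          have := σ.injective (hσ _ hx)
          rw [this] at hx
          exact hx h
      rw [Finset.disjoint_left, Finset.disjoint_left]
      constructor
      · intro h x hx hxm
        rw [mem_firstSet, Equiv.symm_trans_apply] at hxm
        exact h ((hσD (σ.symm x)).1 (by rwa [Equiv.apply_symm_apply])) (mem_firstSet.2 hxm)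
      · intro h x hx hxm
        refine h ((hσD x).2 hx) ?_
        rw [mem_firstSet, Equiv.symm_trans_apply, Equiv.symm_apply_apply]
        exact mem_firstSet.1 hxm
  refine (Finset.sum_le_sum h1).trans ?_
  rw [Finset.sum_const, Finset.card_univ, nsmul_eq_mul, Fintype.card_prod, Fintype.card_fin, sq]
  push_cast
  exact le_rfl

/-- Union bound over the vertex set and over all sets of `k - 1` inner edges, not only trees. The
number `m - (k - 1)` of remaining edges is replaced by the smaller `m - n`. -/
lemma freq_hasSmallComponent_le {m : ℕ} (hm : m ≤ n.choose 2) (hnm : n ≤ m) :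
    freq (fun π : EdgeOrdering n => HasSmallComponent π m) ≤
      ∑ k ∈ Finset.Icc 2 (n / 2), (n.choose k : ℝ) * (((k.choose 2).choose (k - 1) : ℝ) *
        (((m : ℝ) / (n.choose 2 : ℝ)) ^ (k - 1) *
          Real.exp (-((k : ℝ) * (n - k) * (m - n) / (n.choose 2 : ℝ))))) := by
  classical
  set N := n.choose 2
  let I : Finset (Finset (Fin n)) := Finset.univ.filter fun S => 2 ≤ S.card ∧ 2 * S.card ≤ n
  have h0 : freq (fun π : EdgeOrdering n => HasSmallComponent π m) ≤
      ∑ S ∈ I, ∑ T ∈ Finset.powersetCard (S.card - 1) (innerEdges S),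
        freq (fun π : EdgeOrdering n => T ⊆ firstSet π m ∧ Disjoint (cutEdges S) (firstSet π m)) := by
    refine le_trans (freq_mono ?_) ((freq_exists_le I (fun S (π : EdgeOrdering n) =>
      ∃ T ∈ Finset.powersetCard (S.card - 1) (innerEdges S),
        T ⊆ firstSet π m ∧ Disjoint (cutEdges S) (firstSet π m))).trans
      (Finset.sum_le_sum fun S _ => freq_exists_le _ _))
    rintro π ⟨S, hS, h⟩
    exact ⟨S, Finset.mem_filter.2 ⟨Finset.mem_univ _, hS⟩, h⟩
  refine h0.trans ?_
  let f : ℕ → ℝ := fun k => ((k.choose 2).choose (k - 1) : ℝ) *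
        (((m : ℝ) / (N : ℝ)) ^ (k - 1) * Real.exp (-((k : ℝ) * (n - k) * (m - n) / (N : ℝ))))
  have h1 : ∀ S ∈ I, ∑ T ∈ Finset.powersetCard (S.card - 1) (innerEdges S),
        freq (fun π : EdgeOrdering n => T ⊆ firstSet π m ∧ Disjoint (cutEdges S) (firstSet π m)) ≤
        f S.card := by
    intro S hS
    have hS' := (Finset.mem_filter.1 hS).2
    have h2 : ∀ T ∈ Finset.powersetCard (S.card - 1) (innerEdges S),
        freq (fun π : EdgeOrdering n => T ⊆ firstSet π m ∧ Disjoint (cutEdges S) (firstSet π m)) ≤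
        ((m : ℝ) / (N : ℝ)) ^ (S.card - 1) *
          Real.exp (-((S.card : ℝ) * (n - S.card) * (m - n) / (N : ℝ))) := by
      intro T hT
      obtain ⟨hTS, hTc⟩ := Finset.mem_powersetCard.1 hT
      have hdisj := Finset.disjoint_of_subset_left hTS (disjoint_cutEdges_innerEdges S)
      rw [freq_subset_disjoint (card_edgeSet_top n) hm hdisj (by omega)]
      refine (choose_sub_sub_div_choose_le (by omega) hm).trans ?_
      rw [hTc]
      gcongr
      · have : (n : ℝ) ≤ m := by exact_mod_cast hnm
        linarith
      · have := card_cutEdges S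
        rw [← Nat.cast_sub (show S.card ≤ n by omega), ← Nat.cast_mul]
        exact_mod_cast this
      · omega
    refine (Finset.sum_le_sum h2).trans ?_
    rw [Finset.sum_const, nsmul_eq_mul, Finset.card_powersetCard]
    simp only [f]
    gcongr
    exact card_innerEdges_le S
  refine (Finset.sum_le_sum h1).trans ?_
  have hmaps : ∀ S ∈ I, S.card ∈ Finset.Icc 2 (n / 2) := by
    intro S hS
    have hS' := (Finset.mem_filter.1 hS).2
    rw [Finset.mem_Icc]
    omega
  rw [← Finset.sum_fiberwise_of_maps_to hmaps]
  refine Finset.sum_le_sum fun k hk => ?_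
  have h3 : ∑ S ∈ I.filter (fun S => S.card = k), f S.card =
      (I.filter fun S => S.card = k).card * f k := by
    rw [← nsmul_eq_mul, ← Finset.sum_const]
    exact Finset.sum_congr rfl fun S hS => by rw [(Finset.mem_filter.1 hS).2]
  rw [h3]
  have hf0 : 0 ≤ f k := by positivity
  refine mul_le_mul_of_nonneg_right ?_ hf0
  have h4 : (I.filter fun S => S.card = k) ⊆ Finset.powersetCard k Finset.univ := by
    intro S hS
    exact Finset.mem_powersetCard.2 ⟨Finset.subset_univ _, (Finset.mem_filter.1 hS).2⟩
  have h5 := Finset.card_le_card h4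
  rw [Finset.card_powersetCard, Finset.card_univ, Fintype.card_fin] at h5
  exact_mod_cast h5

lemma freq_exists_isolated_le {m : ℕ} (hm : m ≤ n.choose 2) :
    freq (fun π : EdgeOrdering n => ∃ v, ∀ u, ¬ (processGraph π m).Adj v u) ≤
      n * Real.exp (-(((n - 1 : ℕ) : ℝ) * m / (n.choose 2 : ℝ))) := by
  classical
  have h0 : freq (fun π : EdgeOrdering n => ∃ v, ∀ u, ¬ (processGraph π m).Adj v u) ≤
      ∑ v ∈ (Finset.univ : Finset (Fin n)), freq (fun π : EdgeOrdering n =>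
        Disjoint (starEdges v) (firstSet π m)) := by
    refine le_trans (freq_mono ?_) (freq_exists_le _ _)
    rintro π ⟨v, hv⟩
    exact ⟨v, Finset.mem_univ _, isolated_iff.1 hv⟩
  refine h0.trans ((Finset.sum_le_sum fun v _ => freq_disjoint_le hm _).trans ?_)
  simp [card_starEdges]

lemma one_sub_le_exp_of_le {x y : ℝ} (hx : 0 ≤ x) (hy : 0 < y) :
    Real.exp (-(x / y)) ≤ y / (y + x) := by
  rw [Real.exp_neg, ← one_div, div_le_div_iff₀ (Real.exp_pos _) (by linarith), one_mul]
  have := Real.add_one_le_exp (x / y)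
  calc y + x = y * (x / y + 1) := by field_simp; ring
    _ ≤ _ := by gcongr

/-- The ratio is a product of factors `(N - x - i) / (N - i)` with `i < m`, each at least `exp (-x /
(N - m - x))`. -/
lemma exp_le_choose_sub_div_choose {N m x : ℕ} (h : m + x < N) :
    Real.exp (-((m : ℝ) * x / (N - m - x))) ≤ ((N - x).choose m : ℝ) / N.choose m := by
  rw [choose_div_choose, Nat.descFactorial_eq_prod_range, Nat.descFactorial_eq_prod_range]
  push_cast
  rw [← Finset.prod_div_distrib]
  have hN : ((m : ℝ) + x) < N := by exact_mod_cast h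
  have h1 : Real.exp (-((m : ℝ) * x / (N - m - x))) =
      ∏ _i ∈ Finset.range m, Real.exp (-((x : ℝ) / (N - m - x))) := by
    rw [Finset.prod_const, Finset.card_range, ← Real.exp_nat_mul]
    congr 1
    ring
  rw [h1]
  refine Finset.prod_le_prod (fun _ _ => (Real.exp_pos _).le) fun i hi => ?_
  have hi' := Finset.mem_range.1 hi
  have him : (i : ℝ) < m := by exact_mod_cast hi'
  have hx0 : (0 : ℝ) ≤ x := by positivity
  have e1 : ((N - x - i : ℕ) : ℝ) = N - i - x := by
    rw [Nat.cast_sub (by omega), Nat.cast_sub (by omega)]; ring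
  have e2 : ((N - i : ℕ) : ℝ) = (N - i - x) + x := by
    rw [Nat.cast_sub (by omega)]; ring
  rw [e1, e2]
  refine le_trans ?_ (one_sub_le_exp_of_le hx0 (by linarith))
  rw [Real.exp_le_exp, neg_le_neg_iff]
  gcongr
  linarith

/-- Two stars share one edge, hence `2 * x - 1`. For `2 * x` avoided edges the bound by the square
would follow from `B * (B + 2 * x) ≤ (B + x) ^ 2`; restoring the shared edge costs the factor in
front. -/
lemma choose_sub_mul_le {N m x : ℕ} (hx : 1 ≤ x) (h : m + 2 * x ≤ N) :
    ((N - (2 * x - 1)).choose m : ℝ) / N.choose m ≤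
      ((N : ℝ) - 2 * x + 1) / (N - 2 * x + 1 - m) * (((N - x).choose m : ℝ) / N.choose m) ^ 2 := by
  set A := N - 2 * x with hA
  have hAN : (A : ℝ) = N - 2 * x := by rw [hA, Nat.cast_sub (by omega)]; push_cast; ring
  have hmA : (m : ℝ) ≤ A := by exact_mod_cast (by omega : m ≤ A)
  rw [choose_div_choose, choose_div_choose, show N - (2 * x - 1) = A + 1 by omega, ← hAN]
  have h1 : ((A : ℝ) + 1 - m) * (A + 1).descFactorial m = (A + 1) * A.descFactorial m := by
    have := Nat.succ_descFactorial A m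
    rw [← Nat.cast_succ, ← Nat.cast_sub (by omega)]
    exact_mod_cast this
  have h2 : A.descFactorial m * N.descFactorial m ≤ ((N - x).descFactorial m) ^ 2 := by
    rw [Nat.descFactorial_eq_prod_range, Nat.descFactorial_eq_prod_range,
      Nat.descFactorial_eq_prod_range, ← Finset.prod_mul_distrib, ← Finset.prod_pow]
    refine Finset.prod_le_prod' fun i hi => ?_
    have hi' := Finset.mem_range.1 hi
    obtain ⟨B, hB⟩ : ∃ B, N = B + i + 2 * x := ⟨N - i - 2 * x, by omega⟩
    rw [show A - i = B by omega, show N - i = B + 2 * x by omega, show N - x - i = B + x by omega]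
    nlinarith
  have hN0 : (0 : ℝ) < N.descFactorial m := by
    exact_mod_cast Nat.pos_of_ne_zero (by simp [Nat.descFactorial_eq_zero_iff_lt]; omega)
  have hAm : (0 : ℝ) < (A : ℝ) + 1 - m := by linarith
  have h3 : ((A + 1).descFactorial m : ℝ) = (A + 1) / (A + 1 - m) * A.descFactorial m := by
    field_simp
    linarith
  rw [h3, mul_div_assoc]
  gcongr
  rw [div_pow, div_le_div_iff₀ hN0 (by positivity)]
  have h4 : (A.descFactorial m : ℝ) * N.descFactorial m ≤ ((N - x).descFactorial m : ℝ) ^ 2 := by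
    exact_mod_cast h2
  nlinarith

/-- The second moment bound for the existence of isolated vertices. -/
lemma freq_no_isolated_le {m : ℕ} (hn : 2 ≤ n) (hm : m + 2 * (n - 1) < n.choose 2) :
    freq (fun π : EdgeOrdering n => ¬ ∃ v, ∀ u, ¬ (processGraph π m).Adj v u) ≤
      Real.exp ((m : ℝ) * (n - 1 : ℕ) / (n.choose 2 - m - (n - 1 : ℕ))) / n +
        (m : ℝ) / (n.choose 2 - 2 * (n - 1 : ℕ) + 1 - m) := by
  classical
  set N := n.choose 2
  set x := n - 1
  have hmN : m ≤ N := by omega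
  let X : EdgeOrdering n → ℝ := fun π =>
    ∑ v : Fin n, if Disjoint (starEdges v) (firstSet π m) then 1 else 0
  set q : Finset (⊤ : SimpleGraph (Fin n)).edgeSet → ℝ := fun U =>
    freq (fun π : EdgeOrdering n => Disjoint U (firstSet π m)) with hq
  have hqU : ∀ U, q U = ((N - U.card).choose m : ℝ) / N.choose m := by
    intro U
    have h1 := freq_subset_disjoint (card_edgeSet_top n) hmN (Finset.disjoint_empty_left U)
      (by simp)
    simpa using h1
  have havg : ∀ U : Finset (⊤ : SimpleGraph (Fin n)).edgeSet,
      (∑ π : EdgeOrdering n, if Disjoint U (firstSet π m) then (1 : ℝ) else 0) /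
        Fintype.card (EdgeOrdering n) = q U := fun U => by
    rw [hq]
    simp only
    rw [freq_eq_sum]
  set p : ℝ := ((N - x).choose m : ℝ) / N.choose m with hp
  have hplow : Real.exp (-((m : ℝ) * x / (N - m - x))) ≤ p :=
    exp_le_choose_sub_div_choose (by omega)
  have hp0 : 0 < p := lt_of_lt_of_le (Real.exp_pos _) hplow
  have hqv : ∀ v, q (starEdges v) = p := fun v => by rw [hqU, card_starEdges]
  set r : ℝ := ((N : ℝ) - 2 * x + 1) / (N - 2 * x + 1 - m) with hr
  have hNm : (0 : ℝ) < (N : ℝ) - 2 * x + 1 - m := by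
    have : ((m + 2 * x : ℕ) : ℝ) < N := by exact_mod_cast hm
    push_cast at this
    linarith
  have hm0 : (0 : ℝ) ≤ m := by positivity
  have hr0 : 0 ≤ r := div_nonneg (by linarith) hNm.le
  have hquv : ∀ u v, u ≠ v → q (starEdges u ∪ starEdges v) ≤ r * p ^ 2 := fun u v h => by
    rw [hqU, card_starEdges_union h]
    exact choose_sub_mul_le (by omega) (by omega)
  have hn0 : (0 : ℝ) < n := by exact_mod_cast (by omega : 0 < n)
  have h1 : (∑ π, X π) / Fintype.card (EdgeOrdering n) = n * p := by
    simp only [X]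
    rw [Finset.sum_comm, Finset.sum_div,
      Finset.sum_congr rfl fun v _ => (havg (starEdges v)).trans (hqv v)]
    simp
  have hX2 : (∑ π, X π ^ 2) / Fintype.card (EdgeOrdering n) =
      ∑ u, ∑ v, q (starEdges u ∪ starEdges v) := by
    have : ∀ π, X π ^ 2 = ∑ u, ∑ v,
        if Disjoint (starEdges u ∪ starEdges v) (firstSet π m) then (1 : ℝ) else 0 := by
      intro π
      simp only [X]
      rw [sq, Finset.sum_mul_sum]
      refine Finset.sum_congr rfl fun φ _ => Finset.sum_congr rfl fun ψ _ => ?_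
      simp only [Finset.disjoint_union_left, ite_and]
      split_ifs <;> simp
    simp only [this]
    rw [Finset.sum_comm, Finset.sum_div]
    refine Finset.sum_congr rfl fun φ _ => ?_
    rw [Finset.sum_comm, Finset.sum_div]
    exact Finset.sum_congr rfl fun ψ _ => havg _
  set δ : ℝ := Real.exp ((m : ℝ) * x / (N - m - x)) / n + (m : ℝ) / (N - 2 * x + 1 - m) with hδ
  have hrδ : r = 1 + (m : ℝ) / (N - 2 * x + 1 - m) := by
    rw [hr]; field_simp; ring
  have h2 : (∑ π, X π ^ 2) / Fintype.card (EdgeOrdering n) ≤ (1 + δ) * (n * p) ^ 2 := by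
    rw [hX2]
    have h3 : ∀ u v : Fin n, q (starEdges u ∪ starEdges v) ≤
        (if u = v then p else 0) + r * p ^ 2 := by
      intro u v
      split_ifs with h
      · rw [h, Finset.union_self, hqv]
        have : 0 ≤ r * p ^ 2 := by positivity
        linarith
      · rw [zero_add]
        exact hquv u v h
    calc _ ≤ ∑ u : Fin n, ∑ v : Fin n, ((if u = v then p else 0) + r * p ^ 2) :=
          Finset.sum_le_sum fun u _ => Finset.sum_le_sum fun v _ => h3 u v
      _ = n * p + r * (n * p) ^ 2 := by
          simp only [Finset.sum_add_distrib, Finset.sum_ite_eq, Finset.mem_univ, if_true,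
            Finset.sum_const, Finset.card_univ, Fintype.card_fin, nsmul_eq_mul]
          ring
      _ ≤ _ := by
          -- The diagonal term is small relative to the squared mean because `n * p` is bounded
          -- below through `hplow`.
          have h4 : n * p ≤ Real.exp ((m : ℝ) * x / (N - m - x)) / n * (n * p) ^ 2 := by
            have h5 : 1 ≤ Real.exp ((m : ℝ) * x / (N - m - x)) * p := by
              calc (1 : ℝ) = Real.exp ((m : ℝ) * x / (N - m - x)) *
                    Real.exp (-((m : ℝ) * x / (N - m - x))) := by
                    rw [← Real.exp_add, add_neg_cancel, Real.exp_zero]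
                _ ≤ _ := by gcongr
            calc n * p = n * p * 1 := by ring
              _ ≤ n * p * (Real.exp ((m : ℝ) * x / (N - m - x)) * p) := by gcongr
              _ = _ := by field_simp
          rw [hrδ, hδ]
          nlinarith
  refine le_trans (freq_mono fun π hπ => ?_) (freq_eq_zero_le X (by positivity) h1 h2)
  refine Finset.sum_eq_zero fun v _ => if_neg fun hdisj => hπ ⟨v, isolated_iff.2 hdisj⟩

end Bounds

/-! ### Asymptotics at density c log n / n -/

section Limits

/-- The number of edges of the random graph process at density `c * log n / n`. -/
noncomputable def processTime (c : ℝ) (n : ℕ) : ℕ := ⌊c / 2 * (n * Real.log n)⌋₊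

lemma tendsto_log_natCast : Tendsto (fun n : ℕ => Real.log n) atTop atTop :=
  Real.tendsto_log_atTop.comp tendsto_natCast_atTop_atTop

lemma tendsto_natCast_mul_log : Tendsto (fun n : ℕ => (n : ℝ) * Real.log n) atTop atTop :=
  tendsto_natCast_atTop_atTop.atTop_mul_atTop₀ tendsto_log_natCast

lemma tendsto_processTime_div {c : ℝ} (hc : 0 ≤ c) :
    Tendsto (fun n : ℕ => (processTime c n : ℝ) / (n * Real.log n)) atTop (𝓝 (c / 2)) :=
  (tendsto_nat_floor_mul_div_atTop (R := ℝ) (a := c / 2) (by positivity)).comp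
    tendsto_natCast_mul_log

lemma tendsto_log_div_natCast : Tendsto (fun n : ℕ => Real.log n / n) atTop (𝓝 0) := by
  have := Real.isLittleO_log_id_atTop.tendsto_div_nhds_zero
  exact this.comp tendsto_natCast_atTop_atTop

lemma tendsto_inv_natCast : Tendsto (fun n : ℕ => ((n : ℝ))⁻¹) atTop (𝓝 0) :=
  tendsto_inv_atTop_zero.comp tendsto_natCast_atTop_atTop

lemma eventually_pos_log : ∀ᶠ n : ℕ in atTop, 0 < (n : ℝ) ∧ 0 < Real.log n := by
  filter_upwards [eventually_gt_atTop 1] with n hn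
  exact ⟨by exact_mod_cast (by omega : 0 < n), Real.log_pos (by exact_mod_cast hn)⟩

lemma tendsto_processTime_div_sq {c : ℝ} (hc : 0 ≤ c) :
    Tendsto (fun n : ℕ => (processTime c n : ℝ) / n ^ 2) atTop (𝓝 0) := by
  have h := (tendsto_processTime_div hc).mul tendsto_log_div_natCast
  rw [mul_zero] at h
  refine h.congr' ?_
  filter_upwards [eventually_pos_log] with n hn
  have := hn.1.ne'
  have := hn.2.ne'
  field_simp

lemma tendsto_choose_two_div_sq :
    Tendsto (fun n : ℕ => ((n.choose 2 : ℕ) : ℝ) / n ^ 2) atTop (𝓝 (1 / 2)) := by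
  have h : Tendsto (fun n : ℕ => (1 - ((n : ℝ))⁻¹) / 2) atTop (𝓝 ((1 - 0) / 2)) :=
    (tendsto_const_nhds.sub tendsto_inv_natCast).div_const 2
  rw [sub_zero] at h
  refine h.congr' ?_
  filter_upwards [eventually_pos_log] with n hn
  have := hn.1.ne'
  rw [Nat.cast_choose_two]
  field_simp

lemma tendsto_natCast_pred_div :
    Tendsto (fun n : ℕ => (((n - 1 : ℕ) : ℕ) : ℝ) / n) atTop (𝓝 1) := by
  have h : Tendsto (fun n : ℕ => 1 - ((n : ℝ))⁻¹) atTop (𝓝 (1 - 0)) :=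
    tendsto_const_nhds.sub tendsto_inv_natCast
  rw [sub_zero] at h
  refine h.congr' ?_
  filter_upwards [eventually_pos_log, eventually_ge_atTop 1] with n hn h1
  have := hn.1.ne'
  rw [Nat.cast_sub h1]
  field_simp
  simp

lemma tendsto_natCast_pred_div_sq :
    Tendsto (fun n : ℕ => (((n - 1 : ℕ) : ℕ) : ℝ) / n ^ 2) atTop (𝓝 0) := by
  have h := tendsto_natCast_pred_div.mul tendsto_inv_natCast
  rw [mul_zero] at h
  refine h.congr fun n => ?_
  rw [sq, ← div_eq_mul_inv, div_div]

lemma tendsto_exp_log_mul {f : ℕ → ℝ} {a : ℝ} (hf : Tendsto f atTop (𝓝 a)) (ha : a < 0) :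
    Tendsto (fun n : ℕ => Real.exp (Real.log n * f n)) atTop (𝓝 0) :=
  Real.tendsto_exp_atBot.comp (tendsto_log_natCast.atTop_mul_neg ha hf)

lemma eventually_processTime_le {c : ℝ} (hc : 0 ≤ c) :
    ∀ᶠ n : ℕ in atTop, processTime c n + 2 * (n - 1) < n.choose 2 := by
  have h := (tendsto_processTime_div_sq hc).add (tendsto_natCast_pred_div_sq.const_mul 2)
  rw [mul_zero, add_zero] at h
  have h1 := h.eventually_lt tendsto_choose_two_div_sq (by norm_num)
  filter_upwards [h1, eventually_pos_log] with n hn hn0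
  have hn2 : (0 : ℝ) < (n : ℝ) ^ 2 := by have := hn0.1; positivity
  rw [← mul_div_assoc, ← add_div, div_lt_div_iff_of_pos_right hn2] at hn
  exact_mod_cast hn

lemma eventually_le_processTime {c : ℝ} (hc : 0 < c) (C : ℝ) :
    ∀ᶠ n : ℕ in atTop, C * n ≤ processTime c n := by
  have h : Tendsto (fun n : ℕ => (processTime c n : ℝ) / (n * Real.log n) * Real.log n) atTop atTop :=
    (tendsto_processTime_div hc.le).pos_mul_atTop (by positivity) tendsto_log_natCast
  filter_upwards [h.eventually_ge_atTop C, eventually_pos_log] with n hn hn0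
  have h1 := hn0.1
  have h2 := hn0.2
  have h3 : (processTime c n : ℝ) / (n * Real.log n) * Real.log n = processTime c n / n := by
    field_simp
  rwa [h3, le_div_iff₀ h1] at hn

lemma tendsto_natCast_div_processTime {c : ℝ} (hc : 0 < c) :
    Tendsto (fun n : ℕ => (n : ℝ) / processTime c n) atTop (𝓝 0) := by
  have h : Tendsto (fun n : ℕ => (processTime c n : ℝ) / n) atTop atTop := by
    rw [tendsto_atTop]
    intro C
    filter_upwards [eventually_le_processTime hc C, eventually_pos_log] with n hn hn0
    rwa [le_div_iff₀ hn0.1]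
  refine (tendsto_inv_atTop_zero.comp h).congr fun n => ?_
  simp

lemma tendsto_processTime_atTop {c : ℝ} (hc : 0 < c) :
    Tendsto (fun n : ℕ => (processTime c n : ℝ)) atTop atTop := by
  refine tendsto_atTop_mono' _ (eventually_le_processTime hc 1) ?_
  simpa using tendsto_natCast_atTop_atTop

lemma tendsto_div_sub_const {f : ℕ → ℝ} (hf : Tendsto f atTop atTop) (a : ℝ) :
    Tendsto (fun n => f n / (f n - a)) atTop (𝓝 1) := by
  have h : Tendsto (fun n => 1 + a * (f n - a)⁻¹) atTop (𝓝 (1 + a * 0)) :=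
    ((tendsto_inv_atTop_zero.comp (tendsto_atTop_add_const_right _ (-a) hf)).const_mul a).const_add 1
  rw [mul_zero, add_zero] at h
  refine h.congr' ?_
  filter_upwards [hf.eventually_gt_atTop a] with n hn
  have : f n - a ≠ 0 := by linarith
  field_simp
  ring

/-- Sparse graphs appear in the random graph process. -/
lemma tendsto_freq_not_contains {β : Type*} [Fintype β] {B : SimpleGraph β} (hB : B.IsSparse)
    {c : ℝ} (hc : 0 < c) :
    Tendsto (fun n : ℕ => freq (fun π : EdgeOrdering n => ¬ ∃ φ : β → Fin n, Function.Injective φ ∧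
        ∀ a b, B.Adj a b → (processGraph π (processTime c n)).Adj (φ a) (φ b))) atTop (𝓝 0) := by
  classical
  set η := Fintype.card B.edgeSet
  set b := Fintype.card β
  -- This is where the average degree must tend to infinity; the other factors tend to constants.
  have h1 : Tendsto (fun n : ℕ => (n.choose 2 : ℝ) / (n * processTime c n)) atTop (𝓝 0) := by
    have h := tendsto_choose_two_div_sq.mul (tendsto_natCast_div_processTime hc)
    rw [mul_zero] at h
    refine h.congr' ?_
    filter_upwards [eventually_pos_log, (tendsto_processTime_atTop hc).eventually_gt_atTop 0]
      with n hn hm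
    have := hn.1
    field_simp
  have h2 := (tendsto_div_sub_const (tendsto_processTime_atTop hc) η).pow (2 * η)
  have h3 := (tendsto_div_sub_const tendsto_natCast_atTop_atTop (b : ℝ)).pow b
  have h4 := (h2.mul (((h1.mul_const (((b : ℝ) + 1) ^ b)).mul h3).const_add 1)).sub_const 1
  simp only [one_pow, zero_mul, add_zero, mul_one, sub_self] at h4
  refine tendsto_of_tendsto_of_tendsto_of_le_of_le' tendsto_const_nhds h4
    (Eventually.of_forall fun n => freq_nonneg _) ?_
  filter_upwards [(tendsto_processTime_atTop hc).eventually_gt_atTop ((2 * η : ℕ) : ℝ),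
    eventually_processTime_le hc.le, h1.eventually_le_const zero_lt_one, eventually_gt_atTop b,
    eventually_pos_log] with n g1 g2 g3 g4 g5
  have g1' : 2 * η < processTime c n := by exact_mod_cast g1
  refine freq_not_contains_le hB g1' (by omega) ?_ g4
  have hm : (0 : ℝ) < n * processTime c n := by
    have : (0 : ℝ) ≤ ((2 * η : ℕ) : ℝ) := by positivity
    exact mul_pos g5.1 (by linarith)
  rw [div_le_one hm] at g3
  exact_mod_cast g3

/-- Below the connectivity threshold there are isolated vertices. -/
lemma tendsto_freq_no_isolated {c : ℝ} (hc : 0 < c) (hc1 : c < 1) :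
    Tendsto (fun n : ℕ => freq (fun π : EdgeOrdering n =>
      ¬ ∃ v, ∀ u, ¬ (processGraph π (processTime c n)).Adj v u)) atTop (𝓝 0) := by
  have h1 : Tendsto (fun n : ℕ => (processTime c n : ℝ) /
      (n.choose 2 - 2 * (n - 1 : ℕ) + 1 - processTime c n)) atTop (𝓝 0) := by
    have hinv2 : Tendsto (fun n : ℕ => ((n : ℝ) ^ 2)⁻¹) atTop (𝓝 0) := by
      simpa using tendsto_inv_natCast.pow 2
    have h := (tendsto_processTime_div_sq hc.le).div
      (((tendsto_choose_two_div_sq.sub (tendsto_natCast_pred_div_sq.const_mul 2)).add hinv2).sub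
        (tendsto_processTime_div_sq hc.le)) (by norm_num)
    rw [zero_div] at h
    refine h.congr' ?_
    filter_upwards [eventually_pos_log] with n hn
    have := hn.1.ne'
    simp only [Pi.div_apply]
    rw [← mul_div_assoc, ← one_div, ← sub_div, ← add_div, ← sub_div, div_div_div_cancel_right₀]
    positivity
  -- The first error term is written as a power of `n` whose exponent tends to `c - 1`.
  have h2 : Tendsto (fun n : ℕ => (processTime c n : ℝ) / (n * Real.log n) *
      ((((n - 1 : ℕ) : ℝ) / n) / ((n.choose 2 : ℝ) / n ^ 2 - (processTime c n : ℝ) / n ^ 2 -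
        ((n - 1 : ℕ) : ℝ) / n ^ 2)) - 1) atTop (𝓝 (c / 2 * (1 / (1 / 2 - 0 - 0)) - 1)) :=
    ((tendsto_processTime_div hc.le).mul (tendsto_natCast_pred_div.div
      ((tendsto_choose_two_div_sq.sub (tendsto_processTime_div_sq hc.le)).sub
        tendsto_natCast_pred_div_sq) (by norm_num))).sub_const 1
  have h3 := (tendsto_exp_log_mul h2 (by norm_num; linarith)).add h1
  rw [add_zero] at h3
  refine tendsto_of_tendsto_of_tendsto_of_le_of_le' tendsto_const_nhds h3
    (Eventually.of_forall fun n => freq_nonneg _) ?_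
  filter_upwards [eventually_processTime_le hc.le, eventually_ge_atTop 2, eventually_pos_log]
    with n g1 g2 g3
  refine (freq_no_isolated_le g2 g1).trans (le_of_eq ?_)
  congr 1
  have hn0 := g3.1
  have hl0 := g3.2
  rw [mul_sub, mul_one, Real.exp_sub, Real.exp_log hn0]
  congr 2
  rw [← sub_div, ← sub_div]
  have : (n.choose 2 : ℝ) - processTime c n - (n - 1 : ℕ) ≠ 0 := by
    have : ((processTime c n + 2 * (n - 1) : ℕ) : ℝ) < n.choose 2 := by exact_mod_cast g1
    push_cast at this
    have h0 : (0 : ℝ) ≤ ((n - 1 : ℕ) : ℝ) := by positivity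
    linarith
  field_simp

/-- Above the connectivity threshold there are no isolated vertices. -/
lemma tendsto_freq_exists_isolated {c : ℝ} (hc : 1 < c) :
    Tendsto (fun n : ℕ => freq (fun π : EdgeOrdering n =>
      ∃ v, ∀ u, ¬ (processGraph π (processTime c n)).Adj v u)) atTop (𝓝 0) := by
  have hc0 : 0 < c := by linarith
  -- The expected number of isolated vertices is bounded by a power of `n` whose exponent tends to
  -- `1 - c`.
  have h2 : Tendsto (fun n : ℕ => 1 - (processTime c n : ℝ) / (n * Real.log n) *
      ((((n - 1 : ℕ) : ℝ) / n) / ((n.choose 2 : ℝ) / n ^ 2))) atTop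
      (𝓝 (1 - c / 2 * (1 / (1 / 2)))) :=
    ((tendsto_processTime_div hc0.le).mul (tendsto_natCast_pred_div.div
      tendsto_choose_two_div_sq (by norm_num))).const_sub 1
  have h3 := tendsto_exp_log_mul h2 (by norm_num; linarith)
  refine tendsto_of_tendsto_of_tendsto_of_le_of_le' tendsto_const_nhds h3
    (Eventually.of_forall fun n => freq_nonneg _) ?_
  filter_upwards [eventually_processTime_le hc0.le, eventually_pos_log] with n g1 g3
  refine (freq_exists_isolated_le (by omega)).trans (le_of_eq ?_)
  have hn0 := g3.1
  have hl0 := g3.2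
  rw [mul_sub, mul_one, sub_eq_add_neg, Real.exp_add, Real.exp_log hn0]
  congr 3
  have : (0 : ℝ) < n.choose 2 := by exact_mod_cast (by omega : 0 < n.choose 2)
  field_simp

lemma tendsto_freq_hasIsolatedEdge {c : ℝ} (hc : 1 / 2 < c) :
    Tendsto (fun n : ℕ => freq (fun π : EdgeOrdering n => HasIsolatedEdge π (processTime c n)))
      atTop (𝓝 0) := by
  have hc0 : 0 < c := by linarith
  have h1 : Tendsto (fun n : ℕ => ((2 * (n - 1) - 1 : ℕ) : ℝ) / n) atTop (𝓝 2) := by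
    have h := (tendsto_natCast_pred_div.const_mul 2).sub tendsto_inv_natCast
    rw [mul_one, sub_zero] at h
    refine h.congr' ?_
    filter_upwards [eventually_ge_atTop 2] with n hn
    rw [Nat.cast_sub (show 1 ≤ 2 * (n - 1) by omega), Nat.cast_mul, ← mul_div_assoc, ← one_div,
      ← sub_div, Nat.cast_ofNat, Nat.cast_one]
  have h2 : Tendsto (fun n : ℕ => 1 - (processTime c n : ℝ) / (n * Real.log n) *
      ((((2 * (n - 1) - 1 : ℕ) : ℝ) / n) / ((n.choose 2 : ℝ) / n ^ 2))) atTop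
      (𝓝 (1 - c / 2 * (2 / (1 / 2)))) :=
    ((tendsto_processTime_div hc0.le).mul (h1.div
      tendsto_choose_two_div_sq (by norm_num))).const_sub 1
  have h3 := (tendsto_exp_log_mul h2 (by norm_num; linarith)).div h1 two_ne_zero
  rw [zero_div] at h3
  refine tendsto_of_tendsto_of_tendsto_of_le_of_le' tendsto_const_nhds h3
    (Eventually.of_forall fun n => freq_nonneg _) ?_
  filter_upwards [eventually_processTime_le hc0.le, eventually_pos_log, eventually_ge_atTop 2]
    with n g1 g3 g4
  refine (freq_hasIsolatedEdge_le (by omega)).trans (le_of_eq ?_)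
  have hn0 := g3.1
  have hl0 := g3.2
  have hD : (0 : ℝ) < ((2 * (n - 1) - 1 : ℕ) : ℝ) := by exact_mod_cast (by omega)
  have hN : (0 : ℝ) < n.choose 2 := by exact_mod_cast (by omega : 0 < n.choose 2)
  simp only [Pi.div_apply]
  rw [mul_sub, mul_one, sub_eq_add_neg, Real.exp_add, Real.exp_log hn0]
  have : ((2 * (n - 1) - 1 : ℕ) : ℝ) * processTime c n / (n.choose 2 : ℝ) =
      Real.log n * ((processTime c n : ℝ) / (n * Real.log n) *
        ((((2 * (n - 1) - 1 : ℕ) : ℝ) / n) / ((n.choose 2 : ℝ) / n ^ 2))) := by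
    field_simp
  rw [← this]
  field_simp

end Limits

/-! ### Absence of small components -/

section SmallComponents

/-- Both coefficients are bounded by a power over a factorial, and `k ^ k / k! ≤ exp k` is used
twice. The loss against counting trees is only exponential in `k`. -/
lemma choose_mul_choose_le {n k : ℕ} (hk : 1 ≤ k) :
    (n.choose k : ℝ) * ((k.choose 2).choose (k - 1) : ℝ) ≤ (n : ℝ) ^ k * Real.exp 2 ^ k := by
  have h1 : (n.choose k : ℝ) ≤ (n : ℝ) ^ k / k.factorial := Nat.choose_le_pow_div k n
  have h2 : ((k.choose 2).choose (k - 1) : ℝ) ≤ ((k.choose 2 : ℕ) : ℝ) ^ (k - 1) / (k - 1).factorial :=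
    Nat.choose_le_pow_div (k - 1) (k.choose 2)
  have h3 : ((k.choose 2 : ℕ) : ℝ) ≤ (k : ℝ) ^ 2 := by
    exact_mod_cast Nat.choose_le_pow k 2
  have hk0 : (1 : ℝ) ≤ k := by exact_mod_cast hk
  have h4 : (k.factorial : ℝ) = k * (k - 1).factorial := by
    exact_mod_cast (Nat.mul_factorial_pred (by omega)).symm
  have h5 := Real.pow_div_factorial_le_exp (k : ℝ) (by positivity) k
  have h6 : (k : ℝ) ^ k = k ^ (k - 1) * k := by
    rw [← pow_succ, Nat.sub_add_cancel hk]
  have hf : (0 : ℝ) < (k - 1).factorial := by positivity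
  calc _ ≤ (n : ℝ) ^ k / k.factorial * (((k : ℝ) ^ 2) ^ (k - 1) / (k - 1).factorial) := by
        gcongr
        exact h2.trans (by gcongr)
    _ = (n : ℝ) ^ k * (((k : ℝ) ^ k / k.factorial) ^ 2 / k) := by
        rw [h6, h4, ← pow_mul, mul_comm 2, pow_mul]
        field_simp
    _ ≤ (n : ℝ) ^ k * (Real.exp k ^ 2 / 1) := by gcongr
    _ = _ := by
        rw [div_one, ← Real.exp_nat_mul, ← Real.exp_nat_mul]
        congr 2
        push_cast
        ring

/-- With `τ = (n - k) / n` the term is at most `n` to the power `1 + k / 20 - (39 / 50) * τ * k`,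
the `k / 20` paying for `exp 2 * log n`. The bounded sizes `k < 8` get a small term each; larger
sizes gain a further factor `1 / n`, so up to `n` of them can be summed. -/
lemma smallComponent_term_le {n k m : ℕ} {N ℓ : ℝ} (hn : 400 ≤ n) (hN : 0 < N)
    (hℓ : ℓ = Real.log n) (hℓ1 : 1 ≤ ℓ) (h1 : (n : ℝ) * (m / N) ≤ ℓ)
    (h2 : 39 / 50 * ℓ ≤ (m - n) * n / N) (h3 : Real.exp 2 * ℓ ≤ Real.exp (1 / 20 * ℓ))
    (hk : 2 ≤ k) (hkn : 2 * k ≤ n) :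
    (n.choose k : ℝ) * (((k.choose 2).choose (k - 1) : ℝ) * (((m : ℝ) / N) ^ (k - 1) *
      Real.exp (-((k : ℝ) * (n - k) * (m - n) / N)))) ≤
      (if k < 8 then Real.exp (-(2 / 5 * ℓ)) else 0) + Real.exp (-(2 / 5 * ℓ)) / n := by
  have hn0 : (0 : ℝ) < n := by exact_mod_cast (by omega : 0 < n)
  have hnℓ : (n : ℝ) = Real.exp ℓ := by rw [hℓ, Real.exp_log hn0]
  have hk0 : (2 : ℝ) ≤ k := by exact_mod_cast hk
  have hkn' : (2 : ℝ) * k ≤ n := by exact_mod_cast hkn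
  set τ : ℝ := (n - k) / n with hτ
  have hτ0 : 0 ≤ τ := div_nonneg (by linarith) hn0.le
  have main : (n.choose k : ℝ) * (((k.choose 2).choose (k - 1) : ℝ) * (((m : ℝ) / N) ^ (k - 1) *
      Real.exp (-((k : ℝ) * (n - k) * (m - n) / N)))) ≤
      Real.exp (ℓ + k * (1 / 20 * ℓ) - k * (τ * (39 / 50 * ℓ))) := by
    calc _ = ((n.choose k : ℝ) * ((k.choose 2).choose (k - 1) : ℝ)) * (((m : ℝ) / N) ^ (k - 1) *
          Real.exp (-((k : ℝ) * (n - k) * (m - n) / N))) := by ring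
      _ ≤ ((n : ℝ) ^ k * Real.exp 2 ^ k) * (((m : ℝ) / N) ^ (k - 1) *
          Real.exp (-((k : ℝ) * (n - k) * (m - n) / N))) := by
          exact mul_le_mul_of_nonneg_right (choose_mul_choose_le (by omega)) (by positivity)
      _ = n * ((n : ℝ) * (m / N)) ^ (k - 1) * Real.exp 2 ^ k *
          Real.exp (-((k : ℝ) * (n - k) * (m - n) / N)) := by
          have : (n : ℝ) ^ k = n * (n : ℝ) ^ (k - 1) := by
            rw [← pow_succ', Nat.sub_add_cancel (show 1 ≤ k by omega)]
          rw [this, mul_pow]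
          ring
      _ ≤ n * ℓ ^ k * Real.exp 2 ^ k * Real.exp (-(k * (τ * (39 / 50 * ℓ)))) := by
          have e1 : ((n : ℝ) * (m / N)) ^ (k - 1) ≤ ℓ ^ k :=
            calc ((n : ℝ) * (m / N)) ^ (k - 1) ≤ ℓ ^ (k - 1) := by gcongr
              _ ≤ ℓ ^ k := pow_le_pow_right₀ hℓ1 (by omega)
          have e2 : k * (τ * (39 / 50 * ℓ)) ≤ (k : ℝ) * (n - k) * (m - n) / N := by
            calc k * (τ * (39 / 50 * ℓ)) ≤ k * (τ * ((m - n) * n / N)) := by gcongr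
              _ = _ := by rw [hτ]; field_simp
          gcongr
      _ = n * (Real.exp 2 * ℓ) ^ k * Real.exp (-(k * (τ * (39 / 50 * ℓ)))) := by
          rw [mul_pow]; ring
      _ ≤ n * Real.exp (1 / 20 * ℓ) ^ k * Real.exp (-(k * (τ * (39 / 50 * ℓ)))) := by gcongr
      _ = _ := by
          rw [hnℓ, ← Real.exp_nat_mul, ← Real.exp_add, ← Real.exp_add]
          congr 1
  refine main.trans ?_
  have hlast : 0 ≤ Real.exp (-(2 / 5 * ℓ)) / n := by positivity
  split_ifs with h8
  · have h8' : (k : ℝ) ≤ 8 := by exact_mod_cast h8.le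
    have hn' : (400 : ℝ) ≤ n := by exact_mod_cast hn
    have hτ1 : 97 / 100 ≤ τ := by
      rw [hτ, le_div_iff₀ hn0]
      linarith
    refine le_trans (Real.exp_le_exp.2 ?_) (le_add_of_nonneg_right hlast)
    have e1 : (k : ℝ) * (97 / 100 * (39 / 50 * ℓ)) ≤ k * (τ * (39 / 50 * ℓ)) := by gcongr
    nlinarith
  · have h8' : (8 : ℝ) ≤ k := by exact_mod_cast not_lt.1 h8
    have hτ1 : 1 / 2 ≤ τ := by
      rw [hτ, le_div_iff₀ hn0]
      linarith
    rw [zero_add, hnℓ, ← Real.exp_sub]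
    refine Real.exp_le_exp.2 ?_
    have e1 : (k : ℝ) * (1 / 2 * (39 / 50 * ℓ)) ≤ k * (τ * (39 / 50 * ℓ)) := by gcongr
    nlinarith

lemma eventually_exp_two_mul_log_le :
    ∀ᶠ n : ℕ in atTop, Real.exp 2 * Real.log n ≤ Real.exp (1 / 20 * Real.log n) := by
  have h : Tendsto (fun x : ℝ => Real.exp (1 / 20 * x) / x) atTop atTop := by
    have h1 := (Real.tendsto_exp_div_pow_atTop 1).comp
      (tendsto_id.const_mul_atTop (show (0 : ℝ) < 1 / 20 by norm_num))
    have h2 := h1.const_mul_atTop (show (0 : ℝ) < 1 / 20 by norm_num)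
    refine h2.congr fun x => ?_
    simp only [Function.comp, pow_one, id]
    by_cases hx : x = 0
    · simp [hx]
    · field_simp
  filter_upwards [(h.comp tendsto_log_natCast).eventually_ge_atTop (Real.exp 2), eventually_pos_log]
    with n hn hn0
  exact (le_div_iff₀ hn0.2).1 hn

/-- The constant `4/5` lies above `1/2`, so that isolated edges are excluded, and below `1`, so that
isolated vertices still exist. The ratios in `h1` and `h2` tend to `4/5`, leaving room for the
bounds `1` and `39/50`. -/
lemma tendsto_freq_hasSmallComponent :
    Tendsto (fun n : ℕ => freq (fun π : EdgeOrdering n =>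
      HasSmallComponent π (processTime (4 / 5) n))) atTop (𝓝 0) := by
  have hlim : Tendsto (fun n : ℕ => 9 * Real.exp (-(2 / 5 * Real.log n))) atTop (𝓝 0) := by
    have h := tendsto_exp_log_mul (tendsto_const_nhds (x := -(2 / 5 : ℝ))) (by norm_num)
    have h2 := h.const_mul 9
    rw [mul_zero] at h2
    exact h2.congr fun n => by congr 2; ring
  have h1 : Tendsto (fun n : ℕ => (processTime (4 / 5) n : ℝ) / (n * Real.log n) /
      ((n.choose 2 : ℝ) / n ^ 2)) atTop (𝓝 ((4 / 5) / 2 / (1 / 2))) :=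
    (tendsto_processTime_div (by norm_num)).div tendsto_choose_two_div_sq (by norm_num)
  have h2 : Tendsto (fun n : ℕ => ((processTime (4 / 5) n : ℝ) / (n * Real.log n) -
      (Real.log n)⁻¹) / ((n.choose 2 : ℝ) / n ^ 2)) atTop (𝓝 (((4 / 5) / 2 - 0) / (1 / 2))) :=
    ((tendsto_processTime_div (by norm_num)).sub
      (tendsto_inv_atTop_zero.comp tendsto_log_natCast)).div tendsto_choose_two_div_sq (by norm_num)
  refine tendsto_of_tendsto_of_tendsto_of_le_of_le' tendsto_const_nhds hlim
    (Eventually.of_forall fun n => freq_nonneg _) ?_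
  filter_upwards [h1.eventually_le_const (show (4 / 5) / 2 / (1 / 2) < (1 : ℝ) by norm_num),
    h2.eventually_const_le (show (39 / 50 : ℝ) < ((4 / 5) / 2 - 0) / (1 / 2) by norm_num),
    eventually_exp_two_mul_log_le, eventually_processTime_le (show (0 : ℝ) ≤ 4 / 5 by norm_num),
    eventually_le_processTime (show (0 : ℝ) < 4 / 5 by norm_num) 1, eventually_ge_atTop 400,
    eventually_pos_log, tendsto_log_natCast.eventually_ge_atTop 1]
    with n g1 g2 g3 g4 g5 g6 g7 g8
  have hn0 := g7.1
  have hl0 := g7.2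
  have hN : (0 : ℝ) < n.choose 2 := by exact_mod_cast (by omega : 0 < n.choose 2)
  have g5' : n ≤ processTime (4 / 5) n := by rw [one_mul] at g5; exact_mod_cast g5
  set m := processTime (4 / 5) n
  have e1 : (n : ℝ) * (m / (n.choose 2 : ℝ)) ≤ Real.log n := by
    calc (n : ℝ) * (m / (n.choose 2 : ℝ)) =
          (m : ℝ) / (n * Real.log n) / ((n.choose 2 : ℝ) / n ^ 2) * Real.log n := by field_simp
      _ ≤ 1 * Real.log n := by gcongr
      _ = _ := one_mul _
  have e2 : 39 / 50 * Real.log n ≤ ((m : ℝ) - n) * n / (n.choose 2 : ℝ) := by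
    calc 39 / 50 * Real.log n ≤ ((m : ℝ) / (n * Real.log n) - (Real.log n)⁻¹) /
          ((n.choose 2 : ℝ) / n ^ 2) * Real.log n := by gcongr
      _ = _ := by field_simp
  refine (freq_hasSmallComponent_le (by omega) g5').trans ?_
  set x := Real.exp (-(2 / 5 * Real.log n)) with hx
  have hx0 : 0 < x := Real.exp_pos _
  calc _ ≤ ∑ k ∈ Finset.Icc 2 (n / 2), ((if k < 8 then x else 0) + x / n) := by
        refine Finset.sum_le_sum fun k hk => ?_
        rw [Finset.mem_Icc] at hk
        exact smallComponent_term_le g6 hN rfl g8 e1 e2 g3 hk.1 (by omega)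
    _ ≤ 8 * x + n * (x / n) := by
        rw [Finset.sum_add_distrib, ← Finset.sum_filter, Finset.sum_const, Finset.sum_const,
          nsmul_eq_mul, nsmul_eq_mul]
        have c1 : ((Finset.Icc 2 (n / 2)).filter fun k => k < 8).card ≤ 8 := by
          calc _ ≤ (Finset.range 8).card := Finset.card_le_card fun k hk => by
                rw [Finset.mem_filter] at hk
                exact Finset.mem_range.2 hk.2
            _ = 8 := Finset.card_range 8
        have c2 : (Finset.Icc 2 (n / 2)).card ≤ n := by
          rw [Nat.card_Icc]
          omega
        gcongr
        · exact_mod_cast c1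
    _ = 9 * x := by field_simp; ring

end SmallComponents

/-! ### Monotonicity, and transfer to the binomial random graph -/

section Transfer

/-- The closure is the least closed graph above `G`; monotonicity of percolation follows. -/
lemma dynamicsClosure_le {W V : Type*} {H : SimpleGraph W} {G K : SimpleGraph V} (hGK : G ≤ K)
    (hK : IsDynamicsClosed H K) : dynamicsClosure H G ≤ K := by
  refine iSup_le fun t => ?_
  induction t with
  | zero => exact hGK
  | succ t ih =>
    rw [Function.iterate_succ_apply']
    refine sup_le ih fun u v huv => ?_
    rw [SimpleGraph.fromEdgeSet_adj] at huv
    obtain ⟨ψ, hψ, x, y, hxy, he, h⟩ := completesCopy_iff.1 huv.1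
    have := hK ψ hψ x y hxy fun a b hab hne => ih (h a b hab hne)
    rcases Sym2.eq_iff.1 he with ⟨rfl, rfl⟩ | ⟨rfl, rfl⟩
    exacts [this, this.symm]

lemma Percolates.mono {W V : Type*} [Finite W] {H : SimpleGraph W} {G G' : SimpleGraph V}
    (hG : Percolates H G) (h : G ≤ G') : Percolates H G' := by
  refine top_le_iff.1 ?_
  rw [← show dynamicsClosure H G = ⊤ from hG]
  exact dynamicsClosure_le (h.trans (le_dynamicsClosure H _)) (isDynamicsClosed_dynamicsClosure H _)

/-- The probability that a binomial random variable takes the value `j`. -/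
noncomputable def binomialWeight (N : ℕ) (p : ℝ) (j : ℕ) : ℝ :=
  N.choose j * p ^ j * (1 - p) ^ (N - j)

lemma binomialWeight_eq_eval (N : ℕ) (p : ℝ) (j : ℕ) :
    binomialWeight N p j = (bernsteinPolynomial ℝ N j).eval p := by
  simp [binomialWeight, bernsteinPolynomial]

lemma sum_binomialWeight (N : ℕ) (p : ℝ) :
    ∑ j ∈ Finset.range (N + 1), binomialWeight N p j = 1 := by
  simp only [binomialWeight_eq_eval]
  rw [← Polynomial.eval_finsetSum, bernsteinPolynomial.sum, Polynomial.eval_one]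

lemma sum_sq_mul_binomialWeight (N : ℕ) (p : ℝ) :
    ∑ j ∈ Finset.range (N + 1), (N * p - j) ^ 2 * binomialWeight N p j = N * p * (1 - p) := by
  have h := congrArg (Polynomial.eval p) (bernsteinPolynomial.variance ℝ N)
  rw [Polynomial.eval_finsetSum] at h
  simpa [binomialWeight_eq_eval] using h

lemma binomialWeight_nonneg {N : ℕ} {p : ℝ} (h0 : 0 ≤ p) (h1 : p ≤ 1) (j : ℕ) :
    0 ≤ binomialWeight N p j := by
  have : 0 ≤ 1 - p := by linarith
  unfold binomialWeight
  positivity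

/-- Chebyshev's inequality for the binomial distribution. -/
lemma sum_binomialWeight_le {N : ℕ} {p d : ℝ} (h0 : 0 ≤ p) (h1 : p ≤ 1) (hd : 0 < d)
    (P : ℕ → Prop) [DecidablePred P] (hP : ∀ j, P j → d ^ 2 ≤ (N * p - j) ^ 2) :
    ∑ j ∈ Finset.range (N + 1), (if P j then binomialWeight N p j else 0) ≤ N * p / d ^ 2 := by
  rw [le_div_iff₀ (by positivity), Finset.sum_mul]
  calc _ ≤ ∑ j ∈ Finset.range (N + 1), (N * p - j) ^ 2 * binomialWeight N p j := by
        refine Finset.sum_le_sum fun j _ => ?_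
        have := binomialWeight_nonneg (N := N) h0 h1 j
        split_ifs with h
        · rw [mul_comm]
          exact mul_le_mul_of_nonneg_right (hP j h) this
        · rw [zero_mul]
          positivity
    _ = N * p * (1 - p) := sum_sq_mul_binomialWeight N p
    _ ≤ _ := mul_le_of_le_one_right (by positivity) (by linarith)

/-- The graph with a given set of edges. -/
def graphOfEdges {n : ℕ} (A : Finset (⊤ : SimpleGraph (Fin n)).edgeSet) : SimpleGraph (Fin n) :=
  SimpleGraph.fromEdgeSet (Subtype.val '' (A : Set (⊤ : SimpleGraph (Fin n)).edgeSet))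

lemma processGraph_eq_graphOfEdges {n : ℕ} (π : EdgeOrdering n) (m : ℕ) :
    processGraph π m = graphOfEdges (firstSet π m) := by
  ext u v
  rw [processGraph_adj, graphOfEdges, SimpleGraph.fromEdgeSet_adj]
  constructor
  · rintro ⟨h, hm⟩
    exact ⟨⟨topEdge h, hm, rfl⟩, h⟩
  · rintro ⟨⟨e, he, heuv⟩, h⟩
    exact ⟨h, by rwa [show topEdge h = e from Subtype.ext heuv.symm]⟩

lemma edgeSet_graphOfEdges {n : ℕ} (A : Finset (⊤ : SimpleGraph (Fin n)).edgeSet) :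
    (graphOfEdges A).edgeSet = Subtype.val '' (A : Set (⊤ : SimpleGraph (Fin n)).edgeSet) := by
  rw [graphOfEdges, SimpleGraph.edgeSet_fromEdgeSet, sdiff_eq_left, Set.disjoint_left]
  rintro _ ⟨e, -, rfl⟩ hd
  exact (⊤ : SimpleGraph (Fin n)).not_isDiag_of_mem_edgeSet e.2 hd

lemma ncard_edgeSet_graphOfEdges {n : ℕ} (A : Finset (⊤ : SimpleGraph (Fin n)).edgeSet) :
    (graphOfEdges A).edgeSet.ncard = A.card := by
  rw [edgeSet_graphOfEdges, Set.ncard_image_of_injective _ Subtype.val_injective,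
    Set.ncard_coe_finset]

lemma bijective_graphOfEdges {n : ℕ} : Function.Bijective (graphOfEdges (n := n)) := by
  classical
  constructor
  · intro A A' h
    have := congrArg SimpleGraph.edgeSet h
    rw [edgeSet_graphOfEdges, edgeSet_graphOfEdges] at this
    exact_mod_cast Subtype.val_injective.image_injective this
  · intro G
    refine ⟨Finset.univ.filter fun e => (e : Sym2 (Fin n)) ∈ G.edgeSet, ?_⟩
    rw [← SimpleGraph.edgeSet_inj, edgeSet_graphOfEdges]
    ext e
    simp only [Finset.coe_filter, Finset.mem_univ, true_and, Set.mem_image]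
    constructor
    · rintro ⟨e, he, rfl⟩
      exact he
    · intro he
      exact ⟨⟨e, SimpleGraph.edgeSet_mono le_top he⟩, he, rfl⟩

instance {n : ℕ} : MeasurableSingletonClass (SimpleGraph (Fin n)) where
  measurableSet_singleton G := by
    convert SimpleGraph.measurable_edgeSet (measurableSet_singleton G.edgeSet)
    ext G'
    simp

/-- The binomial random graph is a mixture of the stages of the random graph process. -/
lemma binomialRandom_eq_sum {n : ℕ} (p : unitInterval) (Q : SimpleGraph (Fin n) → Prop) :
    (SimpleGraph.binomialRandom (Fin n) p {G | Q G}).toReal =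
      ∑ j ∈ Finset.range (n.choose 2 + 1), binomialWeight (n.choose 2) p j *
        freq (fun π : EdgeOrdering n => Q (processGraph π j)) := by
  classical
  set N := n.choose 2 with hN
  let E := (⊤ : SimpleGraph (Fin n)).edgeSet
  have h1 : (SimpleGraph.binomialRandom (Fin n) p {G | Q G}).toReal =
      ∑ G ∈ Finset.univ.filter Q, (p : ℝ) ^ G.edgeSet.ncard * (1 - p) ^ (N - G.edgeSet.ncard) := by
    have hset : {G | Q G} = ((Finset.univ.filter Q : Finset (SimpleGraph (Fin n))) : Set _) := by
      ext; simp
    rw [hset, ← MeasureTheory.sum_measure_singleton,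
      ENNReal.toReal_sum (fun G _ => MeasureTheory.measure_ne_top _ _)]
    refine Finset.sum_congr rfl fun G _ => ?_
    rw [SimpleGraph.binomialRandom_singleton, Nat.card_eq_fintype_card, Fintype.card_fin]
    simp [hN]
  have h2 : ∑ G ∈ Finset.univ.filter Q, (p : ℝ) ^ G.edgeSet.ncard * (1 - p) ^ (N - G.edgeSet.ncard) =
      ∑ A ∈ Finset.univ.filter (fun A : Finset E => Q (graphOfEdges A)),
        (p : ℝ) ^ A.card * (1 - p) ^ (N - A.card) := by
    symm
    refine Finset.sum_bij (fun A _ => graphOfEdges A) (fun A hA => ?_)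
      (fun A _ A' _ h => bijective_graphOfEdges.1 h) (fun G hG => ?_) (fun A _ => ?_)
    · simpa using hA
    · obtain ⟨A, rfl⟩ := bijective_graphOfEdges.2 G
      exact ⟨A, by simpa using hG, rfl⟩
    · rw [ncard_edgeSet_graphOfEdges]
  rw [h1, h2]
  have hmaps : ∀ A ∈ Finset.univ.filter (fun A : Finset E => Q (graphOfEdges A)),
      A.card ∈ Finset.range (N + 1) := fun A _ => by
    have := A.card_le_univ
    rw [card_edgeSet_top] at this
    rw [Finset.mem_range]
    omega
  rw [← Finset.sum_fiberwise_of_maps_to hmaps]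
  refine Finset.sum_congr rfl fun j hj => ?_
  have hjN : j ≤ N := by rw [Finset.mem_range] at hj; omega
  have h3 : freq (fun π : EdgeOrdering n => Q (processGraph π j)) =
      (((Finset.powersetCard j Finset.univ).filter fun A : Finset E => Q (graphOfEdges A)).card : ℝ) /
        N.choose j := by
    simp only [processGraph_eq_graphOfEdges]
    exact freq_firstSet (card_edgeSet_top n) hjN (fun A => Q (graphOfEdges A))
  rw [h3, binomialWeight]
  have h4 : ∑ A ∈ (Finset.univ.filter (fun A : Finset E => Q (graphOfEdges A))).filter
      (fun A => A.card = j), (p : ℝ) ^ A.card * (1 - p) ^ (N - A.card) =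
      ((Finset.powersetCard j Finset.univ).filter fun A : Finset E => Q (graphOfEdges A)).card *
        ((p : ℝ) ^ j * (1 - p) ^ (N - j)) := by
    rw [← nsmul_eq_mul, ← Finset.sum_const]
    refine Finset.sum_congr ?_ fun A hA => ?_
    · ext A
      simp only [Finset.mem_filter, Finset.mem_univ, true_and, Finset.mem_powersetCard,
        Finset.subset_univ]
      tauto
    · rw [Finset.mem_filter, Finset.mem_powersetCard] at hA
      rw [hA.1.2]
  rw [h4]
  have h5 : (N.choose j : ℝ) ≠ 0 := by exact_mod_cast (Nat.choose_pos hjN).ne'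
  field_simp

variable {Q : ∀ n : ℕ, SimpleGraph (Fin n) → Prop}

lemma freq_process_mono (hQ : ∀ n, Monotone (Q n)) (n : ℕ) {j j' : ℕ} (h : j ≤ j') :
    freq (fun π : EdgeOrdering n => Q n (processGraph π j)) ≤
      freq (fun π : EdgeOrdering n => Q n (processGraph π j')) :=
  freq_mono fun π => hQ n (processGraph_mono π h)

lemma tendsto_processTime_div_choose {c : ℝ} (hc : 0 ≤ c) :
    Tendsto (fun n : ℕ => (processTime c n : ℝ) / (n.choose 2 * (Real.log n / n))) atTop (𝓝 c) := by
  have h := (tendsto_processTime_div hc).div tendsto_choose_two_div_sq (by norm_num)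
  rw [show c / 2 / (1 / 2) = c by ring] at h
  refine h.congr' ?_
  filter_upwards [eventually_pos_log] with n hn
  have := hn.1.ne'
  simp only [Pi.div_apply]
  field_simp

/-- Monotone properties which hold whp in the process at density `c` hold uniformly whp in binomial
random graphs with larger density. -/
lemma eventually_binomialRandom_ge (hQ : ∀ n, Monotone (Q n)) {c c' : ℝ} (hc : 0 < c) (hcc : c < c')
    (h : Tendsto (fun n : ℕ => freq (fun π : EdgeOrdering n =>
      ¬ Q n (processGraph π (processTime c n)))) atTop (𝓝 0)) {η : ℝ} (hη : 0 < η) :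
    ∀ᶠ n : ℕ in atTop, ∀ p : unitInterval, c' * (Real.log n / n) ≤ p →
      1 - η ≤ (SimpleGraph.binomialRandom (Fin n) p {G | Q n G}).toReal := by
  -- The intermediate `d` absorbs the convergence of `processTime c n`, so that the mean `N * p`
  -- exceeds `m` by a constant factor.
  obtain ⟨d, hcd, hdc⟩ := exists_between hcc
  have hc' : 0 < c' := hc.trans hcc
  have hκ : 0 < 1 - d / c' := by rw [sub_pos, div_lt_one hc']; exact hdc
  have hlim := (tendsto_inv_atTop_zero.comp (tendsto_processTime_atTop hc)).const_mul
    (((1 - d / c') ^ 2)⁻¹)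
  rw [mul_zero] at hlim
  filter_upwards [(tendsto_processTime_div_choose hc.le).eventually_le_const hcd,
    eventually_pos_log, h.eventually_le_const (half_pos hη),
    hlim.eventually_le_const (half_pos hη), eventually_processTime_le hc.le,
    (tendsto_processTime_atTop hc).eventually_gt_atTop 0] with n g1 g2 g3 g4 g5 g6 p hp
  set m := processTime c n
  set N := n.choose 2
  set f : ℕ → ℝ := fun j => freq (fun π : EdgeOrdering n => Q n (processGraph π j))
  have hN0 : (0 : ℝ) < N := by exact_mod_cast (by omega : 0 < N)
  have hln : 0 < Real.log n / n := div_pos g2.2 g2.1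
  have hp0 : (0 : ℝ) < p := lt_of_lt_of_le (by positivity) hp
  have hmNp : (m : ℝ) ≤ d / c' * (N * p) := by
    rw [div_le_iff₀ (by positivity)] at g1
    calc (m : ℝ) ≤ d * (N * (Real.log n / n)) := g1
      _ = d / c' * (N * (c' * (Real.log n / n))) := by field_simp
      _ ≤ _ := by
          have : 0 < d := hc.trans hcd
          gcongr
  have hfm : 1 - η / 2 ≤ f m := by
    have := freq_add_freq_not (fun π : EdgeOrdering n => Q n (processGraph π m))
    simp only [f]
    linarith
  have hNp0 : 0 < (N : ℝ) * p := by positivity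
  have hmNp' : (m : ℝ) ≤ N * p := hmNp.trans (mul_le_of_le_one_left hNp0.le (by linarith))
  rw [binomialRandom_eq_sum]
  have hcheb := sum_binomialWeight_le (N := N) p.2.1 p.2.2 (d := (1 - d / c') * (N * p))
    (by positivity) (fun j => j < m) (fun j hj => by
      have hjm : (j : ℝ) ≤ m := by exact_mod_cast (show j < m from hj).le
      refine pow_le_pow_left₀ (by positivity) ?_ 2
      linarith)
  -- The Chebyshev bound is of order `1 / (N * p) ≤ 1 / m`, which makes the estimate uniform in `p`.
  have hb : (N : ℝ) * p / ((1 - d / c') * (N * p)) ^ 2 ≤ η / 2 := by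
    refine le_trans ?_ g4
    rw [mul_pow]
    calc (N : ℝ) * p / ((1 - d / c') ^ 2 * ((N : ℝ) * (p : ℝ)) ^ 2)
        = ((1 - d / c') ^ 2)⁻¹ * ((N : ℝ) * (p : ℝ))⁻¹ := by
          field_simp
      _ ≤ ((1 - d / c') ^ 2)⁻¹ * (m : ℝ)⁻¹ := by gcongr
  -- Terms with at least `m` edges are bounded below by monotonicity; the few with fewer edges are
  -- given up.
  have hmain : f m * ∑ j ∈ Finset.range (N + 1), binomialWeight N p j -
      ∑ j ∈ Finset.range (N + 1), (if j < m then binomialWeight N p j else 0) ≤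
      ∑ j ∈ Finset.range (N + 1), binomialWeight N p j * f j := by
    rw [Finset.mul_sum, ← Finset.sum_sub_distrib]
    refine Finset.sum_le_sum fun j _ => ?_
    have hw := binomialWeight_nonneg (N := N) p.2.1 p.2.2 j
    have hf0 : 0 ≤ f j := freq_nonneg _
    have hf1 : f m ≤ 1 := freq_le_one _
    split_ifs with hj
    · nlinarith
    · have := freq_process_mono hQ n (not_lt.1 hj)
      rw [sub_zero, mul_comm]
      exact mul_le_mul_of_nonneg_left this hw
  rw [sum_binomialWeight, mul_one] at hmain
  linarith

/-- Monotone properties which fail whp in the process at density `c` fail uniformly whp in binomial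
random graphs with smaller density. -/
lemma eventually_binomialRandom_le (hQ : ∀ n, Monotone (Q n)) {c c' : ℝ} (hc' : 0 < c')
    (hcc : c' < c) (h : Tendsto (fun n : ℕ => freq (fun π : EdgeOrdering n =>
      Q n (processGraph π (processTime c n)))) atTop (𝓝 0)) {η : ℝ} (hη : 0 < η) :
    ∀ᶠ n : ℕ in atTop, ∀ p : unitInterval, (p : ℝ) ≤ c' * (Real.log n / n) →
      (SimpleGraph.binomialRandom (Fin n) p {G | Q n G}).toReal ≤ η := by
  obtain ⟨d, hcd, hdc⟩ := exists_between hcc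
  have hc : 0 < c := hc'.trans hcc
  have hd : 0 < d := hc'.trans hcd
  have hκ : 0 < 1 - c' / d := by rw [sub_pos, div_lt_one hd]; exact hcd
  have hlim := (tendsto_inv_atTop_zero.comp (tendsto_processTime_atTop hc)).const_mul
    (((1 - c' / d) ^ 2)⁻¹)
  rw [mul_zero] at hlim
  filter_upwards [(tendsto_processTime_div_choose hc.le).eventually_const_le hdc,
    eventually_pos_log, h.eventually_le_const (half_pos hη),
    hlim.eventually_le_const (half_pos hη), eventually_processTime_le hc.le,
    (tendsto_processTime_atTop hc).eventually_gt_atTop 0] with n g1 g2 g3 g4 g5 g6 p hp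
  set m := processTime c n
  set N := n.choose 2
  set f : ℕ → ℝ := fun j => freq (fun π : EdgeOrdering n => Q n (processGraph π j))
  have hN0 : (0 : ℝ) < N := by exact_mod_cast (by omega : 0 < N)
  have hln : 0 < Real.log n / n := div_pos g2.2 g2.1
  have hp0 : (0 : ℝ) ≤ p := p.2.1
  have hmNp : (N : ℝ) * p ≤ c' / d * m := by
    rw [le_div_iff₀ (by positivity)] at g1
    calc (N : ℝ) * p ≤ N * (c' * (Real.log n / n)) := by gcongr
      _ = c' / d * (d * (N * (Real.log n / n))) := by field_simp
      _ ≤ _ := by gcongr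
  have hmNp' : (N : ℝ) * p ≤ m := hmNp.trans (mul_le_of_le_one_left g6.le (by linarith))
  rw [binomialRandom_eq_sum]
  have hcheb := sum_binomialWeight_le (N := N) p.2.1 p.2.2 (d := (1 - c' / d) * m)
    (by positivity) (fun j => m < j) (fun j hj => by
      have hjm : (m : ℝ) ≤ j := by exact_mod_cast (show m < j from hj).le
      rw [← neg_sq ((N : ℝ) * p - j)]
      refine pow_le_pow_left₀ (by positivity) ?_ 2
      linarith)
  have hb : (N : ℝ) * p / ((1 - c' / d) * m) ^ 2 ≤ η / 2 := by
    refine le_trans ?_ g4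
    rw [mul_pow]
    calc (N : ℝ) * p / ((1 - c' / d) ^ 2 * (m : ℝ) ^ 2) ≤ m / ((1 - c' / d) ^ 2 * (m : ℝ) ^ 2) := by
          gcongr
      _ = ((1 - c' / d) ^ 2)⁻¹ * (m : ℝ)⁻¹ := by field_simp
  -- Terms with at most `m` edges are bounded above by monotonicity; for those with more edges the
  -- frequency is bounded by one.
  have hmain : ∑ j ∈ Finset.range (N + 1), binomialWeight N p j * f j ≤
      f m * ∑ j ∈ Finset.range (N + 1), binomialWeight N p j +
      ∑ j ∈ Finset.range (N + 1), (if m < j then binomialWeight N p j else 0) := by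
    rw [Finset.mul_sum, ← Finset.sum_add_distrib]
    refine Finset.sum_le_sum fun j _ => ?_
    have hw := binomialWeight_nonneg (N := N) p.2.1 p.2.2 j
    have hf0 : 0 ≤ f m := freq_nonneg _
    have hf1 : f j ≤ 1 := freq_le_one _
    split_ifs with hj
    · nlinarith
    · have := freq_process_mono hQ n (not_lt.1 hj)
      rw [add_zero, mul_comm (f m)]
      exact mul_le_mul_of_nonneg_left this hw
  rw [sum_binomialWeight, mul_one] at hmain
  linarith

end Transfer

/-! ### Hitting times and the sharp threshold -/

section Threshold

variable {W : Type*} [Fintype W] {H : SimpleGraph W} [DecidableRel H.Adj]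

lemma processTime_mono {c c' : ℝ} (h : c ≤ c') (n : ℕ) : processTime c n ≤ processTime c' n := by
  have : 0 ≤ (n : ℝ) * Real.log n := mul_nonneg (Nat.cast_nonneg n) (Real.log_natCast_nonneg n)
  exact Nat.floor_mono (by gcongr)

lemma tendsto_freq_or {Ω : ℕ → Type*} {P Q : ∀ n, Ω n → Prop}
    (hP : Tendsto (fun n => freq (P n)) atTop (𝓝 0)) (hQ : Tendsto (fun n => freq (Q n)) atTop (𝓝 0)) :
    Tendsto (fun n => freq (fun ω => P n ω ∨ Q n ω)) atTop (𝓝 0) := by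
  have h := hP.add hQ
  rw [add_zero] at h
  exact squeeze_zero (fun _ => freq_nonneg _) (fun _ => freq_or_le _ _) h

lemma tendsto_freq_of_imp {Ω : ℕ → Type*} [∀ n, Finite (Ω n)] {P Q : ∀ n, Ω n → Prop}
    (hQ : Tendsto (fun n => freq (Q n)) atTop (𝓝 0)) (h : ∀ᶠ n in atTop, ∀ ω, P n ω → Q n ω) :
    Tendsto (fun n => freq (P n)) atTop (𝓝 0) :=
  squeeze_zero' (Eventually.of_forall fun _ => freq_nonneg _) (h.mono fun _ hn => freq_mono hn) hQ

lemma tendsto_freq_percolates (hδ : H.minDegree = 2) {c : ℝ} (hc : 0 < c) (hc1 : c < 1) :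
    Tendsto (fun n : ℕ => freq (fun π : EdgeOrdering n =>
      Percolates H (processGraph π (processTime c n)))) atTop (𝓝 0) := by
  refine tendsto_freq_of_imp (tendsto_freq_no_isolated hc hc1) ?_
  filter_upwards [eventually_ge_atTop 2] with n hn π hπ
  have : Nontrivial (Fin n) := Fin.nontrivial_iff_two_le.2 hn
  push Not
  exact hπ.exists_adj hδ

lemma tendsto_freq_not_percolates (hρ : activationDensity H = 1) (hδ : H.minDegree = 2) {c : ℝ}
    (hc : 1 < c) :
    Tendsto (fun n : ℕ => freq (fun π : EdgeOrdering n =>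
      ¬ Percolates H (processGraph π (processTime c n)))) atTop (𝓝 0) := by
  obtain ⟨β, _, B, hB, hperc⟩ := exists_isSparse_forall_percolates H hρ hδ
  refine tendsto_freq_of_imp (tendsto_freq_or tendsto_freq_hasSmallComponent
    (tendsto_freq_or (tendsto_freq_hasIsolatedEdge (c := 4 / 5) (by norm_num))
    (tendsto_freq_or (tendsto_freq_exists_isolated hc)
    (tendsto_freq_not_contains hB (c := c) (by linarith))))) ?_
  filter_upwards [eventually_ge_atTop 2] with n hn π hπ
  contrapose! hπ
  have : NeZero n := ⟨by omega⟩
  obtain ⟨h1, h2, h3, φ, hφ, hφB⟩ := hπ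
  exact hperc _ φ hφ hφB
    (processGraph_connected (processTime_mono (by linarith) n) h1 h2 h3)

/-- Outside an event of vanishing probability, connectivity and percolation hold at the same set of
times, so the minima of these sets agree. -/
lemma tendsto_processProb_hittingTime_eq (hρ : activationDensity H = 1) (hδ : H.minDegree = 2) :
    Tendsto (fun n : ℕ => processProb n
      {π | hittingTime (Percolates H) π = hittingTime SimpleGraph.Connected π}) atTop (𝓝 1) := by
  obtain ⟨β, _, B, hB, hperc⟩ := exists_isSparse_forall_percolates H hρ hδ
  have hnot : Tendsto (fun n : ℕ => freq (fun π : EdgeOrdering n =>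
      ¬ hittingTime (Percolates H) π = hittingTime SimpleGraph.Connected π)) atTop (𝓝 0) := by
    refine tendsto_freq_of_imp (tendsto_freq_or tendsto_freq_hasSmallComponent
      (tendsto_freq_or (tendsto_freq_hasIsolatedEdge (c := 4 / 5) (by norm_num))
      (tendsto_freq_or (tendsto_freq_no_isolated (c := 4 / 5) (by norm_num) (by norm_num))
      (tendsto_freq_not_contains hB (c := 4 / 5) (by norm_num))))) ?_
    filter_upwards [eventually_ge_atTop 2] with n hn π hπ
    contrapose! hπ
    have : NeZero n := ⟨by omega⟩
    have : Nontrivial (Fin n) := Fin.nontrivial_iff_two_le.2 hn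
    obtain ⟨h1, h2, ⟨v, hv⟩, φ, hφ, hφB⟩ := hπ
    unfold hittingTime
    congr 1
    ext t
    rw [Set.mem_ofPred_eq, Set.mem_ofPred_eq]
    -- Up to this time the isolated vertex `v` excludes both properties; later each property implies
    -- the other.
    rcases le_total t (processTime (4 / 5) n) with ht | ht
    · have hvt : ∀ u, ¬ (processGraph π t).Adj v u := fun u h => hv u (processGraph_mono π ht h)
      refine ⟨fun h => ?_, fun h => ?_⟩
      · obtain ⟨u, hu⟩ := h.exists_adj hδ v
        exact absurd hu (hvt u)
      · obtain ⟨u, hu⟩ := h.preconnected.exists_adj_of_nontrivial v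
        exact absurd hu (hvt u)
    · exact ⟨fun h => processGraph_connected ht h1 h2 (h.exists_adj hδ),
        hperc _ φ hφ fun a b hab => processGraph_mono π ht (hφB a b hab)⟩
  have h := hnot.const_sub 1
  rw [sub_zero] at h
  refine h.congr fun n => ?_
  rw [processProb_eq_freq, ← freq_add_freq_not (fun π : EdgeOrdering n =>
    hittingTime (Percolates H) π = hittingTime SimpleGraph.Connected π)]
  ring

lemma monotone_percolates {W : Type*} [Finite W] {H : SimpleGraph W} (n : ℕ) :
    Monotone fun G : SimpleGraph (Fin n) => Percolates H G :=
  fun _ _ h hG => Percolates.mono hG h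

lemma eventually_binomialRandom_percolates_ge (hρ : activationDensity H = 1)
    (hδ : H.minDegree = 2) {c η : ℝ} (hc : 1 < c) (hη : 0 < η) :
    ∀ᶠ n : ℕ in atTop, ∀ p : unitInterval, c * (Real.log n / n) ≤ p →
      1 - η ≤ (SimpleGraph.binomialRandom (Fin n) p {G | Percolates H G}).toReal := by
  obtain ⟨d, hd, hdc⟩ := exists_between hc
  exact eventually_binomialRandom_ge monotone_percolates (by linarith) hdc
    (tendsto_freq_not_percolates hρ hδ hd) hη

lemma eventually_binomialRandom_percolates_le (hδ : H.minDegree = 2) {c η : ℝ} (hc0 : 0 < c)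
    (hc : c < 1) (hη : 0 < η) :
    ∀ᶠ n : ℕ in atTop, ∀ p : unitInterval, (p : ℝ) ≤ c * (Real.log n / n) →
      (SimpleGraph.binomialRandom (Fin n) p {G | Percolates H G}).toReal ≤ η := by
  obtain ⟨d, hd, hdc⟩ := exists_between hc
  exact eventually_binomialRandom_le monotone_percolates hc0 hd
    (tendsto_freq_percolates hδ (hc0.trans hd) hdc) hη

lemma half_le_iff {x : ℝ≥0∞} (hx : x ≠ ∞) : 1 / 2 ≤ x ↔ (1 / 2 : ℝ) ≤ x.toReal := by
  rw [← ENNReal.ofReal_le_iff_le_toReal hx, ENNReal.ofReal_div_of_pos two_pos]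
  simp

lemma eventually_criticalThreshold_le (hρ : activationDensity H = 1) (hδ : H.minDegree = 2)
    {c : ℝ} (hc : 1 < c) :
    ∀ᶠ n : ℕ in atTop, criticalThreshold H n ≤ c * (Real.log n / n) := by
  have hlim := tendsto_log_div_natCast.const_mul c
  rw [mul_zero] at hlim
  filter_upwards [eventually_binomialRandom_percolates_ge hρ hδ hc (half_pos one_pos),
    eventually_pos_log, hlim.eventually_le_const one_pos] with n hn hpos hle
  have h0 : 0 < c * (Real.log n / n) := mul_pos (by linarith) (div_pos hpos.2 hpos.1)
  refine csInf_le ⟨0, fun x ⟨_, _, hx, _⟩ => hx.le⟩ ⟨⟨_, h0.le, hle⟩, rfl, h0, ?_⟩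
  rw [half_le_iff (MeasureTheory.measure_ne_top _ _)]
  have := hn ⟨_, h0.le, hle⟩ le_rfl
  linarith

/-- The set in `criticalThreshold` must be shown nonempty, since the infimum of the empty set is `0`
by convention; density `2 log n / n` is a witness. -/
lemma eventually_le_criticalThreshold (hρ : activationDensity H = 1) (hδ : H.minDegree = 2)
    {c : ℝ} (hc0 : 0 < c) (hc : c < 1) :
    ∀ᶠ n : ℕ in atTop, c * (Real.log n / n) ≤ criticalThreshold H n := by
  have hlim := tendsto_log_div_natCast.const_mul 2
  rw [mul_zero] at hlim
  filter_upwards [eventually_binomialRandom_percolates_ge hρ hδ one_lt_two (half_pos one_pos),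
    eventually_binomialRandom_percolates_le hδ hc0 hc (show (0 : ℝ) < 1 / 4 by norm_num),
    eventually_pos_log, hlim.eventually_le_const one_pos] with n hn hn' hpos hle
  have h0 : 0 < 2 * (Real.log n / n) := mul_pos two_pos (div_pos hpos.2 hpos.1)
  refine le_csInf ⟨_, ⟨_, h0.le, hle⟩, rfl, h0, ?_⟩ ?_
  · rw [half_le_iff (MeasureTheory.measure_ne_top _ _)]
    have := hn ⟨_, h0.le, hle⟩ le_rfl
    linarith
  · rintro _ ⟨p, rfl, -, hp⟩
    rw [half_le_iff (MeasureTheory.measure_ne_top _ _)] at hp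
    by_contra! hlt
    have := hn' p hlt.le
    linarith

lemma isEquivalent_criticalThreshold (hρ : activationDensity H = 1) (hδ : H.minDegree = 2) :
    (fun n : ℕ => criticalThreshold H n) ~[atTop] (fun n : ℕ => Real.log n / n) := by
  refine (isLittleO_iff).2 fun c hc => ?_
  -- Capping `c` at `1/2` keeps the constant `1 - min c (1 / 2)` positive.
  have hm : 0 < min c (1 / 2) := lt_min hc (by norm_num)
  have hm2 : min c (1 / 2) ≤ 1 / 2 := min_le_right _ _
  filter_upwards [eventually_criticalThreshold_le hρ hδ (show 1 < 1 + c by linarith),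
    eventually_le_criticalThreshold hρ hδ (show 0 < 1 - min c (1 / 2) by linarith) (by linarith),
    eventually_pos_log] with n h1 h2 hpos
  have h0 : 0 < Real.log n / n := div_pos hpos.2 hpos.1
  have := mul_le_mul_of_nonneg_right (min_le_left c (1 / 2)) h0.le
  rw [Real.norm_of_nonneg h0.le, Real.norm_eq_abs, abs_le, Pi.sub_apply]
  constructor <;> linarith

lemma tendsto_binomialRandom_percolates_zero (hρ : activationDensity H = 1) (hδ : H.minDegree = 2)
    {ε : ℝ} (hε : 0 < ε) {p : ℕ → unitInterval}
    (hp : ∀ᶠ n : ℕ in atTop, (p n : ℝ) ≤ (1 - ε) * criticalThreshold H n) :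
    Tendsto (fun n : ℕ =>
      SimpleGraph.binomialRandom (Fin n) (p n) {G | Percolates H G}) atTop (𝓝 0) := by
  rw [← ENNReal.tendsto_toReal_iff (fun n => MeasureTheory.measure_ne_top _ _) ENNReal.zero_ne_top,
    ENNReal.toReal_zero]
  -- With `d ≤ 1/2` the factor `1 - d` is positive even if `ε > 1`, and `(1 - d) * (1 + d) < 1` puts
  -- `p n` below the threshold density.
  obtain ⟨d, hd0, hdε, hd2⟩ : ∃ d : ℝ, 0 < d ∧ d ≤ ε ∧ d ≤ 1 / 2 :=
    ⟨min ε (1 / 2), lt_min hε (by norm_num), min_le_left _ _, min_le_right _ _⟩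
  refine tendsto_order.2 ⟨fun a ha => Eventually.of_forall fun n => ha.trans_le
    ENNReal.toReal_nonneg, fun a ha => ?_⟩
  filter_upwards [hp, eventually_criticalThreshold_le hρ hδ (show 1 < 1 + d by linarith),
    eventually_le_criticalThreshold hρ hδ (c := 1 / 2) (by norm_num) (by norm_num),
    eventually_binomialRandom_percolates_le hδ (c := (1 - d) * (1 + d)) (by nlinarith)
      (by nlinarith) (half_pos ha), eventually_pos_log] with n h1 h2 h3 h4 hpos
  have h0 : 0 < Real.log n / n := div_pos hpos.2 hpos.1
  refine (h4 (p n) ?_).trans_lt (half_lt_self ha)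
  calc (p n : ℝ) ≤ (1 - ε) * criticalThreshold H n := h1
    _ ≤ (1 - d) * criticalThreshold H n :=
        mul_le_mul_of_nonneg_right (by linarith) (le_trans (by positivity) h3)
    _ ≤ (1 - d) * ((1 + d) * (Real.log n / n)) :=
        mul_le_mul_of_nonneg_left h2 (by linarith)
    _ = _ := by ring

lemma tendsto_binomialRandom_percolates_one (hρ : activationDensity H = 1) (hδ : H.minDegree = 2)
    {ε : ℝ} (hε : 0 < ε) {p : ℕ → unitInterval}
    (hp : ∀ᶠ n : ℕ in atTop, (1 + ε) * criticalThreshold H n ≤ (p n : ℝ)) :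
    Tendsto (fun n : ℕ =>
      SimpleGraph.binomialRandom (Fin n) (p n) {G | Percolates H G}) atTop (𝓝 1) := by
  rw [← ENNReal.tendsto_toReal_iff (fun n => MeasureTheory.measure_ne_top _ _) ENNReal.one_ne_top,
    ENNReal.toReal_one]
  -- Then `(1 + ε) * c > 1` while `c < 1` is still a valid lower constant for the threshold.
  obtain ⟨c, hc, hc1⟩ := exists_between (show (1 + ε)⁻¹ < 1 from inv_lt_one_of_one_lt₀ (by linarith))
  have hc0 : 0 < c := lt_trans (by positivity) hc
  rw [inv_lt_iff_one_lt_mul₀' (by linarith)] at hc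
  refine tendsto_order.2 ⟨fun a ha => ?_, fun a ha => Eventually.of_forall fun n => ?_⟩
  · have hη : 0 < (1 - a) / 2 := by linarith
    filter_upwards [hp, eventually_le_criticalThreshold hρ hδ hc0 hc1,
      eventually_binomialRandom_percolates_ge hρ hδ hc hη] with n h1 h2 h3
    have := h3 (p n) (by
      rw [mul_assoc]
      exact (mul_le_mul_of_nonneg_left h2 (by linarith)).trans h1)
    linarith
  · exact (ENNReal.toReal_mono ENNReal.one_ne_top MeasureTheory.prob_le_one).trans_lt
      (by simpa using ha)

end Threshold

theorem mainTheorem4 {W : Type*} [Fintype W] (H : SimpleGraph W) [DecidableRel H.Adj]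
    (hρ : activationDensity H = 1) (hδ : H.minDegree = 2) :
    -- whp the hitting times for percolation and for connectivity coincide
    Tendsto
      (fun n : ℕ => processProb n
        {π | hittingTime (Percolates H) π = hittingTime SimpleGraph.Connected π})
      atTop (𝓝 1) ∧
    -- the critical threshold is asymptotic to `log n / n`
    (fun n : ℕ => criticalThreshold H n) ~[atTop] (fun n : ℕ => Real.log n / n) ∧
    -- the threshold is sharp
    (∀ ε : ℝ, 0 < ε → ∀ p : ℕ → unitInterval,
      ((∀ᶠ n : ℕ in atTop, (p n : ℝ) ≤ (1 - ε) * criticalThreshold H n) →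
        Tendsto (fun n : ℕ =>
          SimpleGraph.binomialRandom (Fin n) (p n) {G | Percolates H G}) atTop (𝓝 0)) ∧
      ((∀ᶠ n : ℕ in atTop, (1 + ε) * criticalThreshold H n ≤ (p n : ℝ)) →
        Tendsto (fun n : ℕ =>
          SimpleGraph.binomialRandom (Fin n) (p n) {G | Percolates H G}) atTop (𝓝 1))) :=
  ⟨tendsto_processProb_hittingTime_eq hρ hδ, isEquivalent_criticalThreshold hρ hδ,
    fun _ hε _ => ⟨tendsto_binomialRandom_percolates_zero hρ hδ hε,
      tendsto_binomialRandom_percolates_one hρ hδ hε⟩⟩
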